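/- Let $T = T[1]\dots T[n]$ be a string over an ordered alphabet of size $\sigma$, identified with $\{1,\dots,\sigma\}$, whose last symbol $T[n]$ is a sentinel, i.e. strictly smaller than all other symbols of $T$. Write $T_i = T[i,n]$ for the suffixes. The suffix array $\mathsf{SA}[1,n]$ lists the positions $1,\dots,n$ so that $T_{\mathsf{SA}[1]} < T_{\mathsf{SA}[2]} < \dots < T_{\mathsf{SA}[n]}$ lexicographically. A Lyndon word is a primitive word that is lexicographically least among its rotations, and the Lyndon array is $\mathsf{LA}[i] = \max\{\ell \ge 1 : i+\ell-1\le n,\ T[i,i+\ell-1] \text{ is a Lyndon word}\}$ for $1 \le i \le n$. (1) The suffix array and the Lyndon array can be computed simultaneously in $O(n)$ time (for a fixed alphabet, or more generally for $\sigma = O(n)$) using $n + \sigma + O(1)$ words of working space, i.e. space in addition to the read-only input and the two output arrays of $n$ words each. Precisely: there are constants $k, e, c$ and one word-RAM program with $k$ registers such that for all $\sigma$, all such $T$ and every word length $w$ with $n+\sigma+k+e < 2^w$, the program, run with a working array of $n+\sigma+e$ words of $w$ bits and with arbitrary initial contents of all registers and arrays other than the input, halts after at most $c\,(n+\sigma)$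 steps with the suffix array of $T$ in $\mathsf{SA}[1,n]$ and the Lyndon array of $T$ in $\mathsf{LA}[1,n]$. (2) The two pointer arrays $\mathsf{NEXT}$ and $\mathsf{PREV}$ can be merged into one array $\mathsf{A}[1,n]$. Relative to the current contents of an array $\mathsf{LA}[1,n]$, let $\mathsf{NEXT}[i]$ be the least $\ell$ with $i<\ell\le n$ and $\mathsf{LA}[\ell]=0$, or $n+1$ if there is none, and let $\mathsf{PREV}[i]$ be the $\ell$ with $\mathsf{LA}[\ell]=0$ and $\mathsf{NEXT}[\ell]=i$, or $0$ if there is none. Start with $\mathsf{LA}[i]=0$ and $\mathsf{A}[i]=i+1$ for all $i$. For $i=n,n-1,\dots,1$ take $j=\mathsf{SA}[i]$, let $q=\mathsf{A}[j]$, and let $p = 0$ if $j=1$, $p = j-1$ if $j \ge 2$ and $\mathsf{LA}[j-1]=0$, and $p=\mathsf{A}[j-1]$ otherwise; set $\mathsf{LA}[j]=q-j$; if $p>0$, set $\mathsf{A}[p]=q$; and if $q<n+1$, set $\mathsf{A}[q-1]=p$. Then before the first and after every iteration, for every $j$ with $\mathsf{LA}[j]=0$ we have $\mathsf{A}[j]=\mathsf{NEXT}[j]$,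 and $\mathsf{PREV}[j]$ equals $0$ if $j=1$, $j-1$ if $j\ge 2$ and $\mathsf{LA}[j-1]=0$, and $\mathsf{A}[j-1]$ otherwise. After the last iteration, $\mathsf{LA}$ is the Lyndon array of $T$. -/

import Mathlib

/-! ### Strings, suffix arrays, Lyndon arrays (positions are numbered from 1) -/

namespace LyndonSA

/-- The suffix `T_i = T[i, n]`. -/
def suffix (T : List ℕ) (i : ℕ) : List ℕ := T.drop (i - 1)

/-- The factor `T[i, i + l - 1]` of length `l` (when `1 ≤ i` and `i + l ≤ n + 1`). -/
def factor (T : List ℕ) (i l : ℕ) : List ℕ := (T.drop (i - 1)).take l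

/-- A string is primitive if it is not `S ^ k` for a string `S` and some `k > 1`. -/
def IsPrimitive (u : List ℕ) : Prop :=
  ¬ ∃ (S : List ℕ) (k : ℕ), 1 < k ∧ u = (List.replicate k S).flatten

/-- A Lyndon word: primitive, and lexicographically least among its rotations. -/
def IsLyndonWord (u : List ℕ) : Prop :=
  IsPrimitive u ∧ ∀ k : ℕ, u ≤ u.rotate k

/-- `S[1..n]` is the suffix array of `T`: it lists the positions `1, …, n` so that the suffixes
starting there are in strictly increasing lexicographic order. -/
def IsSuffixArray (T : List ℕ) (S : ℕ → ℕ) : Prop :=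
  (∀ i, 1 ≤ i → i ≤ T.length → 1 ≤ S i ∧ S i ≤ T.length) ∧
  ∀ i j, 1 ≤ i → i < j → j ≤ T.length → suffix T (S i) < suffix T (S j)

/-- `L[1..n]` is the Lyndon array of `T`: `L[i]` is the length of the longest factor of `T`
starting at `i` that is a Lyndon word. -/
def IsLyndonArray (T : List ℕ) (L : ℕ → ℕ) : Prop :=
  ∀ i, 1 ≤ i → i ≤ T.length →
    IsGreatest {l : ℕ | 1 ≤ l ∧ i + l ≤ T.length + 1 ∧ IsLyndonWord (factor T i l)} (L i)

/-- `T` is nonempty and its last symbol is strictly smaller than all its other symbols. -/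
def EndsWithSentinel (T : List ℕ) : Prop :=
  ∃ (S : List ℕ) (z : ℕ), T = S ++ [z] ∧ ∀ x ∈ S, z < x

/-! ### A word RAM

Programs have `k` registers, read-only access to the input (the text `T[1..n]`, its length `n`
and the alphabet size `σ`), and read/write access to the output arrays `SA[1..n]`, `LA[1..n]` and
to one working array `W[1..workLen]`. Registers and cells hold words of `w` bits. -/

/-- The read/write arrays. -/
inductive Arr
  | sa
  | la
  | work
  deriving DecidableEq

inductive Operand (k : ℕ)
  | reg (r : Fin k)
  | lit (c : ℕ)
  | textLen
  | alphabetSize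

inductive BinOp
  | add
  | sub
  | mul
  | div
  | mod

inductive Rel
  | lt
  | le
  | eq
  | ne

/-- Programs with `k` registers. -/
inductive Cmd (k : ℕ)
  | skip
  /-- `r := a op b` -/
  | assign (r : Fin k) (op : BinOp) (a b : Operand k)
  /-- `r := T[i]` -/
  | loadText (r : Fin k) (i : Operand k)
  /-- `r := arr[i]` -/
  | load (r : Fin k) (arr : Arr) (i : Operand k)
  /-- `arr[i] := a` -/
  | store (arr : Arr) (i a : Operand k)
  | seq (p q : Cmd k)
  /-- if `a rel b` then `p` else `q` -/
  | ite (rel : Rel) (a b : Operand k) (p q : Cmd k)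
  /-- while `a rel b` do `p` -/
  | loop (rel : Rel) (a b : Operand k) (p : Cmd k)

/-- The part of the machine that a run does not change: the word length in bits, the input, and the
number of cells of the working array. -/
structure Machine where
  wordBits : ℕ
  text : List ℕ
  alphabetSize : ℕ
  workLen : ℕ

/-- The number of cells of each array; the cells are numbered from 1. -/
def Machine.len (M : Machine) : Arr → ℕ
  | .sa => M.text.length
  | .la => M.text.length
  | .work => M.workLen

/-- Contents of the registers and of the read/write arrays. Only the cells `1, …, M.len arr` of an
array `arr` can be accessed, see `Exec`. -/
structure State (k : ℕ) where
  regs : Fin k → ℕ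
  mem : Arr → ℕ → ℕ

/-- All registers and cells contain `w`-bit words (they are otherwise arbitrary). -/
def State.HoldsWords {k : ℕ} (w : ℕ) (s : State k) : Prop :=
  (∀ r, s.regs r < 2 ^ w) ∧ ∀ arr i, s.mem arr i < 2 ^ w

def State.setReg {k : ℕ} (s : State k) (r : Fin k) (v : ℕ) : State k :=
  { s with regs := Function.update s.regs r v }

def State.setCell {k : ℕ} (s : State k) (arr : Arr) (i v : ℕ) : State k :=
  { s with mem := Function.update s.mem arr (Function.update (s.mem arr) i v) }

/-- Values of operands; everything is a `w`-bit word. -/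
def Operand.eval {k : ℕ} (M : Machine) (s : State k) : Operand k → ℕ
  | .reg r => s.regs r
  | .lit c => c % 2 ^ M.wordBits
  | .textLen => M.text.length % 2 ^ M.wordBits
  | .alphabetSize => M.alphabetSize % 2 ^ M.wordBits

/-- Arithmetic of `w`-bit words: sums and products modulo `2 ^ w`, differences cut off at `0`. -/
def BinOp.eval (w : ℕ) : BinOp → ℕ → ℕ → ℕ
  | .add, x, y => (x + y) % 2 ^ w
  | .sub, x, y => x - y
  | .mul, x, y => (x * y) % 2 ^ w
  | .div, x, y => x / y
  | .mod, x, y => x % y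

def Rel.Holds : Rel → ℕ → ℕ → Prop
  | .lt, x, y => x < y
  | .le, x, y => x ≤ y
  | .eq, x, y => x = y
  | .ne, x, y => x ≠ y

/-- `Exec M p s t s'`: started in state `s`, the program `p` halts after `t` steps in state `s'`,
and all its memory accesses are within bounds. Each operation, each memory access and each
evaluation of a condition costs one step. A program that does not halt or that tries to access a
cell outside the bounds of an array has no execution. -/
inductive Exec {k : ℕ} (M : Machine) : Cmd k → State k → ℕ → State k → Prop
  | skip (s : State k) : Exec M .skip s 1 s
  | assign (s : State k) (r : Fin k) (op : BinOp) (a b : Operand k) :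
      Exec M (.assign r op a b) s 1
        (s.setReg r (op.eval M.wordBits (a.eval M s) (b.eval M s)))
  | loadText (s : State k) (r : Fin k) (i : Operand k)
      (h₁ : 1 ≤ i.eval M s) (h₂ : i.eval M s ≤ M.text.length) :
      Exec M (.loadText r i) s 1 (s.setReg r (M.text.getD (i.eval M s - 1) 0))
  | load (s : State k) (r : Fin k) (arr : Arr) (i : Operand k)
      (h₁ : 1 ≤ i.eval M s) (h₂ : i.eval M s ≤ M.len arr) :
      Exec M (.load r arr i) s 1 (s.setReg r (s.mem arr (i.eval M s)))
  | store (s : State k) (arr : Arr) (i a : Operand k)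
      (h₁ : 1 ≤ i.eval M s) (h₂ : i.eval M s ≤ M.len arr) :
      Exec M (.store arr i a) s 1 (s.setCell arr (i.eval M s) (a.eval M s))
  | seq (p q : Cmd k) (s₁ s₂ s₃ : State k) (t₁ t₂ : ℕ)
      (hp : Exec M p s₁ t₁ s₂) (hq : Exec M q s₂ t₂ s₃) :
      Exec M (.seq p q) s₁ (t₁ + t₂) s₃
  | iteTrue (rel : Rel) (a b : Operand k) (p q : Cmd k) (s s' : State k) (t : ℕ)
      (h : rel.Holds (a.eval M s) (b.eval M s)) (hp : Exec M p s t s') :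
      Exec M (.ite rel a b p q) s (1 + t) s'
  | iteFalse (rel : Rel) (a b : Operand k) (p q : Cmd k) (s s' : State k) (t : ℕ)
      (h : ¬ rel.Holds (a.eval M s) (b.eval M s)) (hq : Exec M q s t s') :
      Exec M (.ite rel a b p q) s (1 + t) s'
  | loopDone (rel : Rel) (a b : Operand k) (p : Cmd k) (s : State k)
      (h : ¬ rel.Holds (a.eval M s) (b.eval M s)) :
      Exec M (.loop rel a b p) s 1 s
  | loopStep (rel : Rel) (a b : Operand k) (p : Cmd k) (s₁ s₂ s₃ : State k) (t₁ t₂ : ℕ)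
      (h : rel.Holds (a.eval M s₁) (b.eval M s₁)) (hp : Exec M p s₁ t₁ s₂)
      (hrest : Exec M (.loop rel a b p) s₂ t₂ s₃) :
      Exec M (.loop rel a b p) s₁ (1 + t₁ + t₂) s₃

/-! ### The pointer arrays NEXT and PREV and the merged array A -/

/-- `v = NEXT[i]`: the least position `l > i` of the text with `LA[l] = 0`, or `n + 1` if there is
none. -/
def IsNext (n : ℕ) (LA : ℕ → ℕ) (i v : ℕ) : Prop :=
  IsLeast ({n + 1} ∪ {l : ℕ | i < l ∧ l ≤ n ∧ LA l = 0}) v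

/-- `v = PREV[i]`: the position `l` with `LA[l] = 0` and `NEXT[l] = i`, or `0` if there is none. -/
def IsPrev (n : ℕ) (LA : ℕ → ℕ) (i v : ℕ) : Prop :=
  (1 ≤ v ∧ LA v = 0 ∧ IsNext n LA v i) ∨
  (v = 0 ∧ ∀ l, 1 ≤ l → LA l = 0 → ¬ IsNext n LA l i)

/-- The current contents of the arrays `LA[1..n]` and `A[1..n]`. -/
structure Merged where
  LA : ℕ → ℕ
  A : ℕ → ℕ

/-- `PREV[j]` read off from `A`: `PREV[1] = 0`, and for `j ≥ 2` it is `j - 1` if `LA[j - 1] = 0`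
and `A[j - 1]` otherwise. -/
def Merged.prev (s : Merged) (j : ℕ) : ℕ :=
  if j ≤ 1 then 0 else if s.LA (j - 1) = 0 then j - 1 else s.A (j - 1)

/-- Initially `LA[i] = 0` and `A[i] = NEXT[i] = i + 1`. -/
def Merged.init : Merged where
  LA := fun _ => 0
  A := fun i => i + 1

/-- One iteration, for the position `j`, with `NEXT[j] = A[j]`: set `LA[j] := NEXT[j] - j`, then
`NEXT[PREV[j]] := NEXT[j]` (in `A[PREV[j]]`) if `PREV[j] > 0`, and `PREV[NEXT[j]] := PREV[j]`
(in `A[NEXT[j] - 1]`) if `NEXT[j] < n + 1`. -/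
def Merged.step (n j : ℕ) (s : Merged) : Merged :=
  let nxt := s.A j
  let prv := s.prev j
  let A₁ := if 0 < prv then Function.update s.A prv nxt else s.A
  { LA := Function.update s.LA j (nxt - j)
    A := if nxt < n + 1 then Function.update A₁ (nxt - 1) prv else A₁ }

/-- The arrays after the first `m` iterations, for the positions `SA[n], …, SA[n - m + 1]`. -/
def Merged.run (n : ℕ) (SA : ℕ → ℕ) : ℕ → Merged
  | 0 => Merged.init
  | m + 1 => (Merged.run n SA m).step n (SA (n - m))

end LyndonSA

/-!
The suffix array is computed by the skew algorithm. For a string `s` of length `m` with letters up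
to `K`, the positions that are not multiples of three are sorted by the triples of letters that begin
there, with three passes of counting sort (`csort_run`), and the triples are replaced by their
names. This gives a string of about two thirds of the length whose suffixes are ordered as the
suffixes of `s` at these sample positions (`Reduces.sufLt`). Conversely, the ranks of the suffixes of
the reduced string order the sample positions and, after one letter, the multiples of three; two such
lists can be merged because a suffix of either kind needs at most two letters before its comparison
with the other is a comparison of ranks (`mergeLt_spec`, `expandSuffixes_run`). The reduction is
iterated down to a string of length one, and the suffix arrays are then built on the way back.
The lengths decrease by a factor of at most `5 / 6`, so the total work is linear (`workSum_le`,
`sortSuffixes_run`).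

The space bound holds because the two output arrays serve as memory as long as they are not filled.
The arrays `SA`, `LA` and the working array are interleaved to one flat memory of `3 n + σ + O(1)`
cells (`cellOf`), the reduced strings are stacked from its upper end downwards, and the free part
below always suffices for the counters and for the lists of positions (`topAt_ge`). Addresses in it
are written as `3 * b + i` with a row `b`, as only rows, not addresses, need to fit into machine
words.

Programs are written in a small language of expressions and statements, which is compiled to word-RAM
programs. Loops are treated with an invariant and a potential for the running time
(`Stmt.Run.loop`, `Stmt.RunIn.count`), everything else with weakest preconditions.

For the Lyndon array, the longest Lyndon factor that starts at `j` ends just before the next position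
at which a smaller suffix starts (`IsNextSmaller.isGreatest`). If positions are processed by
decreasing suffixes, then the positions that are not processed yet are those with smaller suffixes,
and they form a doubly linked list in the merged array `A`: the forward pointer of `j` is in `A[j]`,
and its backward pointer, unless it is `j - 1`, is in `A[j - 1]`, which is free, since `j - 1` is no
longer in the list (`Merged.Linked.step`). So the next element after `j` is where the Lyndon factor
ends (`Merged.afterRun`). The columns of the flat memory are the three arrays, and the
program runs the same iterations on them (`runMerged_run`).
-/

set_option linter.constructorNameAsVariable false

namespace LyndonSA

/-! ### A language of expressions and statements over one flat memory -/

/-- Names of the registers that hold program variables. While suffixes are sorted, `lev` is the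
current level of the recursion, `m` the length of the string of this level and `top` the row in
which it begins; `K` bounds its letters, `q` is the number of multiples of `3` below `m` and `np` the
number of sample positions; `tp` is the row of the reduced string, and `b1`, `b2`, `b3` are the rows
of the lists of positions. The others are counters and intermediate values. -/
inductive Var
  | lev | m | top | K | q | np | tp | b1 | b2 | b3 | a | c | x | y | i | j
  deriving DecidableEq

/-- The register of a variable. The variables take the registers below `20`; those from number
`20` on are temporaries. -/
def Var.reg (v : Var) : Fin 64 := Fin.ofNat 64 v.ctorIdx

/-- Temporary registers, for `d < 44`. -/
def tmp (d : ℕ) : Fin 64 := Fin.ofNat 64 (20 + d)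

theorem Var.ctorIdx_lt (v : Var) : v.ctorIdx < 20 := by cases v <;> decide

theorem Var.reg_inj {u v : Var} : u.reg = v.reg ↔ u = v := by
  constructor
  · intro h
    have h1 : u.ctorIdx = v.ctorIdx := by
      have := congrArg Fin.val h
      simp only [Var.reg, Fin.ofNat] at this
      rwa [Nat.mod_eq_of_lt (by have := u.ctorIdx_lt; omega),
        Nat.mod_eq_of_lt (by have := v.ctorIdx_lt; omega)] at this
    rw [← Var.ofNat_ctorIdx u, ← Var.ofNat_ctorIdx v, h1]
  · rintro rfl; rfl

theorem tmp_inj {d e : ℕ} (hd : d < 44) (he : e < 44) : tmp d = tmp e ↔ d = e := by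
  simp only [tmp, Fin.ext_iff, Fin.ofNat]
  rw [Nat.mod_eq_of_lt (by omega), Nat.mod_eq_of_lt (by omega)]
  omega

theorem Var.reg_ne_tmp (v : Var) {d : ℕ} (hd : d < 44) : v.reg ≠ tmp d := by
  have := v.ctorIdx_lt
  simp only [Var.reg, tmp, ne_eq, Fin.ext_iff, Fin.ofNat]
  rw [Nat.mod_eq_of_lt (by omega), Nat.mod_eq_of_lt (by omega)]
  omega

/-- The cell that stands for the flat address `a`. The first `3 * n` addresses run row by row
through the cells `1, …, n` of the three arrays `SA`, `LA`, `W`; the later ones continue in `W`. -/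
def cellOf (n a : ℕ) : Arr × ℕ :=
  if a < 3 * n then
    (if a % 3 = 0 then .sa else if a % 3 = 1 then .la else .work, a / 3 + 1)
  else (.work, a - 3 * n + n + 1)

theorem cellOf_inj {n a b : ℕ} : cellOf n a = cellOf n b ↔ a = b := by
  refine ⟨fun h => ?_, fun h => h ▸ rfl⟩
  unfold cellOf at h
  split_ifs at h <;> simp_all <;> omega

/-- What the programs below see of a machine state: the variables and the flat memory. -/
@[ext]
structure View where
  /-- the values of the variables -/
  v : Var → ℕ
  /-- the contents of the flat memory -/
  mem : ℕ → ℕ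

/-- Assigns `k` to the variable `x`. -/
def View.set (h : View) (x : Var) (k : ℕ) : View := { h with v := Function.update h.v x k }

/-- Stores `k` at the address `a`. -/
def View.put (h : View) (a k : ℕ) : View := { h with mem := Function.update h.mem a k }

@[simp] theorem View.set_v (h : View) (x y : Var) (k : ℕ) :
    (h.set x k).v y = if y = x then k else h.v y := by
  simp [View.set, Function.update_apply]

@[simp] theorem View.set_mem (h : View) (x : Var) (k : ℕ) : (h.set x k).mem = h.mem := rfl

@[simp] theorem View.put_v (h : View) (a k : ℕ) : (h.put a k).v = h.v := rfl

@[simp] theorem View.put_mem (h : View) (a b k : ℕ) :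
    (h.put a k).mem b = if b = a then k else h.mem b := by
  simp [View.put, Function.update_apply]

/-- The view of a machine state. -/
def view (M : Machine) (s : State 64) : View where
  v := fun x => s.regs x.reg
  mem := fun a => s.mem (cellOf M.text.length a).1 (cellOf M.text.length a).2

/-- Machines with at least one letter of text, the working space that is granted, and words that
are long enough for it. -/
structure Machine.Fits (M : Machine) : Prop where
  pos : 1 ≤ M.text.length
  work : M.workLen = M.text.length + M.alphabetSize + 100
  bits : M.text.length + M.alphabetSize + 164 < 2 ^ M.wordBits

/-- The number of cells of the flat memory. -/
def Machine.size (M : Machine) : ℕ := 3 * M.text.length + M.alphabetSize + 100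

/-- Expressions without side effects. Addresses of the flat memory are given by a row `b` and an
offset `i`: row `b` begins at the address `3 * b`, so that rows fit into words although addresses
need not. -/
inductive Expr
  | var (x : Var)
  | lit (k : ℕ)
  | textLen
  | alphabetSize
  | op (o : BinOp) (a b : Expr)
  /-- the content of the flat address `3 * b + i` -/
  | get (b i : Expr)
  /-- the letter `T[i]` -/
  | text (i : Expr)
  | ite (r : Rel) (a b e₁ e₂ : Expr)

instance : Coe Var Expr := ⟨.var⟩
instance (k : ℕ) : OfNat Expr k := ⟨.lit k⟩
instance : Add Expr := ⟨.op .add⟩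
instance : Sub Expr := ⟨.op .sub⟩
instance : Mul Expr := ⟨.op .mul⟩
instance : Div Expr := ⟨.op .div⟩
instance : Mod Expr := ⟨.op .mod⟩

/-- The operations on natural numbers, without overflow. -/
def BinOp.val : BinOp → ℕ → ℕ → ℕ
  | .add, x, y => x + y
  | .sub, x, y => x - y
  | .mul, x, y => x * y
  | .div, x, y => x / y
  | .mod, x, y => x % y

/-- The operation does not overflow for words below `W`. -/
def BinOp.Ok (W : ℕ) : BinOp → ℕ → ℕ → Prop
  | .add, x, y => x + y < W
  | .mul, x, y => x * y < W
  | _, _, _ => True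

/-- The value of an expression, computed with natural numbers instead of words. -/
noncomputable def Expr.eval (M : Machine) (h : View) : Expr → ℕ
  | .var x => h.v x
  | .lit k => k
  | .textLen => M.text.length
  | .alphabetSize => M.alphabetSize
  | .op o a b => o.val (a.eval M h) (b.eval M h)
  | .get b i => h.mem (3 * b.eval M h + i.eval M h)
  | .text i => M.text.getD (i.eval M h - 1) 0
  | .ite r a b e₁ e₂ =>
      haveI := Classical.propDecidable
      if r.Holds (a.eval M h) (b.eval M h) then e₁.eval M h else e₂.eval M h

/-- The evaluation neither overflows nor accesses a cell out of bounds. -/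
def Expr.Ok (M : Machine) (h : View) : Expr → Prop
  | .lit k => k ≤ 100
  | .op o a b => a.Ok M h ∧ b.Ok M h ∧ o.Ok (2 ^ M.wordBits) (a.eval M h) (b.eval M h)
  | .get b i => b.Ok M h ∧ i.Ok M h ∧ 3 * b.eval M h + i.eval M h < M.size
  | .text i => i.Ok M h ∧ 1 ≤ i.eval M h ∧ i.eval M h ≤ M.text.length
  | .ite r a b e₁ e₂ => a.Ok M h ∧ b.Ok M h ∧
      (r.Holds (a.eval M h) (b.eval M h) → e₁.Ok M h) ∧
      (¬ r.Holds (a.eval M h) (b.eval M h) → e₂.Ok M h)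
  | _ => True

/-- The number of temporaries that the evaluation needs. -/
def Expr.depth : Expr → ℕ
  | .op _ a b => max a.depth (b.depth + 1)
  | .get b i => max (max b.depth (i.depth + 1)) 4
  | .text i => max i.depth 1
  | .ite _ a b e₁ e₂ => max (max a.depth (b.depth + 1)) (max e₁.depth e₂.depth)
  | _ => 1

/-- Accesses the flat address `3 * b + i`, for `b` and `i` in the temporaries `d` and `d + 1`: runs
`f arr r` for its array `arr`, with the number of the cell in the register `r`. The address itself
need not fit into a word. -/
def access (d : ℕ) (f : Arr → Operand 64 → Cmd 64) : Cmd 64 :=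
  .seq (.assign (tmp (d + 3)) .div (.reg (tmp (d + 1))) (.lit 3)) <|
  .seq (.assign (tmp d) .add (.reg (tmp d)) (.reg (tmp (d + 3)))) <|
  .seq (.assign (tmp (d + 1)) .mod (.reg (tmp (d + 1))) (.lit 3)) <|
  .ite .lt (.reg (tmp d)) .textLen
    (.seq (.assign (tmp d) .add (.reg (tmp d)) (.lit 1)) <|
      .ite .eq (.reg (tmp (d + 1))) (.lit 0) (f .sa (.reg (tmp d))) <|
      .ite .eq (.reg (tmp (d + 1))) (.lit 1) (f .la (.reg (tmp d))) (f .work (.reg (tmp d))))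
    (.seq (.assign (tmp d) .sub (.reg (tmp d)) .textLen) <|
      .seq (.assign (tmp d) .mul (.reg (tmp d)) (.lit 3)) <|
      .seq (.assign (tmp d) .add (.reg (tmp d)) (.reg (tmp (d + 1)))) <|
      .seq (.assign (tmp d) .add (.reg (tmp d)) .textLen) <|
      .seq (.assign (tmp d) .add (.reg (tmp d)) (.lit 1)) <|
      f .work (.reg (tmp d)))

/-- The program that leaves the value of an expression in the temporary `d`. -/
def Expr.compile : Expr → ℕ → Cmd 64
  | .var x, d => .assign (tmp d) .sub (.reg x.reg) (.lit 0)
  | .lit k, d => .assign (tmp d) .sub (.lit k) (.lit 0)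
  | .textLen, d => .assign (tmp d) .sub .textLen (.lit 0)
  | .alphabetSize, d => .assign (tmp d) .sub .alphabetSize (.lit 0)
  | .op o a b, d => .seq (a.compile d) <| .seq (b.compile (d + 1)) <|
      .assign (tmp d) o (.reg (tmp d)) (.reg (tmp (d + 1)))
  | .get b i, d => .seq (b.compile d) <| .seq (i.compile (d + 1)) <|
      access d (fun arr r => .load (tmp d) arr r)
  | .text i, d => .seq (i.compile d) (.loadText (tmp d) (.reg (tmp d)))
  | .ite r a b e₁ e₂, d => .seq (a.compile d) <| .seq (b.compile (d + 1)) <|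
      .ite r (.reg (tmp d)) (.reg (tmp (d + 1))) (e₁.compile d) (e₂.compile d)

/-- Statements: assignments, stores, sequences, conditionals and while loops. -/
inductive Stmt
  | set (x : Var) (e : Expr)
  /-- stores `e` at the flat address `3 * b + i` -/
  | put (b i e : Expr)
  | seq (p q : Stmt)
  | ite (r : Rel) (a b : Expr) (p q : Stmt)
  | loop (r : Rel) (a b : Expr) (p : Stmt)

/-- The program of a statement. A loop evaluates both sides of its condition into the temporaries
`0` and `1`, before the first iteration and at the end of each one. -/
def Stmt.compile : Stmt → Cmd 64
  | .set x e => .seq (e.compile 0) (.assign x.reg .sub (.reg (tmp 0)) (.lit 0))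
  | .put b i e => .seq (b.compile 0) <| .seq (i.compile 1) <| .seq (e.compile 2) <|
      access 0 (fun arr r => .store arr r (.reg (tmp 2)))
  | .seq p q => .seq p.compile q.compile
  | .ite r a b p q => .seq (a.compile 0) <| .seq (b.compile 1) <|
      .ite r (.reg (tmp 0)) (.reg (tmp 1)) p.compile q.compile
  | .loop r a b p => .seq (.seq (a.compile 0) (b.compile 1)) <|
      .loop r (.reg (tmp 0)) (.reg (tmp 1)) (.seq p.compile (.seq (a.compile 0) (b.compile 1)))

/-! ### Correctness of the compilation of expressions -/

/-- The states differ at most in temporaries from number `d` on. -/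
def SameBelow (d : ℕ) (s s' : State 64) : Prop :=
  s'.mem = s.mem ∧ ∀ r, (∀ e, d ≤ e → e < 44 → r ≠ tmp e) → s'.regs r = s.regs r

theorem SameBelow.refl (d : ℕ) (s : State 64) : SameBelow d s s := ⟨rfl, fun _ _ => rfl⟩

theorem SameBelow.trans {d : ℕ} {s s' s'' : State 64} (h : SameBelow d s s')
    (h' : SameBelow d s' s'') : SameBelow d s s'' :=
  ⟨h'.1.trans h.1, fun r hr => (h'.2 r hr).trans (h.2 r hr)⟩

theorem SameBelow.mono {d e : ℕ} {s s' : State 64} (h : SameBelow e s s') (hd : d ≤ e) :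
    SameBelow d s s' :=
  ⟨h.1, fun r hr => h.2 r fun f hf => hr f (hd.trans hf)⟩

theorem SameBelow.setReg {d e : ℕ} {s s' : State 64} (h : SameBelow d s s') (hd : d ≤ e)
    (he : e < 44) (k : ℕ) : SameBelow d s (s'.setReg (tmp e) k) := by
  refine ⟨h.1, fun r hr => ?_⟩
  have := hr e hd he
  simp only [State.setReg, Function.update_apply, this, if_false]
  exact h.2 r hr

theorem SameBelow.view {d : ℕ} {s s' : State 64} (h : SameBelow d s s') (M : Machine) :
    view M s' = view M s := by
  ext x
  · exact h.2 _ fun e _ he => x.reg_ne_tmp he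
  · simp [LyndonSA.view, h.1]

theorem SameBelow.tmp {d e : ℕ} {s s' : State 64} (h : SameBelow d s s') (hd : e < d)
    (he : e < 44) : s'.regs (tmp e) = s.regs (tmp e) :=
  h.2 _ fun f hf hf' => by rw [ne_eq, tmp_inj he hf']; omega

theorem State.setReg_tmp (s : State 64) {d e : ℕ} (hd : d < 44) (he : e < 44) (k : ℕ) :
    (s.setReg (tmp d) k).regs (tmp e) = if e = d then k else s.regs (tmp e) := by
  simp only [State.setReg, Function.update_apply, tmp_inj he hd]

theorem BinOp.eval_eq_val {w x y : ℕ} (o : BinOp) (h : o.Ok (2 ^ w) x y) :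
    o.eval w x y = o.val x y := by
  cases o <;> simp_all [BinOp.eval, BinOp.val, BinOp.Ok, Nat.mod_eq_of_lt]

variable {M : Machine}

theorem Machine.Fits.lit (hM : M.Fits) {k : ℕ} (hk : k ≤ 100) : k % 2 ^ M.wordBits = k :=
  Nat.mod_eq_of_lt (by have := hM.bits; omega)

theorem Machine.Fits.len (hM : M.Fits) :
    M.text.length % 2 ^ M.wordBits = M.text.length :=
  Nat.mod_eq_of_lt (by have := hM.bits; omega)

theorem Machine.Fits.alpha (hM : M.Fits) :
    M.alphabetSize % 2 ^ M.wordBits = M.alphabetSize :=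
  Nat.mod_eq_of_lt (by have := hM.bits; omega)

/-- `access` reaches, after some steps, its memory operation on the cell that `cellOf` assigns to the
address; before that it changes only temporaries. -/
theorem access_exec (hM : M.Fits) {d : ℕ} (hd : d + 4 ≤ 44) (f : Arr → Operand 64 → Cmd 64)
    (s : State 64) {b i : ℕ} (hb : s.regs (tmp d) = b) (hi : s.regs (tmp (d + 1)) = i)
    (hsize : 3 * b + i < M.size) :
    ∃ s₁, s₁.mem = s.mem ∧ (∀ r, r ≠ tmp d → r ≠ tmp (d + 1) → r ≠ tmp (d + 3) →
        s₁.regs r = s.regs r) ∧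
      s₁.regs (tmp d) = (cellOf M.text.length (3 * b + i)).2 ∧
      1 ≤ s₁.regs (tmp d) ∧
      s₁.regs (tmp d) ≤ M.len (cellOf M.text.length (3 * b + i)).1 ∧
      ∀ t s', Exec M (f (cellOf M.text.length (3 * b + i)).1 (.reg (tmp d))) s₁ t s' →
        ∃ t', Exec M (access d f) s t' s' := by
  obtain ⟨hpos, hwork, hbits⟩ := hM
  set n := M.text.length with hn
  have hsize' : 3 * b + i < 3 * n + M.alphabetSize + 100 := hsize
  have e3 : 3 % 2 ^ M.wordBits = 3 := Nat.mod_eq_of_lt (by omega)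
  have e1 : 1 % 2 ^ M.wordBits = 1 := Nat.mod_eq_of_lt (by omega)
  have e0 : 0 % 2 ^ M.wordBits = 0 := by simp
  have en : n % 2 ^ M.wordBits = n := Nat.mod_eq_of_lt (by omega)
  have er : (b + i / 3) % 2 ^ M.wordBits = b + i / 3 := Nat.mod_eq_of_lt (by omega)
  have hd0 : d < 44 := by omega
  have hd1 : d + 1 < 44 := by omega
  have hd3 : d + 3 < 44 := by omega
  set s1 := s.setReg (tmp (d + 3)) (i / 3) with hs1
  set s2 := s1.setReg (tmp d) (b + i / 3) with hs2
  set s3 := s2.setReg (tmp (d + 1)) (i % 3) with hs3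
  have x1 : Exec M (.assign (tmp (d + 3)) .div (.reg (tmp (d + 1))) (.lit 3)) s 1 s1 := by
    have := Exec.assign (M := M) s (tmp (d + 3)) .div (.reg (tmp (d + 1))) (.lit 3)
    simpa [Operand.eval, BinOp.eval, hi, e3] using this
  have x2 : Exec M (.assign (tmp d) .add (.reg (tmp d)) (.reg (tmp (d + 3)))) s1 1 s2 := by
    have := Exec.assign (M := M) s1 (tmp d) .add (.reg (tmp d)) (.reg (tmp (d + 3)))
    simpa [Operand.eval, BinOp.eval, hs1, State.setReg_tmp, hb, er, hd0, hd3] using this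
  have x3 : Exec M (.assign (tmp (d + 1)) .mod (.reg (tmp (d + 1))) (.lit 3)) s2 1 s3 := by
    have := Exec.assign (M := M) s2 (tmp (d + 1)) .mod (.reg (tmp (d + 1))) (.lit 3)
    simpa [Operand.eval, BinOp.eval, hs1, hs2, State.setReg_tmp, hi, e3, hd0, hd1, hd3] using this
  have h3d : s3.regs (tmp d) = b + i / 3 := by simp [hs3, hs2, State.setReg_tmp, hd0, hd1]
  have h3e : s3.regs (tmp (d + 1)) = i % 3 := by simp [hs3, State.setReg_tmp, hd1]
  have hother : ∀ r, r ≠ tmp d → r ≠ tmp (d + 1) → r ≠ tmp (d + 3) → s3.regs r = s.regs r := by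
    intro r h1 h2 h3
    simp [hs3, hs2, hs1, State.setReg, h1, h2, h3]
  by_cases hlt : 3 * b + i < 3 * n
  · have hc : cellOf n (3 * b + i) = (if i % 3 = 0 then .sa else if i % 3 = 1 then .la else .work,
        b + i / 3 + 1) := by
      have h1 : (3 * b + i) % 3 = i % 3 := by omega
      have h2 : (3 * b + i) / 3 = b + i / 3 := by omega
      simp [cellOf, hlt, h1, h2]
    set s4 := s3.setReg (tmp d) (b + i / 3 + 1) with hs4
    have x4 : Exec M (.assign (tmp d) .add (.reg (tmp d)) (.lit 1)) s3 1 s4 := by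
      have := Exec.assign (M := M) s3 (tmp d) .add (.reg (tmp d)) (.lit 1)
      have er' : (b + i / 3 + 1) % 2 ^ M.wordBits = b + i / 3 + 1 := Nat.mod_eq_of_lt (by omega)
      simpa [Operand.eval, BinOp.eval, h3d, e1, er'] using this
    have h4e : s4.regs (tmp (d + 1)) = i % 3 := by
      simp [hs4, State.setReg_tmp, hd0, hd1, h3e]
    refine ⟨s4, rfl, ?_, by simp [hs4, hc, State.setReg_tmp, hd0],
      by simp [hs4, State.setReg_tmp, hd0], ?_, ?_⟩
    · intro r h1 h2 h3
      simp [hs4, State.setReg, h1, hother r h1 h2 h3]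
    · have : s4.regs (tmp d) ≤ n := by simp [hs4, State.setReg_tmp, hd0]; omega
      refine this.trans ?_
      rw [hc]
      split_ifs <;> simp [Machine.len, hwork] <;> omega
    · intro t s' hx
      rw [hc] at hx
      obtain ⟨t', hx'⟩ : ∃ t', Exec M (.ite .eq (.reg (tmp (d + 1))) (.lit 0) (f .sa (.reg (tmp d))) <|
          .ite .eq (.reg (tmp (d + 1))) (.lit 1) (f .la (.reg (tmp d)))
            (f .work (.reg (tmp d)))) s4 t' s' := by
        split_ifs at hx with h1 h2
        · exact ⟨_, .iteTrue _ _ _ _ _ _ _ _ (by simp [Rel.Holds, Operand.eval, h4e, h1]) hx⟩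
        · exact ⟨_, .iteFalse _ _ _ _ _ _ _ _ (by simp [Rel.Holds, Operand.eval, h4e, h1])
            (.iteTrue _ _ _ _ _ _ _ _ (by simp [Rel.Holds, Operand.eval, h4e, h2, e1]) hx)⟩
        · exact ⟨_, .iteFalse _ _ _ _ _ _ _ _ (by simp [Rel.Holds, Operand.eval, h4e, h1])
            (.iteFalse _ _ _ _ _ _ _ _ (by simp [Rel.Holds, Operand.eval, h4e, h2, e1]) hx)⟩
      refine ⟨_, .seq _ _ _ _ _ _ _ x1 (.seq _ _ _ _ _ _ _ x2 (.seq _ _ _ _ _ _ _ x3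
        (.iteTrue _ _ _ _ _ _ _ _ ?_ (.seq _ _ _ _ _ _ _ x4 hx'))))⟩
      simp only [Rel.Holds, Operand.eval, h3d, ← hn, en]; omega
  · have hc : cellOf n (3 * b + i) = (.work, 3 * b + i - 3 * n + n + 1) := by
      simp [cellOf, hlt]
    set s4 := s3.setReg (tmp d) (b + i / 3 - n) with hs4
    set s5 := s4.setReg (tmp d) ((b + i / 3 - n) * 3) with hs5
    set s6 := s5.setReg (tmp d) ((b + i / 3 - n) * 3 + i % 3) with hs6
    set s7 := s6.setReg (tmp d) ((b + i / 3 - n) * 3 + i % 3 + n) with hs7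
    set s8 := s7.setReg (tmp d) ((b + i / 3 - n) * 3 + i % 3 + n + 1) with hs8
    have x4 : Exec M (.assign (tmp d) .sub (.reg (tmp d)) .textLen) s3 1 s4 := by
      have := Exec.assign (M := M) s3 (tmp d) .sub (.reg (tmp d)) .textLen
      simpa [Operand.eval, BinOp.eval, h3d, ← hn, en] using this
    have x5 : Exec M (.assign (tmp d) .mul (.reg (tmp d)) (.lit 3)) s4 1 s5 := by
      have := Exec.assign (M := M) s4 (tmp d) .mul (.reg (tmp d)) (.lit 3)
      have er' : ((b + i / 3 - n) * 3) % 2 ^ M.wordBits = (b + i / 3 - n) * 3 :=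
        Nat.mod_eq_of_lt (by omega)
      simpa [Operand.eval, BinOp.eval, hs4, State.setReg_tmp, hd0, e3, er'] using this
    have x6 : Exec M (.assign (tmp d) .add (.reg (tmp d)) (.reg (tmp (d + 1)))) s5 1 s6 := by
      have := Exec.assign (M := M) s5 (tmp d) .add (.reg (tmp d)) (.reg (tmp (d + 1)))
      have er' : ((b + i / 3 - n) * 3 + i % 3) % 2 ^ M.wordBits = (b + i / 3 - n) * 3 + i % 3 :=
        Nat.mod_eq_of_lt (by omega)
      simpa [Operand.eval, BinOp.eval, hs5, hs4, h3e, State.setReg_tmp, hd0, hd1, er'] using this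
    have x7 : Exec M (.assign (tmp d) .add (.reg (tmp d)) .textLen) s6 1 s7 := by
      have := Exec.assign (M := M) s6 (tmp d) .add (.reg (tmp d)) .textLen
      have er' : ((b + i / 3 - n) * 3 + i % 3 + n) % 2 ^ M.wordBits =
        (b + i / 3 - n) * 3 + i % 3 + n := Nat.mod_eq_of_lt (by omega)
      simpa [Operand.eval, BinOp.eval, hs6, State.setReg_tmp, hd0, ← hn, en, er'] using this
    have x8 : Exec M (.assign (tmp d) .add (.reg (tmp d)) (.lit 1)) s7 1 s8 := by
      have := Exec.assign (M := M) s7 (tmp d) .add (.reg (tmp d)) (.lit 1)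
      have er' : ((b + i / 3 - n) * 3 + i % 3 + n + 1) % 2 ^ M.wordBits =
        (b + i / 3 - n) * 3 + i % 3 + n + 1 := Nat.mod_eq_of_lt (by omega)
      simpa [Operand.eval, BinOp.eval, hs7, State.setReg_tmp, hd0, e1, er'] using this
    have h8 : s8.regs (tmp d) = (b + i / 3 - n) * 3 + i % 3 + n + 1 := by
      simp [hs8, State.setReg_tmp, hd0]
    refine ⟨s8, rfl, ?_, by rw [h8, hc]; simp only; omega, by rw [h8]; omega, ?_, ?_⟩
    · intro r h1 h2 h3
      simp [hs8, hs7, hs6, hs5, hs4, State.setReg, h1, hother r h1 h2 h3]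
    · rw [h8, hc]
      simp only [Machine.len, hwork]
      omega
    · intro t s' hx
      rw [hc] at hx
      refine ⟨_, .seq _ _ _ _ _ _ _ x1 (.seq _ _ _ _ _ _ _ x2 (.seq _ _ _ _ _ _ _ x3
        (.iteFalse _ _ _ _ _ _ _ _ ?_ (.seq _ _ _ _ _ _ _ x4 (.seq _ _ _ _ _ _ _ x5
          (.seq _ _ _ _ _ _ _ x6 (.seq _ _ _ _ _ _ _ x7 (.seq _ _ _ _ _ _ _ x8 hx))))))))⟩
      simp only [Rel.Holds, Operand.eval, h3d, ← hn, en]; omega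

theorem Expr.compile_exec (hM : M.Fits) (e : Expr) :
    ∀ (d : ℕ) (s : State 64), d + e.depth ≤ 44 → e.Ok M (view M s) →
      ∃ t s', Exec M (e.compile d) s t s' ∧ s'.regs (tmp d) = e.eval M (view M s) ∧
        SameBelow d s s' := by
  have hlit0 : 0 % 2 ^ M.wordBits = 0 := by simp
  have leaf : ∀ (d : ℕ) (s : State 64) (o : Operand 64) (k : ℕ), d + 1 ≤ 44 → o.eval M s = k →
      ∃ t s', Exec M (.assign (tmp d) .sub o (.lit 0)) s t s' ∧ s'.regs (tmp d) = k ∧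
        SameBelow d s s' := by
    intro d s o k hd hk
    refine ⟨_, _, .assign _ _ _ _ _, ?_, (SameBelow.refl d s).setReg le_rfl (by omega) _⟩
    rw [State.setReg_tmp _ (by omega) (by omega)]
    simp only [BinOp.eval, hk]
    simp [Operand.eval]
  induction e with
  | var x => intro d s hd _; exact leaf d s _ _ hd rfl
  | lit k => intro d s hd h; exact leaf d s _ _ hd (hM.lit h)
  | textLen => intro d s hd _; exact leaf d s _ _ hd hM.len
  | alphabetSize => intro d s hd _; exact leaf d s _ _ hd hM.alpha
  | op o a b iha ihb =>
    intro d s hd h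
    obtain ⟨ha, hb, ho⟩ := h
    have hd' : d + max a.depth (b.depth + 1) ≤ 44 := hd
    obtain ⟨t1, s1, x1, v1, f1⟩ := iha d s (by omega) ha
    obtain ⟨t2, s2, x2, v2, f2⟩ := ihb (d + 1) s1 (by omega) (by rwa [f1.view M])
    rw [f1.view M] at v2
    have hd0 : d < 44 := by omega
    refine ⟨_, _, .seq _ _ _ _ _ _ _ x1 (.seq _ _ _ _ _ _ _ x2 (.assign _ _ _ _ _)), ?_,
      (f1.trans (f2.mono (by omega))).setReg le_rfl hd0 _⟩
    rw [State.setReg_tmp _ hd0 hd0, if_pos rfl]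
    simp only [Operand.eval, v2, f2.tmp (Nat.lt_succ_self d) hd0, v1]
    exact BinOp.eval_eq_val o ho
  | get b i ihb ihi =>
    intro d s hd h
    obtain ⟨hb, hi, hs⟩ := h
    have hd' : d + max (max b.depth (i.depth + 1)) 4 ≤ 44 := hd
    obtain ⟨t1, s1, x1, v1, f1⟩ := ihb d s (by omega) hb
    obtain ⟨t2, s2, x2, v2, f2⟩ := ihi (d + 1) s1 (by omega) (by rwa [f1.view M])
    rw [f1.view M] at v2
    have hd0 : d < 44 := by omega
    obtain ⟨s3, m3, r3, v3, l3, u3, x3⟩ := access_exec hM (d := d) (by omega)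
      (fun arr r => .load (tmp d) arr r) s2 ((f2.tmp (Nat.lt_succ_self d) hd0).trans v1) v2 hs
    obtain ⟨t4, x4⟩ := x3 _ _ (.load _ _ _ _ l3 u3)
    have f3 : SameBelow d s2 s3 := ⟨m3, fun r hr => r3 r (hr _ le_rfl hd0)
      (hr _ (by omega) (by omega)) (hr _ (by omega) (by omega))⟩
    refine ⟨_, _, .seq _ _ _ _ _ _ _ x1 (.seq _ _ _ _ _ _ _ x2 x4), ?_,
      ((f1.trans (f2.mono (by omega))).trans f3).setReg le_rfl hd0 _⟩
    rw [State.setReg_tmp _ hd0 hd0, if_pos rfl]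
    simp only [Operand.eval, v3, Expr.eval, view, m3, f2.1, f1.1]
  | text i ihi =>
    intro d s hd h
    obtain ⟨hi, hl, hu⟩ := h
    have hd' : d + max i.depth 1 ≤ 44 := hd
    obtain ⟨t1, s1, x1, v1, f1⟩ := ihi d s (by omega) hi
    have hd0 : d < 44 := by omega
    refine ⟨_, _, .seq _ _ _ _ _ _ _ x1 (.loadText _ _ _ ?_ ?_), ?_, f1.setReg le_rfl hd0 _⟩
    · simpa only [Operand.eval, v1] using hl
    · simpa only [Operand.eval, v1] using hu
    · rw [State.setReg_tmp _ hd0 hd0, if_pos rfl]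
      simp only [Operand.eval, v1, Expr.eval]
  | ite r a b e₁ e₂ iha ihb ih₁ ih₂ =>
    intro d s hd h
    obtain ⟨ha, hb, h₁, h₂⟩ := h
    have hd' : d + max (max a.depth (b.depth + 1)) (max e₁.depth e₂.depth) ≤ 44 := hd
    obtain ⟨t1, s1, x1, v1, f1⟩ := iha d s (by omega) ha
    obtain ⟨t2, s2, x2, v2, f2⟩ := ihb (d + 1) s1 (by omega) (by rwa [f1.view M])
    have hd0 : d < 44 := by omega
    have f12 := f1.trans (f2.mono (Nat.le_succ d))
    rw [f1.view M] at v2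
    rw [← f2.tmp (Nat.lt_succ_self d) hd0] at v1
    by_cases hr : r.Holds (a.eval M (view M s)) (b.eval M (view M s))
    · obtain ⟨t3, s3, x3, v3, f3⟩ := ih₁ d s2 (by omega) (by rw [f12.view M]; exact h₁ hr)
      refine ⟨_, _, .seq _ _ _ _ _ _ _ x1 (.seq _ _ _ _ _ _ _ x2
        (.iteTrue _ _ _ _ _ _ _ _ ?_ x3)), ?_, f12.trans f3⟩
      · simpa only [Operand.eval, v1, v2] using hr
      · rw [v3, f12.view M]; simp [Expr.eval, hr]
    · obtain ⟨t3, s3, x3, v3, f3⟩ := ih₂ d s2 (by omega) (by rw [f12.view M]; exact h₂ hr)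
      refine ⟨_, _, .seq _ _ _ _ _ _ _ x1 (.seq _ _ _ _ _ _ _ x2
        (.iteFalse _ _ _ _ _ _ _ _ ?_ x3)), ?_, f12.trans f3⟩
      · simpa only [Operand.eval, v1, v2] using hr
      · rw [v3, f12.view M]; simp [Expr.eval, hr]

/-! ### Rules for statements -/

/-- The number of commands in a program; it bounds the time of a program without loops. -/
def Cmd.cost {k : ℕ} : Cmd k → ℕ
  | .seq p q => p.cost + q.cost
  | .ite _ _ _ p q => 1 + (p.cost + q.cost)
  | .loop _ _ _ p => 1 + p.cost
  | _ => 1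

/-- The program contains no loop. -/
def Cmd.LoopFree {k : ℕ} : Cmd k → Prop
  | .seq p q => p.LoopFree ∧ q.LoopFree
  | .ite _ _ _ p q => p.LoopFree ∧ q.LoopFree
  | .loop _ _ _ _ => False
  | _ => True

theorem Exec.le_cost {k : ℕ} {p : Cmd k} {s s' : State k} {t : ℕ} (h : Exec M p s t s')
    (hp : p.LoopFree) : t ≤ p.cost := by
  induction h with
  | seq p q s₁ s₂ s₃ t₁ t₂ _ _ ih₁ ih₂ => exact Nat.add_le_add (ih₁ hp.1) (ih₂ hp.2)
  | iteTrue rel a b p q s s' t _ _ ih =>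
    have := ih hp.1
    simp only [Cmd.cost]; omega
  | iteFalse rel a b p q s s' t _ _ ih =>
    have := ih hp.2
    simp only [Cmd.cost]; omega
  | loopDone => exact hp.elim
  | loopStep => exact hp.elim
  | _ => exact le_rfl

theorem access_loopFree (d : ℕ) (f : Arr → Operand 64 → Cmd 64)
    (hf : ∀ arr r, (f arr r).LoopFree) : (access d f).LoopFree := by
  simp [access, Cmd.LoopFree, hf]

theorem Expr.compile_loopFree (e : Expr) : ∀ d, (e.compile d).LoopFree := by
  induction e with
  | op o a b iha ihb => intro d; exact ⟨iha _, ihb _, trivial⟩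
  | get b i ihb ihi => intro d; exact ⟨ihb _, ihi _, access_loopFree _ _ fun _ _ => trivial⟩
  | text i ihi => intro d; exact ⟨ihi _, trivial⟩
  | ite r a b e₁ e₂ iha ihb ih₁ ih₂ => intro d; exact ⟨iha _, ihb _, ih₁ _, ih₂ _⟩
  | _ => intro d; exact trivial

/-- No loops, and no expression that needs too many temporaries. -/
def Stmt.Simple : Stmt → Prop
  | .set _ e => e.depth ≤ 40
  | .put b i e => b.depth ≤ 40 ∧ i.depth ≤ 40 ∧ e.depth ≤ 40
  | .seq p q => p.Simple ∧ q.Simple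
  | .ite _ a b p q => a.depth ≤ 40 ∧ b.depth ≤ 40 ∧ p.Simple ∧ q.Simple
  | .loop _ _ _ _ => False

theorem Stmt.Simple.loopFree {p : Stmt} (h : p.Simple) : p.compile.LoopFree := by
  induction p with
  | set x e => exact ⟨e.compile_loopFree _, trivial⟩
  | put b i e => exact ⟨b.compile_loopFree _, i.compile_loopFree _, e.compile_loopFree _,
      access_loopFree _ _ fun _ _ => trivial⟩
  | seq p q ihp ihq => exact ⟨ihp h.1, ihq h.2⟩
  | ite r a b p q ihp ihq => exact ⟨a.compile_loopFree _, b.compile_loopFree _, ihp h.2.2.1,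
      ihq h.2.2.2⟩
  | loop => exact h.elim

/-- The weakest precondition of a statement without loops. -/
def Stmt.wp (M : Machine) : Stmt → (View → Prop) → View → Prop
  | .set x e, Q, h => e.Ok M h ∧ Q (h.set x (e.eval M h))
  | .put b i e, Q, h => b.Ok M h ∧ i.Ok M h ∧ e.Ok M h ∧
      3 * b.eval M h + i.eval M h < M.size ∧
      Q (h.put (3 * b.eval M h + i.eval M h) (e.eval M h))
  | .seq p q, Q, h => p.wp M (q.wp M Q) h
  | .ite r a b p q, Q, h => a.Ok M h ∧ b.Ok M h ∧
      (r.Holds (a.eval M h) (b.eval M h) → p.wp M Q h) ∧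
      (¬ r.Holds (a.eval M h) (b.eval M h) → q.wp M Q h)
  | .loop _ _ _ _, _, _ => False

theorem view_setReg (s : State 64) (x : Var) (k : ℕ) :
    view M (s.setReg x.reg k) = (view M s).set x k := by
  ext y
  · simp [view, State.setReg, Function.update_apply, Var.reg_inj]
  · rfl

theorem view_setCell (s : State 64) (a k : ℕ) :
    view M (s.setCell (cellOf M.text.length a).1 (cellOf M.text.length a).2 k) =
      (view M s).put a k := by
  ext b
  · rfl
  · simp only [view, State.setCell, View.put_mem]
    by_cases hb : b = a
    · simp [hb]
    · rw [if_neg hb]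
      by_cases h1 : (cellOf M.text.length b).1 = (cellOf M.text.length a).1
      · have h2 : (cellOf M.text.length b).2 ≠ (cellOf M.text.length a).2 := fun h2 =>
          hb (cellOf_inj.1 (Prod.ext h1 h2))
        rw [h1, Function.update_self, Function.update_of_ne h2]
      · rw [Function.update_of_ne h1]

/-- Evaluates two expressions into the temporaries `0` and `1`. -/
theorem Expr.compile_exec_pair (hM : M.Fits) {a b : Expr} (ha : a.depth ≤ 40) (hb : b.depth ≤ 40)
    (s : State 64) (oa : a.Ok M (view M s)) (ob : b.Ok M (view M s)) :
    ∃ t₁ t₂ s₁ s₂, Exec M (a.compile 0) s t₁ s₁ ∧ Exec M (b.compile 1) s₁ t₂ s₂ ∧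
      view M s₂ = view M s ∧ s₂.regs (tmp 0) = a.eval M (view M s) ∧
      s₂.regs (tmp 1) = b.eval M (view M s) := by
  obtain ⟨t1, s1, x1, v1, f1⟩ := a.compile_exec hM 0 s (by omega) oa
  obtain ⟨t2, s2, x2, v2, f2⟩ := b.compile_exec hM 1 s1 (by omega) (by rwa [f1.view M])
  refine ⟨t1, t2, s1, s2, x1, x2, ?_, ?_, ?_⟩
  · rw [f2.view M, f1.view M]
  · rw [f2.tmp (by omega) (by omega), v1]
  · rw [v2, f1.view M]

/-- The rules of `wp` are sound for the compiled program. -/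
theorem Stmt.exec_of_wp (hM : M.Fits) (p : Stmt) : ∀ (Q : View → Prop) (s : State 64), p.Simple →
    p.wp M Q (view M s) → ∃ t s', Exec M p.compile s t s' ∧ Q (view M s') := by
  induction p with
  | set x e =>
    intro Q s hp ⟨ho, hQ⟩
    obtain ⟨t1, s1, x1, v1, f1⟩ := e.compile_exec hM 0 s (by have : e.depth ≤ 40 := hp; omega) ho
    refine ⟨_, _, .seq _ _ _ _ _ _ _ x1 (.assign _ _ _ _ _), ?_⟩
    rw [view_setReg, f1.view M]
    simpa [Operand.eval, BinOp.eval, v1] using hQ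
  | put b i e =>
    intro Q s ⟨hb, hi, he⟩ ⟨ob, oi, oe, hs, hQ⟩
    obtain ⟨t1, t2, s1, s2, x1, x2, w2, v1, v2⟩ := Expr.compile_exec_pair hM hb hi s ob oi
    obtain ⟨t3, s3, x3, v3, f3⟩ := e.compile_exec hM 2 s2 (by omega) (by rwa [w2])
    obtain ⟨s4, m4, r4, v4, l4, u4, x4⟩ := access_exec hM (d := 0) (by omega)
      (fun arr r => .store arr r (.reg (tmp 2))) s3
      ((f3.tmp (by omega) (by omega)).trans v1) ((f3.tmp (by omega) (by omega)).trans v2) hs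
    obtain ⟨t5, x5⟩ := x4 _ _ (.store _ _ _ _ l4 u4)
    refine ⟨_, _, .seq _ _ _ _ _ _ _ x1 (.seq _ _ _ _ _ _ _ x2 (.seq _ _ _ _ _ _ _ x3 x5)), ?_⟩
    have e4 : view M s4 = view M s := by
      rw [← w2, ← f3.view M]
      ext x
      · exact r4 _ (x.reg_ne_tmp (by omega)) (x.reg_ne_tmp (by omega)) (x.reg_ne_tmp (by omega))
      · simp [view, m4]
    have r2 : s4.regs (tmp 2) = e.eval M (view M s) := by
      rw [r4 _ (by rw [ne_eq, tmp_inj] <;> omega) (by rw [ne_eq, tmp_inj] <;> omega)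
        (by rw [ne_eq, tmp_inj] <;> omega), v3, w2]
    simp only [Operand.eval, v4, r2]
    rw [view_setCell, e4]
    exact hQ
  | seq p q ihp ihq =>
    intro Q s hp hQ
    obtain ⟨t1, s1, x1, h1⟩ := ihp _ s hp.1 hQ
    obtain ⟨t2, s2, x2, h2⟩ := ihq _ s1 hp.2 h1
    exact ⟨_, _, .seq _ _ _ _ _ _ _ x1 x2, h2⟩
  | ite r a b p q ihp ihq =>
    intro Q s ⟨ha, hb, hp, hq⟩ ⟨oa, ob, h1, h2⟩
    obtain ⟨t1, t2, s1, s2, x1, x2, w2, v1, v2⟩ := Expr.compile_exec_pair hM ha hb s oa ob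
    by_cases hr : r.Holds (a.eval M (view M s)) (b.eval M (view M s))
    · obtain ⟨t3, s3, x3, h3⟩ := ihp Q s2 hp (by rw [w2]; exact h1 hr)
      refine ⟨_, _, .seq _ _ _ _ _ _ _ x1 (.seq _ _ _ _ _ _ _ x2
        (.iteTrue _ _ _ _ _ _ _ _ ?_ x3)), h3⟩
      simpa only [Operand.eval, v1, v2] using hr
    · obtain ⟨t3, s3, x3, h3⟩ := ihq Q s2 hq (by rw [w2]; exact h2 hr)
      refine ⟨_, _, .seq _ _ _ _ _ _ _ x1 (.seq _ _ _ _ _ _ _ x2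
        (.iteFalse _ _ _ _ _ _ _ _ ?_ x3)), h3⟩
      simpa only [Operand.eval, v1, v2] using hr
  | loop => intro Q s hp; exact hp.elim

/-- Started in any machine state with view `h`, the statement halts after at most `t` steps in a
state whose view satisfies `Q`. -/
def Stmt.Run (M : Machine) (p : Stmt) (h : View) (t : ℕ) (Q : View → Prop) : Prop :=
  ∀ s, view M s = h → ∃ t' ≤ t, ∃ s', Exec M p.compile s t' s' ∧ Q (view M s')

theorem Stmt.Run.mono {p : Stmt} {h : View} {t t' : ℕ} {Q Q' : View → Prop}
    (hp : p.Run M h t Q) (ht : t ≤ t') (hQ : ∀ h', Q h' → Q' h') : p.Run M h t' Q' := by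
  intro s hs
  obtain ⟨u, hu, s', hx, hq⟩ := hp s hs
  exact ⟨u, hu.trans ht, s', hx, hQ _ hq⟩

theorem Stmt.Run.seq {p q : Stmt} {h : View} {t₁ t₂ : ℕ} {R Q : View → Prop}
    (hp : p.Run M h t₁ R) (hq : ∀ h', R h' → q.Run M h' t₂ Q) :
    (Stmt.seq p q).Run M h (t₁ + t₂) Q := by
  intro s hs
  obtain ⟨u₁, hu₁, s₁, hx₁, hr⟩ := hp s hs
  obtain ⟨u₂, hu₂, s₂, hx₂, hq'⟩ := hq _ hr s₁ rfl
  exact ⟨_, Nat.add_le_add hu₁ hu₂, s₂, .seq _ _ _ _ _ _ _ hx₁ hx₂, hq'⟩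

theorem Stmt.Run.of_wp (hM : M.Fits) {p : Stmt} {h : View} {Q : View → Prop} (hp : p.Simple)
    (hw : p.wp M Q h) : p.Run M h p.compile.cost Q := by
  rintro s rfl
  obtain ⟨t, s', hx, hq⟩ := p.exec_of_wp hM Q s hp hw
  exact ⟨t, hx.le_cost hp.loopFree, s', hx, hq⟩

/-- The cost of evaluating the condition of a loop. -/
def condCost (a b : Expr) : ℕ := (a.compile 0).cost + (b.compile 1).cost + 1

/-- A loop with an invariant `I` and a potential `φ`, which pays for the iterations; both depend on
a ghost parameter. -/
theorem Stmt.Run.loop (hM : M.Fits) {ι : Type*} (I : ι → View → Prop) (φ : ι → ℕ) {r : Rel}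
    {a b : Expr} {p : Stmt} (ha : a.depth ≤ 40) (hb : b.depth ≤ 40)
    (hok : ∀ g h, I g h → a.Ok M h ∧ b.Ok M h)
    (step : ∀ g h, I g h → r.Holds (a.eval M h) (b.eval M h) →
      ∃ t, p.Run M h t (fun h' => ∃ g', I g' h' ∧ φ g' + t + condCost a b ≤ φ g))
    {g : ι} {h : View} (h0 : I g h) :
    (Stmt.loop r a b p).Run M h (φ g + condCost a b)
      (fun h' => ∃ g', I g' h' ∧ ¬ r.Holds (a.eval M h') (b.eval M h')) := by
  have key : ∀ N g s, φ g ≤ N → I g (view M s) → s.regs (tmp 0) = a.eval M (view M s) →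
      s.regs (tmp 1) = b.eval M (view M s) →
      ∃ t ≤ φ g + 1, ∃ s', Exec M (.loop r (.reg (tmp 0)) (.reg (tmp 1))
        (.seq p.compile (.seq (a.compile 0) (b.compile 1)))) s t s' ∧
        ∃ g', I g' (view M s') ∧ ¬ r.Holds (a.eval M (view M s')) (b.eval M (view M s')) := by
    intro N
    induction N using Nat.strong_induction_on with
    | _ N ih =>
    intro g s hN hI v0 v1
    by_cases hr : r.Holds (a.eval M (view M s)) (b.eval M (view M s))
    · obtain ⟨t, ht⟩ := step g _ hI hr
      obtain ⟨u, hu, s1, x1, g', hI', hφ⟩ := ht s rfl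
      obtain ⟨oa, ob⟩ := hok g' _ hI'
      obtain ⟨t2, t3, s2, s3, x2, x3, w3, y0, y1⟩ := Expr.compile_exec_pair hM ha hb s1 oa ob
      have c2 := x2.le_cost (a.compile_loopFree 0)
      have c3 := x3.le_cost (b.compile_loopFree 1)
      have hc : condCost a b = (a.compile 0).cost + (b.compile 1).cost + 1 := rfl
      obtain ⟨t4, ht4, s4, x4, hfin⟩ := ih (φ g') (by omega) g' s3 le_rfl (by rwa [w3])
        (by rw [y0, w3]) (by rw [y1, w3])
      exact ⟨_, by omega, s4, .loopStep _ _ _ _ _ _ _ _ _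
        (by simpa only [Operand.eval, v0, v1] using hr)
        (.seq _ _ _ _ _ _ _ x1 (.seq _ _ _ _ _ _ _ x2 x3)) x4, hfin⟩
    · exact ⟨1, by omega, s, .loopDone _ _ _ _ _
        (by simpa only [Operand.eval, v0, v1] using hr), g, hI, hr⟩
  rintro s rfl
  obtain ⟨oa, ob⟩ := hok g _ h0
  obtain ⟨t2, t3, s2, s3, x2, x3, w3, y0, y1⟩ := Expr.compile_exec_pair hM ha hb s oa ob
  have c2 := x2.le_cost (a.compile_loopFree 0)
  have c3 := x3.le_cost (b.compile_loopFree 1)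
  obtain ⟨t4, ht4, s4, x4, hfin⟩ := key _ g s3 le_rfl (by rwa [w3]) (by rw [y0, w3])
    (by rw [y1, w3])
  exact ⟨_, by simp only [condCost]; omega, s4,
    .seq _ _ _ _ _ _ _ (.seq _ _ _ _ _ _ _ x2 x3) x4, hfin⟩

/-- The statement runs in time at most `X` times its number of commands. -/
def Stmt.RunIn (M : Machine) (p : Stmt) (h : View) (X : ℕ) (Q : View → Prop) : Prop :=
  p.Run M h (X * p.compile.cost) Q

theorem Stmt.RunIn.mono {p : Stmt} {h : View} {X X' : ℕ} {Q Q' : View → Prop}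
    (hp : p.RunIn M h X Q) (hX : X ≤ X') (hQ : ∀ h', Q h' → Q' h') : p.RunIn M h X' Q' :=
  Stmt.Run.mono hp (Nat.mul_le_mul_right _ hX) hQ

theorem Stmt.RunIn.seq {p q : Stmt} {h : View} {X : ℕ} {R Q : View → Prop}
    (hp : p.RunIn M h X R) (hq : ∀ h', R h' → q.RunIn M h' X Q) :
    (Stmt.seq p q).RunIn M h X Q := by
  refine (Stmt.Run.seq hp hq).mono ?_ fun _ h => h
  rw [← Nat.mul_add]
  exact le_rfl

theorem Stmt.RunIn.of_wp (hM : M.Fits) {p : Stmt} {h : View} {X : ℕ} {Q : View → Prop}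
    (hp : p.Simple) (hX : 1 ≤ X) (hw : p.wp M Q h) : p.RunIn M h X Q :=
  (Stmt.Run.of_wp hM hp hw).mono (Nat.le_mul_of_pos_left _ hX) fun _ h => h

/-- A loop without inner loops, after the initialization of its counter, that runs `N` times. -/
theorem Stmt.RunIn.count (hM : M.Fits) (I : ℕ → View → Prop) (N : ℕ) {X : ℕ} {x : Var} {e : Expr}
    {r : Rel} {a b : Expr} {p : Stmt} {h : View} {Q : View → Prop} (hX : N + 1 ≤ X)
    (he : e.depth ≤ 40) (ha : a.depth ≤ 40) (hb : b.depth ≤ 40) (hp : p.Simple) (oe : e.Ok M h)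
    (hcond : ∀ k ≤ N, ∀ h', I k h' → a.Ok M h' ∧ b.Ok M h' ∧
      (r.Holds (a.eval M h') (b.eval M h') ↔ k < N))
    (step : ∀ k < N, ∀ h', I k h' → p.wp M (I (k + 1)) h')
    (h0 : I 0 (h.set x (e.eval M h)))
    (hQ : ∀ h', I N h' → Q h') :
    (Stmt.seq (.set x e) (.loop r a b p)).RunIn M h X Q := by
  refine Stmt.RunIn.mono ?_ hX hQ
  have init : (Stmt.set x e).Run M h (Stmt.set x e).compile.cost
      (fun h' => h' = h.set x (e.eval M h)) :=
    Stmt.Run.of_wp hM he ⟨oe, rfl⟩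
  refine (init.seq (t₂ := N * (p.compile.cost + condCost a b) + condCost a b) (Q := I N)
    fun h' hh' => ?_).mono ?_ fun _ h => h
  · subst hh'
    have := Stmt.Run.loop hM (fun k h => k ≤ N ∧ I k h)
      (fun k => (N - k) * (p.compile.cost + condCost a b)) (r := r) (p := p) ha hb
      (fun k h hI => ⟨(hcond k hI.1 h hI.2).1, (hcond k hI.1 h hI.2).2.1⟩) ?_ (g := 0)
      ⟨Nat.zero_le _, h0⟩
    · refine this.mono (by simp) ?_
      rintro h' ⟨k, ⟨hk, hI⟩, hn⟩
      rw [(hcond k hk h' hI).2.2] at hn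
      obtain rfl : k = N := by omega
      exact hI
    · rintro k h' ⟨hk, hI⟩ hr
      rw [(hcond k hk h' hI).2.2] at hr
      refine ⟨_, (Stmt.Run.of_wp hM hp (step k hr h' hI)).mono le_rfl
        fun h' hI' => ⟨k + 1, ⟨hr, hI'⟩, ?_⟩⟩
      have : N - k = N - (k + 1) + 1 := by omega
      rw [this]
      nlinarith
  · simp only [Stmt.compile, Cmd.cost, condCost]
    nlinarith

/-! ### Evaluation of expressions, and frames -/

section Simp
variable (h : View) (a b e₁ e₂ : Expr) (r : Rel) (v : Var) (k : ℕ)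

@[simp] theorem eval_var : (Expr.var v).eval M h = h.v v := rfl
@[simp] theorem eval_textLen : Expr.textLen.eval M h = M.text.length := rfl
@[simp] theorem eval_alphabetSize : Expr.alphabetSize.eval M h = M.alphabetSize := rfl
@[simp] theorem eval_ofNat : (ofNat(k) : Expr).eval M h = (OfNat.ofNat k : ℕ) := rfl
@[simp] theorem eval_add : (a + b).eval M h = a.eval M h + b.eval M h := rfl
@[simp] theorem eval_sub : (a - b).eval M h = a.eval M h - b.eval M h := rfl
@[simp] theorem eval_mul : (a * b).eval M h = a.eval M h * b.eval M h := rfl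
@[simp] theorem eval_div : (a / b).eval M h = a.eval M h / b.eval M h := rfl
@[simp] theorem eval_mod : (a % b).eval M h = a.eval M h % b.eval M h := rfl
@[simp] theorem eval_get : (Expr.get a b).eval M h = h.mem (3 * a.eval M h + b.eval M h) := rfl
@[simp] theorem eval_text : (Expr.text a).eval M h = M.text.getD (a.eval M h - 1) 0 := rfl
theorem eval_ite [Decidable (r.Holds (a.eval M h) (b.eval M h))] :
    (Expr.ite r a b e₁ e₂).eval M h =
      if r.Holds (a.eval M h) (b.eval M h) then e₁.eval M h else e₂.eval M h := by
  simp only [Expr.eval]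
  congr

@[simp] theorem ok_var : (Expr.var v).Ok M h := trivial
@[simp] theorem ok_textLen : Expr.textLen.Ok M h := trivial
@[simp] theorem ok_alphabetSize : Expr.alphabetSize.Ok M h := trivial
@[simp] theorem ok_ofNat : (ofNat(k) : Expr).Ok M h ↔ (OfNat.ofNat k : ℕ) ≤ 100 := Iff.rfl
@[simp] theorem ok_add : (a + b).Ok M h ↔ a.Ok M h ∧ b.Ok M h ∧
    a.eval M h + b.eval M h < 2 ^ M.wordBits := Iff.rfl
@[simp] theorem ok_sub : (a - b).Ok M h ↔ a.Ok M h ∧ b.Ok M h := by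
  simp [HSub.hSub, Sub.sub, Expr.Ok, BinOp.Ok]
@[simp] theorem ok_mul : (a * b).Ok M h ↔ a.Ok M h ∧ b.Ok M h ∧
    a.eval M h * b.eval M h < 2 ^ M.wordBits := Iff.rfl
@[simp] theorem ok_div : (a / b).Ok M h ↔ a.Ok M h ∧ b.Ok M h := by
  simp [HDiv.hDiv, Div.div, Expr.Ok, BinOp.Ok]
@[simp] theorem ok_mod : (a % b).Ok M h ↔ a.Ok M h ∧ b.Ok M h := by
  simp [Expr.Ok, BinOp.Ok]
@[simp] theorem ok_get : (Expr.get a b).Ok M h ↔ a.Ok M h ∧ b.Ok M h ∧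
    3 * a.eval M h + b.eval M h < M.size := Iff.rfl
@[simp] theorem ok_text : (Expr.text a).Ok M h ↔ a.Ok M h ∧ 1 ≤ a.eval M h ∧
    a.eval M h ≤ M.text.length := Iff.rfl
theorem ok_ite : (Expr.ite r a b e₁ e₂).Ok M h ↔ a.Ok M h ∧ b.Ok M h ∧
      (r.Holds (a.eval M h) (b.eval M h) → e₁.Ok M h) ∧
      (¬ r.Holds (a.eval M h) (b.eval M h) → e₂.Ok M h) := Iff.rfl

@[simp] theorem depth_var : (Expr.var v).depth = 1 := rfl
@[simp] theorem depth_textLen : Expr.textLen.depth = 1 := rfl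
@[simp] theorem depth_alphabetSize : Expr.alphabetSize.depth = 1 := rfl
@[simp] theorem depth_ofNat : (ofNat(k) : Expr).depth = 1 := rfl
@[simp] theorem depth_add : (a + b).depth = max a.depth (b.depth + 1) := rfl
@[simp] theorem depth_sub : (a - b).depth = max a.depth (b.depth + 1) := rfl
@[simp] theorem depth_mul : (a * b).depth = max a.depth (b.depth + 1) := rfl
@[simp] theorem depth_div : (a / b).depth = max a.depth (b.depth + 1) := rfl
@[simp] theorem depth_mod : (a % b).depth = max a.depth (b.depth + 1) := rfl
@[simp] theorem depth_get : (Expr.get a b).depth = max (max a.depth (b.depth + 1)) 4 := rfl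
@[simp] theorem depth_text : (Expr.text a).depth = max a.depth 1 := rfl
@[simp] theorem depth_ite : (Expr.ite r a b e₁ e₂).depth =
    max (max a.depth (b.depth + 1)) (max e₁.depth e₂.depth) := rfl

@[simp] theorem holds_lt (x y : ℕ) : Rel.lt.Holds x y ↔ x < y := Iff.rfl
@[simp] theorem holds_le (x y : ℕ) : Rel.le.Holds x y ↔ x ≤ y := Iff.rfl
@[simp] theorem holds_eq (x y : ℕ) : Rel.eq.Holds x y ↔ x = y := Iff.rfl
@[simp] theorem holds_ne (x y : ℕ) : Rel.ne.Holds x y ↔ x ≠ y := Iff.rfl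

end Simp

/-- Only the listed variables and the addresses in `R` differ. -/
def Frame (vs : List Var) (R : ℕ → Prop) (h h' : View) : Prop :=
  (∀ v, v ∉ vs → h'.v v = h.v v) ∧ ∀ k, ¬ R k → h'.mem k = h.mem k

theorem Frame.refl (vs : List Var) (R : ℕ → Prop) (h : View) : Frame vs R h h :=
  ⟨fun _ _ => rfl, fun _ _ => rfl⟩

theorem Frame.trans {vs : List Var} {R : ℕ → Prop} {h h' h'' : View} (h₁ : Frame vs R h h')
    (h₂ : Frame vs R h' h'') : Frame vs R h h'' :=
  ⟨fun v hv => (h₂.1 v hv).trans (h₁.1 v hv), fun k hk => (h₂.2 k hk).trans (h₁.2 k hk)⟩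

theorem Frame.mono {vs vs' : List Var} {R R' : ℕ → Prop} {h h' : View} (hf : Frame vs R h h')
    (hv : ∀ v, v ∈ vs → v ∈ vs') (hR : ∀ k, R k → R' k) : Frame vs' R' h h' :=
  ⟨fun v hn => hf.1 v fun hm => hn (hv v hm), fun k hn => hf.2 k fun hm => hn (hR k hm)⟩

theorem Frame.set {vs : List Var} {R : ℕ → Prop} {h h' : View} (hf : Frame vs R h h') {x : Var}
    (hx : x ∈ vs) (k : ℕ) : Frame vs R h (h'.set x k) :=
  ⟨fun v hv => by
    rw [View.set_v, if_neg (by rintro rfl; exact hv hx)]; exact hf.1 v hv, hf.2⟩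

theorem Frame.put {vs : List Var} {R : ℕ → Prop} {h h' : View} (hf : Frame vs R h h') {a : ℕ}
    (ha : R a) (k : ℕ) : Frame vs R h (h'.put a k) :=
  ⟨hf.1, fun b hb => by
    rw [View.put_mem, if_neg (by rintro rfl; exact hb ha)]; exact hf.2 b hb⟩

/-! ### Counting sort -/

/-- The place of the `a`-th of `L` items in the stable order by `key`. -/
def dest (key : ℕ → ℕ) (L a : ℕ) : ℕ :=
  Nat.count (fun b => key b < key a) L + Nat.count (fun b => key b = key a) a

theorem count_add_count_le {p q r : ℕ → Prop} [DecidablePred p] [DecidablePred q] [DecidablePred r]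
    (L : ℕ) (hp : ∀ x, p x → r x) (hq : ∀ x, q x → r x) (hpq : ∀ x, p x → ¬ q x) :
    Nat.count p L + Nat.count q L ≤ Nat.count r L := by
  induction L with
  | zero => simp
  | succ L ih =>
    simp only [Nat.count_succ]
    have h1 := hp L
    have h2 := hq L
    have h3 := hpq L
    by_cases hp' : p L <;> by_cases hq' : q L <;> by_cases hr' : r L <;> simp_all <;> omega

/-- The items that come before the `a`-th one in the stable order are among the other `L - 1`. -/
theorem dest_lt_length {key : ℕ → ℕ} {L a : ℕ} (ha : a < L) : dest key L a < L := by
  have h1 := count_add_count_le (p := fun b => key b < key a) (q := fun b => key b = key a)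
    (r := fun _ => True) L (by simp) (by simp) (by intro x hx; omega)
  have h2 : Nat.count (fun b => key b = key a) a < Nat.count (fun b => key b = key a) L :=
    Nat.count_strict_mono rfl ha
  have h3 : Nat.count (fun _ => True) L = L := by simp
  simp only [dest]
  omega

theorem dest_lt_dest {key : ℕ → ℕ} {L a b : ℕ} (ha : a < L)
    (h : key a < key b ∨ key a = key b ∧ a < b) : dest key L a < dest key L b := by
  rcases h with h | ⟨h, hab⟩
  · have h1 := count_add_count_le (p := fun c => key c < key a) (q := fun c => key c = key a)
      (r := fun c => key c < key b) L (by intro x hx; omega)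
      (by intro x hx; omega) (by intro x hx; omega)
    have h2 : Nat.count (fun b => key b = key a) a < Nat.count (fun b => key b = key a) L :=
      Nat.count_strict_mono rfl ha
    simp only [dest]
    omega
  · have h2 : Nat.count (fun c => key c = key b) a < Nat.count (fun c => key c = key b) b :=
      Nat.count_strict_mono h hab
    simp only [dest, h]
    omega

theorem dest_inj {key : ℕ → ℕ} {L a b : ℕ} (ha : a < L) (hb : b < L)
    (h : dest key L a = dest key L b) : a = b := by
  by_contra hne
  have : (key a < key b ∨ key a = key b ∧ a < b) ∨ (key b < key a ∨ key b = key a ∧ b < a) := by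
    omega
  rcases this with h' | h'
  · have := dest_lt_dest ha h'; omega
  · have := dest_lt_dest hb h'; omega

/-- An injection of an initial segment of the natural numbers into itself is onto. -/
theorem exists_eq_of_inj_of_lt {f : ℕ → ℕ} {L : ℕ} (hf : ∀ a < L, f a < L)
    (hinj : ∀ a < L, ∀ b < L, f a = f b → a = b) {y : ℕ} (hy : y < L) : ∃ a < L, f a = y := by
  have := Finset.surj_on_of_inj_on_of_card_le (s := Finset.range L) (t := Finset.range L)
    (fun a _ => f a) (fun a ha => by simpa using hf a (by simpa using ha))
    (fun a b ha hb hab => hinj a (by simpa using ha) b (by simpa using hb) hab) le_rfl y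
    (by simpa using hy)
  obtain ⟨a, ha, h⟩ := this
  exact ⟨a, by simpa using ha, h.symm⟩

/-- The first `L` values of `A` are listed in an order compatible with `P`. -/
def SortedBy (P : ℕ → ℕ → Prop) (A : ℕ → ℕ) (L : ℕ) : Prop :=
  ∀ a b, a < b → b < L → P (A a) (A b)

/-- `B` lists the `L` values of `A` in the stable order by `κ`. -/
def StableSort (κ : ℕ → ℕ) (A B : ℕ → ℕ) (L : ℕ) : Prop :=
  (∀ P, SortedBy P A L → SortedBy (fun x y => κ x < κ y ∨ κ x = κ y ∧ P x y) B L) ∧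
  ∀ v, (∃ b < L, B b = v) ↔ ∃ a < L, A a = v

theorem stableSort_of_dest {κ A B : ℕ → ℕ} {L : ℕ}
    (h : ∀ a < L, B (dest (fun a => κ (A a)) L a) = A a) : StableSort κ A B L := by
  have surj : ∀ y < L, ∃ a < L, dest (fun a => κ (A a)) L a = y := fun y hy =>
    exists_eq_of_inj_of_lt (fun a ha => dest_lt_length ha)
      (fun a ha b hb => dest_inj ha hb) hy
  refine ⟨fun P hP x y hxy hy => ?_, fun v => ⟨?_, ?_⟩⟩
  · obtain ⟨a, ha, rfl⟩ := surj x (by omega)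
    obtain ⟨b, hb, rfl⟩ := surj y hy
    rw [h a ha, h b hb]
    by_contra hn
    have : κ (A b) < κ (A a) ∨ κ (A b) = κ (A a) ∧ b < a ∨ a = b := by
      by_contra hn'
      exact hn (by
        by_cases hk : κ (A a) < κ (A b)
        · exact Or.inl hk
        · exact Or.inr ⟨by omega, hP a b (by omega) hb⟩)
    rcases this with h' | h' | rfl
    · have := dest_lt_dest (key := fun a => κ (A a)) hb (Or.inl h'); omega
    · have := dest_lt_dest (key := fun a => κ (A a)) hb (Or.inr h'); omega
    · omega
  · rintro ⟨b, hb, rfl⟩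
    obtain ⟨a, ha, rfl⟩ := surj b hb
    exact ⟨a, ha, (h a ha).symm⟩
  · rintro ⟨a, ha, rfl⟩
    exact ⟨_, dest_lt_length ha, h a ha⟩

open Stmt in
/-- Stable counting sort of the `len` values at `src` to `dst`, by the expression `key` in the
variable `x`, with values up to `K`. The addresses `0, …, K + 1` hold the counters. -/
def csort (src dst len : Var) (key : Expr) : Stmt :=
  seq (seq (set .a 0)
    (loop .lt Var.a (Var.K + 2) (seq (put 0 Var.a 0) (set .a (Var.a + 1))))) <|
  seq (seq (set .a 0)
    (loop .lt Var.a len (seq (set .x (.get src Var.a)) <| seq (set .c (key + 1)) <|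
      seq (put 0 Var.c (.get 0 Var.c + 1)) (set .a (Var.a + 1))))) <|
  seq (seq (set .a 1)
    (loop .lt Var.a (Var.K + 1) (seq (put 0 Var.a (.get 0 Var.a + .get 0 (Var.a - 1)))
      (set .a (Var.a + 1))))) <|
  seq (set .a 0)
    (loop .lt Var.a len (seq (set .x (.get src Var.a)) <| seq (set .c key) <|
      seq (put dst (.get 0 Var.c) Var.x) <|
      seq (put 0 Var.c (.get 0 Var.c + 1)) (set .a (Var.a + 1))))

/-- The counting sort in time `O(L + K)`. The key is an expression that may read the memory, hence
its value `κ` is required in all views that differ from `h` only in what the sort itself changes. -/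
theorem csort_run (hM : M.Fits) {src dst len : Var} (hsrc : src ∉ [Var.a, .c, .x])
    (hdst : dst ∉ [Var.a, .c, .x]) (hlen : len ∉ [Var.a, .c, .x]) {key : Expr}
    (hkd : key.depth ≤ 30) {h : View} {κ A : ℕ → ℕ} {X : ℕ} (hX : h.v len + h.v .K + 3 ≤ X)
    (hA : ∀ a < h.v len, h.mem (3 * h.v src + a) = A a)
    (hS : h.v .K + 2 ≤ 3 * h.v src) (hD : h.v .K + 2 ≤ 3 * h.v dst)
    (hSD : 3 * h.v src + h.v len ≤ 3 * h.v dst ∨ 3 * h.v dst + h.v len ≤ 3 * h.v src)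
    (hSs : 3 * h.v src + h.v len ≤ M.size) (hDs : 3 * h.v dst + h.v len ≤ M.size)
    (hKs : h.v .K + 2 ≤ M.size)
    (hLw : h.v len + 3 < 2 ^ M.wordBits) (hKw : h.v .K + 3 < 2 ^ M.wordBits)
    (hκ : ∀ a < h.v len, κ (A a) ≤ h.v .K)
    (hkey : ∀ h', Frame [.a, .c, .x] (fun k => k < h.v .K + 2 ∨
          3 * h.v dst ≤ k ∧ k < 3 * h.v dst + h.v len) h h' →
        (∃ a < h.v len, h'.v .x = A a) → key.Ok M h' ∧ key.eval M h' = κ (h'.v .x)) :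
    (csort src dst len key).RunIn M h X (fun h' =>
      Frame [.a, .c, .x] (fun k => k < h.v .K + 2 ∨
        3 * h.v dst ≤ k ∧ k < 3 * h.v dst + h.v len) h h' ∧
      StableSort κ A (fun b => h'.mem (3 * h.v dst + b)) (h.v len)) := by
  simp only [List.mem_cons, List.not_mem_nil, or_false, not_or] at hsrc hdst hlen
  set L := h.v len with hL
  set S := h.v src with hSdef
  set D := h.v dst with hDdef
  set K := h.v .K with hK
  set R : ℕ → Prop := fun k => k < K + 2 ∨ 3 * D ≤ k ∧ k < 3 * D + L with hR
  have hw := hM.bits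
  -- what the frame says about the parameters
  have fr : ∀ h', Frame [.a, .c, .x] R h h' → h'.v len = L ∧ h'.v src = S ∧ h'.v dst = D ∧
      h'.v .K = K ∧ ∀ a < L, h'.mem (3 * S + a) = A a := by
    intro h' hf
    refine ⟨hf.1 _ (by simp [hlen]), hf.1 _ (by simp [hsrc]), hf.1 _ (by simp [hdst]),
      hf.1 _ (by simp), fun a ha => (hf.2 _ ?_).trans (hA a ha)⟩
    simp only [hR]; omega
  refine Stmt.RunIn.seq (R := fun h' => Frame [.a, .c, .x] R h h' ∧ ∀ c < K + 2, h'.mem c = 0)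
    ?_ fun h1 hh1 => Stmt.RunIn.seq (R := fun h' => Frame [.a, .c, .x] R h h' ∧
      ∀ c < K + 2, h'.mem c = Nat.count (fun b => κ (A b) + 1 = c) L) ?_ fun h2 hh2 =>
    Stmt.RunIn.seq (R := fun h' => Frame [.a, .c, .x] R h h' ∧
      ∀ c ≤ K, h'.mem c = Nat.count (fun b => κ (A b) < c) L) ?_ fun h3 hh3 => ?_
  · refine Stmt.RunIn.count hM (fun k h' => Frame [.a, .c, .x] R h h' ∧
      h'.v .a = k ∧ ∀ c < k, h'.mem c = 0) (K + 2) (by omega) (by simp) (by simp) (by simp)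
      (by simp [Stmt.Simple]) (by simp) ?_ ?_ ?_ ?_
    · rintro k hk h' ⟨hf, ha, h0⟩
      obtain ⟨f1, f2, f3, f4, f5⟩ := fr h' hf
      simp [ha, f4]; omega
    · rintro k hk h' ⟨hf, ha, h0⟩
      simp only [Stmt.wp, ok_ofNat, ok_var, eval_ofNat, eval_var, ha, ok_add, eval_add,
        View.put_v, View.set_v, View.set_mem, View.put_mem]
      refine ⟨by omega, trivial, by omega, by omega, ⟨trivial, by omega, by omega⟩,
        (hf.put (by simp only [hR]; omega) _).set (by simp) _, by simp, fun c hc => ?_⟩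
      split_ifs with h1
      · rfl
      · exact h0 c (by omega)
    · exact ⟨(Frame.refl _ _ _).set (by simp) _, by simp, by simp⟩
    · rintro h' ⟨hf, ha, h0⟩; exact ⟨hf, h0⟩
  · refine Stmt.RunIn.count hM (fun k h' => Frame [.a, .c, .x] R h h' ∧
      h'.v .a = k ∧ ∀ c < K + 2, h'.mem c = Nat.count (fun b => κ (A b) + 1 = c) k)
      L (by omega) (by simp) (by simp) (by simp)
      (by simp [Stmt.Simple]; omega) (by simp) ?_ ?_ ?_ ?_
    · rintro k hk h' ⟨hf, ha, h0⟩
      obtain ⟨f1, f2, f3, f4, f5⟩ := fr h' hf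
      simp [ha, f1]
    · rintro k hk h' ⟨hf, ha, h0⟩
      obtain ⟨f1, f2, f3, f4, f5⟩ := fr h' hf
      obtain ⟨ok1, ev1⟩ := hkey (h'.set .x (A k)) (hf.set (by simp) _) ⟨k, hk, by simp⟩
      simp only [View.set_v, if_true] at ev1
      have hκk := hκ k hk
      simp only [Stmt.wp, ok_ofNat, ok_var, eval_ofNat, eval_var, ha, ok_add, eval_add, ok_get,
        eval_get, f2, f5 k hk, View.put_v, View.set_v, View.set_mem, View.put_mem, ev1,
        reduceCtorEq, if_false, if_true, ok1]
      have hm : h'.mem (3 * 0 + (κ (A k) + 1)) =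
        Nat.count (fun b => κ (A b) + 1 = κ (A k) + 1) k := by
          rw [Nat.mul_zero, Nat.zero_add]; exact h0 _ (by omega)
      have hle : Nat.count (fun b => κ (A b) + 1 = κ (A k) + 1) k ≤ k := Nat.count_le _
      rw [hm]
      refine ⟨⟨trivial, trivial, by omega⟩, ⟨trivial, by omega, by omega⟩, by omega, trivial,
        ⟨⟨by omega, trivial, by omega⟩, by omega, by omega⟩, by omega,
        ⟨trivial, by omega, by omega⟩,
        ((((hf.set (by simp) _).set (by simp) _).put (by simp only [hR]; omega) _).set
          (by simp) _), trivial, fun c hc => ?_⟩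
      rw [Nat.count_succ]
      split_ifs with h1 h2 h2
      · rw [show c = κ (A k) + 1 by omega]
      · omega
      · omega
      · exact h0 c hc
    · exact ⟨hh1.1.set (by simp) _, by simp, fun c hc => by simpa using hh1.2 c hc⟩
    · rintro h' ⟨hf, ha, h0⟩; exact ⟨hf, h0⟩
  · refine Stmt.RunIn.count hM (fun k h' => Frame [.a, .c, .x] R h h' ∧
      h'.v .a = k + 1 ∧ ∀ c ≤ K, h'.mem c = if c ≤ k then Nat.count (fun b => κ (A b) < c) L
        else Nat.count (fun b => κ (A b) + 1 = c) L)
      K (by omega) (by simp) (by simp) (by simp)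
      (by simp [Stmt.Simple]) (by simp) ?_ ?_ ?_ ?_
    · rintro k hk h' ⟨hf, ha, h0⟩
      obtain ⟨f1, f2, f3, f4, f5⟩ := fr h' hf
      simp [ha, f4]; omega
    · rintro k hk h' ⟨hf, ha, h0⟩
      obtain ⟨f1, f2, f3, f4, f5⟩ := fr h' hf
      have hm1 : h'.mem (3 * 0 + (k + 1)) = Nat.count (fun b => κ (A b) + 1 = k + 1) L := by
        rw [Nat.mul_zero, Nat.zero_add, h0 _ (by omega), if_neg (by omega)]
      have hm2 : h'.mem (3 * 0 + (k + 1 - 1)) = Nat.count (fun b => κ (A b) < k) L := by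
        rw [Nat.mul_zero, Nat.zero_add, Nat.add_sub_cancel, h0 _ (by omega), if_pos le_rfl]
      have hsum : Nat.count (fun b => κ (A b) + 1 = k + 1) L + Nat.count (fun b => κ (A b) < k) L
          = Nat.count (fun b => κ (A b) < k + 1) L := by
        clear hm1 hm2
        generalize L = L'
        induction L' with
        | zero => simp
        | succ l ih =>
          simp only [Nat.count_succ, ← ih]
          split_ifs <;> omega
      have hle : Nat.count (fun b => κ (A b) < k + 1) L ≤ L := Nat.count_le _
      simp only [Stmt.wp, ok_ofNat, ok_var, eval_ofNat, eval_var, ha, ok_add, eval_add, ok_get,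
        ok_sub, eval_sub, eval_get, View.put_v, View.set_v, View.set_mem, View.put_mem, hm1, hm2,
        if_true, hsum]
      refine ⟨by omega, trivial, ⟨⟨by omega, trivial, by omega⟩, ⟨by omega, ⟨trivial, by omega⟩,
        by omega⟩, by omega⟩, by omega, ⟨trivial, by omega, by omega⟩,
        (hf.put (by simp only [hR]; omega) _).set (by simp) _, trivial, fun c hc => ?_⟩
      split_ifs with h1 h2 h2
      · rw [show c = k + 1 by omega]
      · omega
      · rw [h0 c hc, if_pos (by omega)]
      · rw [h0 c hc, if_neg (by omega)]
    · refine ⟨hh2.1.set (by simp) _, by simp, fun c hc => ?_⟩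
      rw [View.set_mem, hh2.2 c (by omega)]
      split_ifs with h1
      · obtain rfl : c = 0 := by omega
        simp
      · rfl
    · rintro h' ⟨hf, ha, h0⟩
      exact ⟨hf, fun c hc => by rw [h0 c hc, if_pos hc]⟩
  · refine Stmt.RunIn.count hM (fun k h' => Frame [.a, .c, .x] R h h' ∧
      h'.v .a = k ∧ (∀ c ≤ K, h'.mem c = Nat.count (fun b => κ (A b) < c) L +
        Nat.count (fun b => κ (A b) = c) k) ∧
      ∀ b < k, h'.mem (3 * D + dest (fun b => κ (A b)) L b) = A b)
      L (by omega) (by simp) (by simp) (by simp)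
      (by simp [Stmt.Simple]; omega) (by simp) ?_ ?_ ?_ ?_
    · rintro k hk h' ⟨hf, ha, h0, -⟩
      obtain ⟨f1, f2, f3, f4, f5⟩ := fr h' hf
      simp [ha, f1]
    · rintro k hk h' ⟨hf, ha, h0, hd⟩
      obtain ⟨f1, f2, f3, f4, f5⟩ := fr h' hf
      obtain ⟨ok1, ev1⟩ := hkey (h'.set .x (A k)) (hf.set (by simp) _) ⟨k, hk, by simp⟩
      simp only [View.set_v, if_true] at ev1
      have hκk := hκ k hk
      have hm : h'.mem (3 * 0 + (κ (A k))) = dest (fun b => κ (A b)) L k := by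
        rw [Nat.mul_zero, Nat.zero_add]; exact h0 _ (by omega)
      have hlt : dest (fun b => κ (A b)) L k < L := dest_lt_length hk
      simp only [Stmt.wp, ok_ofNat, ok_var, eval_ofNat, eval_var, ha, ok_add, eval_add, ok_get,
        eval_get, f2, f3, f5 k hk, View.put_v, View.set_v, View.set_mem, View.put_mem, ev1,
        reduceCtorEq, if_false, if_true, ok1, hm, hdst]
      have hne : ¬ (3 * 0 + κ (A k) = 3 * D + dest (fun b => κ (A b)) L k) := by omega
      simp only [hne, if_false]
      refine ⟨⟨trivial, trivial, by omega⟩, trivial, trivial, ⟨by omega, trivial, by omega⟩,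
        trivial, by omega, by omega, trivial,
        ⟨⟨by omega, trivial, by omega⟩, by omega, by omega⟩, by omega,
        ⟨trivial, by omega, by omega⟩, ?_, trivial, fun c hc => ?_, fun b hb => ?_⟩
      · refine Frame.set (Frame.put (Frame.put ((hf.set (by simp) _).set (by simp) _) ?_ _) ?_ _)
          (by simp) _
        · simp only [hR]; omega
        · simp only [hR]; omega
      · rw [Nat.count_succ]
        rw [if_neg (by omega : ¬ (c = 3 * D + dest (fun b => κ (A b)) L k))]
        split_ifs with h1 h2 h2
        · rw [show c = κ (A k) by omega]; simp only [dest]; omega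
        · omega
        · omega
        · exact h0 c hc
      · have hbl : dest (fun b => κ (A b)) L b < L := dest_lt_length (by omega)
        rw [if_neg (by omega)]
        split_ifs with h1
        · rw [dest_inj (key := fun b => κ (A b)) hk (by omega : b < L) (by omega)]
        · refine hd b ?_
          by_contra hbk
          exact h1 (by rw [show b = k by omega])
    · exact ⟨hh3.1.set (by simp) _, by simp, fun c hc => by simpa using hh3.2 c hc, by simp⟩
    · rintro h' ⟨hf, ha, h0, hd⟩
      exact ⟨hf, stableSort_of_dest hd⟩

/-! ### Order of suffixes, and the reduction to two thirds of the length -/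

/-- The suffix at `i` is smaller than the suffix at `j`, for a string that is continued by zeros. -/
def SufLt (s : ℕ → ℕ) (i j : ℕ) : Prop :=
  ∃ d, (∀ t < d, s (i + t) = s (j + t)) ∧ s (i + d) < s (j + d)

/-- `s` is a string of length `m`, continued by zeros, with positive letters. -/
structure IsStr (s : ℕ → ℕ) (m : ℕ) : Prop where
  pos : ∀ i < m, 1 ≤ s i
  zero : ∀ i, m ≤ i → s i = 0

section
variable {s : ℕ → ℕ} {m i j k : ℕ}

theorem SufLt.of_lt (h : s i < s j) : SufLt s i j := ⟨0, by simp, by simpa using h⟩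

theorem SufLt.cons (h : s i = s j) (h' : SufLt s (i + 1) (j + 1)) : SufLt s i j := by
  obtain ⟨d, hd, hlt⟩ := h'
  refine ⟨d + 1, fun t ht => ?_, ?_⟩
  · rcases t with _ | t
    · simpa using h
    · have := hd t (by omega)
      rwa [show i + (t + 1) = i + 1 + t by omega, show j + (t + 1) = j + 1 + t by omega]
  · rwa [show i + (d + 1) = i + 1 + d by omega, show j + (d + 1) = j + 1 + d by omega]

theorem SufLt.irrefl (i : ℕ) : ¬ SufLt s i i := fun ⟨_, _, h⟩ => lt_irrefl _ h

theorem SufLt.ne (h : SufLt s i j) : i ≠ j := by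
  rintro rfl; exact SufLt.irrefl _ h

theorem SufLt.trans (h₁ : SufLt s i j) (h₂ : SufLt s j k) : SufLt s i k := by
  obtain ⟨d, hd, hlt⟩ := h₁
  obtain ⟨e, he, hlt'⟩ := h₂
  refine ⟨min d e, fun t ht => (hd t (by omega)).trans (he t (by omega)), ?_⟩
  rcases lt_trichotomy d e with h | rfl | h
  · rw [min_eq_left h.le, ← he d h]; exact hlt
  · rw [min_self]; exact hlt.trans hlt'
  · rw [min_eq_right h.le, hd e h]; exact hlt'

/-- `A` lists the positions of `s` in increasing order of their suffixes. -/
def IsSA (s : ℕ → ℕ) (m : ℕ) (A : ℕ → ℕ) : Prop :=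
  (∀ k < m, A k < m) ∧ SortedBy (SufLt s) A m

theorem IsSA.surj {A : ℕ → ℕ} (h : IsSA s m A) {x : ℕ} (hx : x < m) : ∃ a < m, A a = x := by
  refine exists_eq_of_inj_of_lt h.1 (fun a ha b hb hab => ?_) hx
  by_contra hne
  rcases Nat.lt_or_gt_of_ne hne with h' | h'
  · exact (h.2 a b h' hb).ne hab
  · exact (h.2 b a h' ha).ne hab.symm

end

/-- The positions of the sample: those congruent to `1` modulo `3`, of which there are `q`, and then
those congruent to `2`. -/
def samplePos (q r : ℕ) : ℕ := if r < q then 3 * r + 1 else 3 * (r - q) + 2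

/-- Lexicographic order of the triples of letters at `p` and `p'`. -/
def TriLt (s : ℕ → ℕ) (p p' : ℕ) : Prop :=
  s p < s p' ∨ s p = s p' ∧
    (s (p + 1) < s (p' + 1) ∨ s (p + 1) = s (p' + 1) ∧ s (p + 2) < s (p' + 2))

/-- The triples of letters at `p` and `p'` are equal. -/
def TriEq (s : ℕ → ℕ) (p p' : ℕ) : Prop :=
  s p = s p' ∧ s (p + 1) = s (p' + 1) ∧ s (p + 2) = s (p' + 2)

/-- `R` is the string of the names of the triples of `s` at the sample positions. If `m` is
congruent to `1` modulo `3`, then `m` counts as a sample position, so that the last triple of the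
first half contains a zero in all cases. -/
structure Reduces (s : ℕ → ℕ) (m : ℕ) (R : ℕ → ℕ) : Prop where
  str : IsStr R ((m + 2) / 3 + m / 3)
  le : ∀ x < (m + 2) / 3 + m / 3, R x ≤ (m + 2) / 3 + m / 3
  lt : ∀ x < (m + 2) / 3 + m / 3, ∀ y < (m + 2) / 3 + m / 3, R x < R y →
    TriLt s (samplePos ((m + 2) / 3) x) (samplePos ((m + 2) / 3) y)
  eq : ∀ x < (m + 2) / 3 + m / 3, ∀ y < (m + 2) / 3 + m / 3, R x = R y →
    TriEq s (samplePos ((m + 2) / 3) x) (samplePos ((m + 2) / 3) y)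

section
variable {s R : ℕ → ℕ} {m : ℕ}

theorem TriLt.sufLt {p p' : ℕ} (h : TriLt s p p') : SufLt s p p' := by
  rcases h with h | ⟨h, h' | ⟨h', h''⟩⟩
  · exact .of_lt h
  · exact .cons h (.of_lt h')
  · exact .cons h (.cons h' (.of_lt h''))

/-- Positions whose equal triples reach beyond the end of the string are equal. -/
theorem TriEq.eq_of_le (hs : IsStr s m) {p p' : ℕ} (h : TriEq s p p') (hp : p ≤ m) (hp' : p' ≤ m)
    (hm : m ≤ p + 2) : p = p' := by
  obtain ⟨h0, h1, h2⟩ := h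
  have z : ∀ i, s i = 0 ↔ m ≤ i := fun i =>
    ⟨fun h => by by_contra hn; have := hs.pos i (by omega); omega, hs.zero i⟩
  have e0 : m ≤ p ↔ m ≤ p' := by rw [← z, ← z, h0]
  have e1 : m ≤ p + 1 ↔ m ≤ p' + 1 := by rw [← z, ← z, h1]
  have e2 : m ≤ p + 2 ↔ m ≤ p' + 2 := by rw [← z, ← z, h2]
  omega

/-- The suffixes of the reduced string are in the same order as the suffixes of `s` at the sample
positions. Equal names mean equal triples, and one step in the reduced string is three steps in `s`
until a triple reaches the end of `s`; equal triples of this kind occur only at equal positions, so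
the comparison of different suffixes is decided before it runs from the first half of the reduced
string into the second one. -/
theorem Reduces.sufLt (hs : IsStr s m) (h : Reduces s m R) {x y : ℕ}
    (hx : x < (m + 2) / 3 + m / 3) (hy : y < (m + 2) / 3 + m / 3) (hxy : SufLt R x y) :
    SufLt s (samplePos ((m + 2) / 3) x) (samplePos ((m + 2) / 3) y) := by
  obtain ⟨d, hd, hlt⟩ := hxy
  induction d generalizing x y with
  | zero => exact (h.lt x hx y hy (by simpa using hlt)).sufLt
  | succ d ih =>
    have hR : R x = R y := by simpa using hd 0 (by omega)
    have hne : x ≠ y := by rintro rfl; omega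
    have ht := h.eq x hx y hy hR
    set q := (m + 2) / 3 with hq
    have hpx : samplePos q x ≤ m := by simp only [samplePos]; split_ifs <;> omega
    have hpy : samplePos q y ≤ m := by simp only [samplePos]; split_ifs <;> omega
    have hpne : samplePos q x ≠ samplePos q y := by
      simp only [samplePos]; split_ifs <;> omega
    have hx2 : samplePos q x + 2 < m := by
      by_contra hn
      exact hpne (ht.eq_of_le hs hpx hpy (by omega))
    have hy2 : samplePos q y + 2 < m := by
      by_contra hn
      exact hpne.symm (TriEq.eq_of_le hs ⟨ht.1.symm, ht.2.1.symm, ht.2.2.symm⟩ hpy hpx (by omega))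
    have hd' : ∀ t < d, R (x + 1 + t) = R (y + 1 + t) := fun t ht => by
      have := hd (t + 1) (by omega)
      rwa [show x + (t + 1) = x + 1 + t by omega, show y + (t + 1) = y + 1 + t by omega] at this
    have hlt' : R (x + 1 + d) < R (y + 1 + d) := by
      rwa [show x + (d + 1) = x + 1 + d by omega, show y + (d + 1) = y + 1 + d by omega] at hlt
    have hshift : SufLt s (samplePos q x + 3) (samplePos q y + 3) := by
      have hyn : y + 1 < q + m / 3 := by
        by_contra hn
        rw [h.str.zero (y + 1 + d) (by omega)] at hlt'
        omega
      have hy3 : samplePos q y + 3 = samplePos q (y + 1) := by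
        simp only [samplePos] at hy2 ⊢; split_ifs at hy2 ⊢ <;> omega
      by_cases hxn : x + 1 < q + m / 3
      · have hx3 : samplePos q x + 3 = samplePos q (x + 1) := by
          simp only [samplePos] at hx2 ⊢; split_ifs at hx2 ⊢ <;> omega
        rw [hx3, hy3]
        exact ih hxn hyn hd' hlt'
      · refine .of_lt ?_
        rw [hs.zero (samplePos q x + 3)]
        · refine hs.pos _ ?_
          simp only [samplePos] at hx2 hy2 ⊢; split_ifs at hx2 hy2 ⊢ <;> omega
        · simp only [samplePos] at hx2 ⊢; split_ifs at hx2 ⊢ <;> omega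
    exact .cons ht.1 (.cons ht.2.1 (.cons ht.2.2 hshift))

/-- The rank of the suffix at a sample position, or at the end, from the ranks of the suffixes of
the reduced string. -/
def sampleRank (ρ : ℕ → ℕ) (m p : ℕ) : ℕ :=
  if p % 3 = 1 then ρ (p / 3) else if p / 3 < m / 3 then ρ ((m + 2) / 3 + p / 3) else 0

/-- Ranks compare suffixes at sample positions; the end of the string has rank `0` unless it counts
as a sample position itself. -/
theorem sampleRank_spec (hs : IsStr s m) (h : Reduces s m R) {A ρ : ℕ → ℕ}
    (hA : IsSA R ((m + 2) / 3 + m / 3) A)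
    (hρ : ∀ a < (m + 2) / 3 + m / 3, ρ (A a) = a + 1) {p p' : ℕ} (hp : p ≤ m) (hp' : p' ≤ m)
    (h3 : p % 3 ≠ 0) (h3' : p' % 3 ≠ 0) :
    (sampleRank ρ m p < sampleRank ρ m p' → SufLt s p p') ∧
    (sampleRank ρ m p = sampleRank ρ m p' → p = p') := by
  have key : ∀ p ≤ m, p % 3 ≠ 0 → (p = m ∧ sampleRank ρ m p = 0) ∨
      ∃ a < (m + 2) / 3 + m / 3, sampleRank ρ m p = a + 1 ∧ samplePos ((m + 2) / 3) (A a) = p := by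
    intro p hp h3
    simp only [sampleRank]
    split_ifs with h1 h2
    · obtain ⟨a, ha, hx⟩ := hA.surj (x := p / 3) (by omega)
      refine Or.inr ⟨a, ha, by rw [← hx, hρ a ha], ?_⟩
      rw [hx]; simp only [samplePos]; split_ifs <;> omega
    · obtain ⟨a, ha, hx⟩ := hA.surj (x := (m + 2) / 3 + p / 3) (by omega)
      refine Or.inr ⟨a, ha, by rw [← hx, hρ a ha], ?_⟩
      rw [hx]; simp only [samplePos]; split_ifs <;> omega
    · exact Or.inl ⟨by omega, rfl⟩
  rcases key p hp h3 with ⟨e, hr⟩ | ⟨a, ha, hr, e⟩ <;>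
    rcases key p' hp' h3' with ⟨e', hr'⟩ | ⟨b, hb, hr', e'⟩
  · rw [hr, hr']; exact ⟨by omega, fun _ => e.trans e'.symm⟩
  · rw [hr, hr']
    refine ⟨fun _ => ?_, by omega⟩
    rcases Nat.lt_or_ge p' m with hlt | hge
    · refine .of_lt ?_
      rw [hs.zero p (by omega)]
      exact hs.pos p' hlt
    · -- both positions are the end of the string, once with and once without a rank
      exfalso
      obtain rfl : p' = p := by omega
      omega
  · rw [hr, hr']; exact ⟨by omega, by omega⟩
  · rw [hr, hr', ← e, ← e']
    refine ⟨fun hlt => h.sufLt hs (hA.1 a ha) (hA.1 b hb) (hA.2 a b (by omega) hb), fun heq => ?_⟩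
    rw [show a = b by omega]

/-- The comparison of the suffixes at a sample position `x` and at a multiple `y` of `3`. -/
def MergeLt (s ρ : ℕ → ℕ) (m x y : ℕ) : Prop :=
  s x < s y ∨ s x = s y ∧
    (x % 3 = 1 ∧ sampleRank ρ m (x + 1) < sampleRank ρ m (y + 1) ∨
     x % 3 ≠ 1 ∧ (s (x + 1) < s (y + 1) ∨ s (x + 1) = s (y + 1) ∧
       sampleRank ρ m (x + 2) < sampleRank ρ m (y + 2)))

/-- After one or two letters, both positions are in the sample, where ranks decide. -/
theorem mergeLt_spec (hs : IsStr s m) {ρ : ℕ → ℕ}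
    (hrank : ∀ p ≤ m, ∀ p' ≤ m, p % 3 ≠ 0 → p' % 3 ≠ 0 →
      (sampleRank ρ m p < sampleRank ρ m p' → SufLt s p p') ∧
      (sampleRank ρ m p = sampleRank ρ m p' → p = p')) {x y : ℕ} (hx : x < m) (hy : y < m)
    (hx3 : x % 3 ≠ 0) (hy3 : y % 3 = 0) :
    (MergeLt s ρ m x y → SufLt s x y) ∧ (¬ MergeLt s ρ m x y → SufLt s y x) := by
  by_cases h0 : s x = s y
  swap
  · refine ⟨fun h => .of_lt (h.resolve_right fun h => h0 h.1), fun h => .of_lt ?_⟩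
    have : ¬ s x < s y := fun h' => h (Or.inl h')
    omega
  by_cases h1 : x % 3 = 1
  · have r1 := hrank (x + 1) (by omega) (y + 1) (by omega) (by omega) (by omega)
    have r2 := hrank (y + 1) (by omega) (x + 1) (by omega) (by omega) (by omega)
    refine ⟨fun h => .cons h0 (r1.1 ?_), fun h => .cons h0.symm (r2.1 ?_)⟩
    · rcases h with h | ⟨-, h | h⟩
      · omega
      · exact h.2
      · exact absurd h1 h.1
    · have n1 : ¬ sampleRank ρ m (x + 1) < sampleRank ρ m (y + 1) := fun h' =>
        h (Or.inr ⟨h0, Or.inl ⟨h1, h'⟩⟩)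
      have n2 : sampleRank ρ m (x + 1) ≠ sampleRank ρ m (y + 1) := fun h' => by
        have := r1.2 h'; omega
      omega
  · by_cases h2 : s (x + 1) = s (y + 1)
    · -- a zero at both places would be the end of both suffixes
      have hx1 : x + 1 < m := by
        by_contra hn
        have e := hs.zero (x + 1) (by omega)
        have : ¬ y + 1 < m := fun hlt => by have := hs.pos (y + 1) hlt; omega
        omega
      have hy1 : y + 1 < m := by
        by_contra hn
        have e := hs.zero (y + 1) (by omega)
        have := hs.pos (x + 1) hx1; omega
      have r1 := hrank (x + 2) (by omega) (y + 2) (by omega) (by omega) (by omega)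
      have r2 := hrank (y + 2) (by omega) (x + 2) (by omega) (by omega) (by omega)
      refine ⟨fun h => .cons h0 (.cons h2 (r1.1 ?_)), fun h =>
        .cons h0.symm (.cons h2.symm (r2.1 ?_))⟩
      · rcases h with h | ⟨-, h | ⟨-, h | h⟩⟩
        · omega
        · exact absurd h.1 h1
        · omega
        · exact h.2
      · have n1 : ¬ sampleRank ρ m (x + 2) < sampleRank ρ m (y + 2) := fun h' =>
          h (Or.inr ⟨h0, Or.inr ⟨h1, Or.inr ⟨h2, h'⟩⟩⟩)
        have n2 : sampleRank ρ m (x + 2) ≠ sampleRank ρ m (y + 2) := fun h' => by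
          have := r1.2 h'; omega
        omega
    · refine ⟨fun h => .cons h0 (.of_lt ?_), fun h => .cons h0.symm (.of_lt ?_)⟩
      · rcases h with h | ⟨-, h | ⟨-, h | h⟩⟩
        · omega
        · exact absurd h.1 h1
        · exact h
        · exact absurd h.1 h2
      · have n1 : ¬ s (x + 1) < s (y + 1) := fun h' => h (Or.inr ⟨h0, Or.inr ⟨h1, Or.inl h'⟩⟩)
        omega

end

/-! ### Sorting and naming the triples of a level -/

/-- The letter number `e`, counted from `0`, of the string of the current level: the text itself at
level `0`, and otherwise a string in the memory that begins in row `top`. -/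
def letter (e : Expr) : Expr :=
  .ite .lt e Var.m (.ite .eq Var.lev 0 (.text (e + 1)) (.get Var.top e)) 0

/-- `samplePos` as an expression. -/
def samplePosE (e : Expr) : Expr := .ite .lt e Var.q (3 * e + 1) (3 * (e - Var.q) + 2)

/-- The view `h` is set up for the work on the string `s`. The memory below row `top` is free; row
`tp` is where the reduced string goes, and between them there is room for the counters of the
counting sort (from row `0`), for one list of sample positions (from row `b1`) and for two lists of
multiples of `3`. -/
structure Level (M : Machine) (s : ℕ → ℕ) (h : View) : Prop where
  str : IsStr s (h.v .m)
  bound : ∀ i, s i ≤ h.v .K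
  text : h.v .lev = 0 → h.v .m = M.text.length ∧ ∀ i < h.v .m, s i = M.text.getD i 0
  mem : h.v .lev ≠ 0 → 3 * h.v .top + h.v .m ≤ M.size ∧
    ∀ i < h.v .m, h.mem (3 * h.v .top + i) = s i
  q_eq : h.v .q = (h.v .m + 2) / 3
  np_eq : h.v .np = h.v .q + h.v .m / 3
  two_le : 2 ≤ h.v .m
  m_le : h.v .m ≤ h.v .K
  K_le : h.v .K ≤ M.text.length + M.alphabetSize
  b1_eq : h.v .b1 = h.v .K / 3 + 2
  room : h.v .b1 + (h.v .np / 3 + 1) + 2 * (h.v .q / 3 + 1) ≤ h.v .tp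
  top_eq : h.v .top = h.v .tp + (h.v .np / 3 + 1)
  top_le : 3 * h.v .top ≤ M.size

theorem Level.frame {s : ℕ → ℕ} {h h' : View} (hl : Level M s h) {vs : List Var} {R : ℕ → Prop}
    (hf : Frame vs R h h') (hR : ∀ k, R k → k < 3 * h.v .top)
    (hvs : ∀ v ∈ [Var.lev, .m, .top, .K, .q, .np, .tp, .b1], v ∉ vs) : Level M s h' := by
  have e : ∀ v ∈ [Var.lev, .m, .top, .K, .q, .np, .tp, .b1], h'.v v = h.v v := fun v hv =>
    hf.1 v (hvs v hv)
  simp only [List.mem_cons, List.not_mem_nil, or_false, forall_eq_or_imp, forall_eq] at e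
  obtain ⟨e1, e2, e3, e4, e5, e6, e7, e8⟩ := e
  obtain ⟨a1, a2, a3, a4, a5, a6, a7, a8, a9, a10, a11, a12, a13⟩ := hl
  constructor <;> simp only [e1, e2, e3, e4, e5, e6, e7, e8] <;> try assumption
  refine fun h0 => ⟨(a4 h0).1, fun i hi => ?_⟩
  rw [hf.2 _ fun hk => by have := hR _ hk; omega]
  exact (a4 h0).2 i hi

theorem Level.letter_eval {s : ℕ → ℕ} {h : View} (hl : Level M s h) {e : Expr}
    (he : e.Ok M h) (hw : e.eval M h + 1 < 2 ^ M.wordBits) :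
    (letter e).Ok M h ∧ (letter e).eval M h = s (e.eval M h) := by
  classical
  simp only [letter, ok_ite, eval_ite, ok_var, eval_var, holds_lt, holds_eq, ok_ofNat,
    eval_ofNat, ok_text, eval_text, ok_add, eval_add, ok_get, eval_get, he, true_and,
    Nat.add_sub_cancel]
  by_cases hm : e.eval M h < h.v .m
  · by_cases h0 : h.v .lev = 0
    · have := hl.text h0
      simp only [hm, h0, if_true]
      refine ⟨⟨fun _ => ⟨by omega, fun _ => ⟨⟨by omega, by omega⟩, by omega, by omega⟩,
        by simp⟩, by simp⟩, ?_⟩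
      rw [this.2 _ hm]
    · have := hl.mem h0
      simp only [hm, h0, if_true, if_false]
      refine ⟨⟨fun _ => ⟨by omega, by simp, fun _ => by omega⟩, by simp⟩, this.2 _ hm⟩
  · simp only [hm, if_false]
    exact ⟨⟨by simp, fun _ => by omega⟩, (hl.str.zero _ (by omega)).symm⟩

theorem samplePosE_spec {h : View} {e : Expr} (he : e.Ok M h)
    (hw : samplePos (h.v .q) (e.eval M h) < 2 ^ M.wordBits) :
    (samplePosE e).Ok M h ∧ (samplePosE e).eval M h = samplePos (h.v .q) (e.eval M h) := by
  classical
  simp only [samplePosE, ok_ite, eval_ite, ok_var, eval_var, holds_lt, ok_ofNat, eval_ofNat,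
    ok_add, ok_mul, ok_sub, eval_sub, eval_mul, eval_add, he, true_and, samplePos, and_true] at *
  split_ifs at hw with h1 <;> simp only [h1, true_implies, false_implies, not_true, not_false_iff,
    and_true, true_and] <;> omega

theorem samplePos_le {m r : ℕ} (hr : r < (m + 2) / 3 + m / 3) : samplePos ((m + 2) / 3) r ≤ m := by
  simp only [samplePos]; split_ifs <;> omega

/-- The key `x ↦ s (samplePos x + d)` of the radix sort of triples. -/
theorem Level.letter_samplePos {s : ℕ → ℕ} {h : View} (hM : M.Fits) (hl : Level M s h) {x : Var}
    (hx : h.v x < h.v .np) {d : Expr} {k : ℕ} (hd : d.eval M h = k) (hd' : d.Ok M h) (hk : k ≤ 2) :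
    (letter (samplePosE x + d)).Ok M h ∧
      (letter (samplePosE x + d)).eval M h = s (samplePos (h.v .q) (h.v x) + k) := by
  have hw := hM.bits
  have h1 := hl.q_eq
  have h2 := hl.np_eq
  have h3 := hl.K_le
  have h4 := hl.m_le
  have hle : samplePos (h.v .q) (h.v x) ≤ h.v .m := by
    rw [h1]; exact samplePos_le (by omega)
  obtain ⟨o1, v1⟩ := samplePosE_spec (M := M) (h := h) (e := .var x) trivial
    (by rw [eval_var]; omega)
  rw [eval_var] at v1
  have := hl.letter_eval (e := samplePosE x + d) ⟨o1, hd', ?_⟩ ?_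
  · simpa only [eval_add, v1, hd] using this
  · show (samplePosE x).eval M h + d.eval M h < _
    rw [v1, hd]; omega
  · show (samplePosE x).eval M h + d.eval M h + 1 < _
    rw [v1, hd]; omega

/-- Sorts the sample positions by their triples: a radix sort by the third, the second and the
first letter, from row `tp` to row `b1`. -/
def sortTriples : Stmt :=
  .seq (.seq (.set .a 0) (.loop .lt Var.a Var.np
    (.seq (.put Var.tp Var.a Var.a) (.set .a (Var.a + 1))))) <|
  .seq (csort .tp .b1 .np (letter (samplePosE Var.x + 2))) <|
  .seq (csort .b1 .tp .np (letter (samplePosE Var.x + 1)))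
    (csort .tp .b1 .np (letter (samplePosE Var.x + 0)))

/-- Distinct sample positions with equal triples may come in any order. -/
theorem sortTriples_run (hM : M.Fits) {s : ℕ → ℕ} {h : View} (hl : Level M s h) {X : ℕ}
    (hX : h.v .np + h.v .K + 3 ≤ X) :
    sortTriples.RunIn M h X fun h' => Frame [.a, .c, .x] (fun k => k < 3 * h.v .top) h h' ∧
      (∀ a < h.v .np, h'.mem (3 * h.v .b1 + a) < h.v .np) ∧
      SortedBy (fun x y => TriLt s (samplePos (h.v .q) x) (samplePos (h.v .q) y) ∨
        TriEq s (samplePos (h.v .q) x) (samplePos (h.v .q) y) ∧ x ≠ y)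
        (fun a => h'.mem (3 * h.v .b1 + a)) (h.v .np) := by
  have hw := hM.bits
  obtain ⟨-, h2, -, -, h5, h6, h7, h8, h9, h10, h11, h12, h13⟩ := id hl
  have hns : ∀ v ∈ [Var.lev, .m, .top, .K, .q, .np, .tp, .b1], v ∉ [Var.a, .c, .x] := by decide
  have size : M.size = 3 * M.text.length + M.alphabetSize + 100 := rfl
  set L := h.v .np with hL
  set K := h.v .K with hK
  set top := h.v .top with htop
  -- one of the sorts, from a view that the earlier ones lead to
  have sort : ∀ (src dst : Var) (d : Expr) (k : ℕ) (h' : View),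
      (src = .tp ∧ dst = .b1 ∨ src = .b1 ∧ dst = .tp) → d.depth = 1 → k ≤ 2 →
      (∀ h'', d.eval M h'' = k ∧ d.Ok M h'') → Frame [.a, .c, .x] (fun k => k < 3 * top) h h' →
      (∀ v, (∃ a < L, h'.mem (3 * h.v src + a) = v) ↔ v < L) →
      (csort src dst .np (letter (samplePosE Var.x + d))).RunIn M h' X fun h'' =>
        Frame [.a, .c, .x] (fun k => k < 3 * top) h h'' ∧
        (∀ v, (∃ a < L, h''.mem (3 * h.v dst + a) = v) ↔ v < L) ∧
        StableSort (fun x => s (samplePos (h.v .q) x + k)) (fun a => h'.mem (3 * h.v src + a))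
          (fun a => h''.mem (3 * h.v dst + a)) L := by
    intro src dst d k h' hsd hdd hk hd hf hval
    have hl' := hl.frame hf (fun _ h => h) hns
    have e1 : h'.v .np = L := hf.1 _ (by simp)
    have e2 : h'.v .K = K := hf.1 _ (by simp)
    have e3 : h'.v src = h.v src := hf.1 _ (by rcases hsd with ⟨rfl, -⟩ | ⟨rfl, -⟩ <;> simp)
    have e4 : h'.v dst = h.v dst := hf.1 _ (by rcases hsd with ⟨-, rfl⟩ | ⟨-, rfl⟩ <;> simp)
    have e5 : h'.v .q = h.v .q := hf.1 _ (by simp)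
    have hs3 : K + 2 ≤ 3 * h.v src ∧ K + 2 ≤ 3 * h.v dst ∧ 3 * h.v src + L ≤ 3 * top ∧
        3 * h.v dst + L ≤ 3 * top ∧
        (3 * h.v src + L ≤ 3 * h.v dst ∨ 3 * h.v dst + L ≤ 3 * h.v src) := by
      rcases hsd with ⟨rfl, rfl⟩ | ⟨rfl, rfl⟩ <;> omega
    have := csort_run hM (src := src) (dst := dst) (len := .np)
      (key := letter (samplePosE Var.x + d)) (h := h')
      (κ := fun x => s (samplePos (h.v .q) x + k)) (A := fun a => h'.mem (3 * h.v src + a)) (X := X)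
      (by rcases hsd with ⟨rfl, -⟩ | ⟨rfl, -⟩ <;> simp)
      (by rcases hsd with ⟨-, rfl⟩ | ⟨-, rfl⟩ <;> simp) (by simp)
      (by simp [letter, samplePosE, hdd])
      (by rw [e1, e2]; exact hX) (fun a _ => by rw [e3]) (by omega) (by omega) (by omega)
      (by omega) (by omega) (by omega) (by omega) (by omega) (fun a _ => by rw [e2]; exact h2 _)
      (fun h'' hf'' hx => by
        have hf3 := hf''.mono (vs' := [.a, .c, .x]) (R' := fun k => k < 3 * top)
          (fun _ h => h) (fun k hk => by omega)
        have hl'' := hl'.frame hf3 (fun k hk => by rw [hf.1 _ (by simp)]; exact hk) hns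
        obtain ⟨a, ha, hx⟩ := hx
        have hxlt : h''.v .x < h''.v .np := by
          rw [hf3.1 .np (by simp), e1, hx]
          exact (hval _).1 ⟨a, by omega, rfl⟩
        have := hl''.letter_samplePos hM hxlt (hd h'').1 (hd h'').2 hk
        rwa [hf3.1 .q (by simp), e5] at this)
    refine this.mono le_rfl fun h'' ⟨hf'', hst⟩ => ?_
    rw [e1, e4] at hst
    refine ⟨hf.trans (hf''.mono (fun _ h => h) fun k hk => by omega), fun v => ?_, hst⟩
    exact (hst.2 v).trans (hval v)
  refine Stmt.RunIn.seq (R := fun h' => Frame [.a, .c, .x] (fun k => k < 3 * top) h h' ∧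
    ∀ a < L, h'.mem (3 * h.v .tp + a) = a) ?_ fun h1 ⟨f1, m1⟩ => ?_
  · refine Stmt.RunIn.count hM (fun k h' => Frame [.a, .c, .x] (fun k => k < 3 * top) h h' ∧
      h'.v .a = k ∧ ∀ a < k, h'.mem (3 * h.v .tp + a) = a) L (by omega) (by simp) (by simp)
      (by simp) (by simp [Stmt.Simple]) (by simp) ?_ ?_ ?_ ?_
    · rintro k hk h' ⟨hf, ha, -⟩
      simp [ha, hf.1 .np (by simp), hL]
    · rintro k hk h' ⟨hf, ha, hm⟩
      simp only [Stmt.wp, ok_ofNat, ok_var, eval_ofNat, eval_var, ha, ok_add, eval_add,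
        View.put_v, View.set_v, View.set_mem, View.put_mem, hf.1 .tp (by simp), if_true]
      refine ⟨trivial, trivial, trivial, by omega, ⟨trivial, by omega, by omega⟩,
        (hf.put (by omega) _).set (by simp) _, trivial, fun a ha' => ?_⟩
      split_ifs with h1
      · omega
      · exact hm a (by omega)
    · exact ⟨(Frame.refl _ _ _).set (by simp) _, by simp, by simp⟩
    · rintro h' ⟨hf, -, hm⟩
      exact ⟨hf, hm⟩
  refine (sort .tp .b1 2 2 h1 (by simp) (by simp) (by simp) (by simp) f1 fun v => ?_).seq
    fun h2' ⟨f2, v2, s2⟩ => (sort .b1 .tp 1 1 h2' (by simp) (by simp) (by simp) (by simp) f2 v2).seq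
    fun h3 ⟨f3, v3, s3⟩ => (sort .tp .b1 0 0 h3 (by simp) (by simp) (by simp) (by simp) f3 v3).mono
    le_rfl fun h4 ⟨f4, v4, s4⟩ => ⟨f4, fun a ha => (v4 _).1 ⟨a, ha, rfl⟩, ?_⟩
  · exact ⟨fun ⟨a, ha, hv⟩ => by rw [m1 a ha] at hv; omega, fun hv => ⟨v, hv, m1 v hv⟩⟩
  have p1 : SortedBy (fun x y => x ≠ y) (fun a => h1.mem (3 * h.v .tp + a)) L := by
    intro a b hab hb
    simp only [m1 a (by omega), m1 b hb]
    omega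
  have p4 := s4.1 _ (s3.1 _ (s2.1 _ p1))
  intro a b hab hb
  have := p4 a b hab hb
  simp only [Nat.add_zero] at this
  simp only [TriLt, TriEq]
  tauto

/-- `1` if the triples at `i` and `j` differ, and otherwise `0`. -/
def triDiff (i j : Var) : Expr :=
  .ite .eq (letter i) (letter j) (.ite .eq (letter (i + 1)) (letter (j + 1))
    (.ite .eq (letter (i + 2)) (letter (j + 2)) 0 1) 1) 1

theorem Level.triDiff_eval {s : ℕ → ℕ} {h : View} (hM : M.Fits) (hl : Level M s h) {i j : Var}
    (hi : h.v i ≤ h.v .m) (hj : h.v j ≤ h.v .m) :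
    (triDiff i j).Ok M h ∧
      (TriEq s (h.v i) (h.v j) ∧ (triDiff i j).eval M h = 0 ∨
        ¬ TriEq s (h.v i) (h.v j) ∧ (triDiff i j).eval M h = 1) := by
  classical
  have hw := hM.bits
  have h3 := hl.K_le
  have h4 := hl.m_le
  have L : ∀ v : Var, h.v v ≤ h.v .m → ((letter v).Ok M h ∧ (letter v).eval M h = s (h.v v)) ∧
      ((letter (v + 1)).Ok M h ∧ (letter (v + 1)).eval M h = s (h.v v + 1)) ∧
      ((letter (v + 2)).Ok M h ∧ (letter (v + 2)).eval M h = s (h.v v + 2)) := fun v hv =>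
    ⟨hl.letter_eval (e := v) (by simp) (by simp; omega),
      hl.letter_eval (e := v + 1) (by simp; omega) (by simp; omega),
      hl.letter_eval (e := v + 2) (by simp; omega) (by simp; omega)⟩
  obtain ⟨⟨o1, v1⟩, ⟨o2, v2⟩, ⟨o3, v3⟩⟩ := L i hi
  obtain ⟨⟨o4, v4⟩, ⟨o5, v5⟩, ⟨o6, v6⟩⟩ := L j hj
  simp only [triDiff, ok_ite, eval_ite, holds_eq, ok_ofNat, eval_ofNat, o1, o2, o3, o4, o5,
    o6, v1, v2, v3, v4, v5, v6, TriEq]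
  refine ⟨by simp, ?_⟩
  split_ifs <;> simp_all

/-- Writes to row `tp` the names of the triples of the sample positions, which row `b1` lists in
sorted order. -/
def nameTriples : Stmt :=
  .seq (.set .c 0) <|
  .seq (.set .a 0) (.loop .lt Var.a Var.np
    (.seq (.set .x (.get Var.b1 Var.a)) <| .seq (.set .i (samplePosE Var.x)) <|
      .seq (.set .c (Var.c + .ite .eq Var.a 0 1 (triDiff .i .j))) <|
      .seq (.put Var.tp Var.x Var.c) <| .seq (.set .j Var.i) (.set .a (Var.a + 1))))

/-- The name of a triple is the number of different triples up to it in the sorted list, so names are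
positive and at most `np`. -/
theorem nameTriples_run (hM : M.Fits) {s : ℕ → ℕ} {h : View} (hl : Level M s h) {X : ℕ}
    (hX : h.v .np + 1 ≤ X) (hlt : ∀ a < h.v .np, h.mem (3 * h.v .b1 + a) < h.v .np)
    (hsort : SortedBy (fun x y => TriLt s (samplePos (h.v .q) x) (samplePos (h.v .q) y) ∨
        TriEq s (samplePos (h.v .q) x) (samplePos (h.v .q) y) ∧ x ≠ y)
        (fun a => h.mem (3 * h.v .b1 + a)) (h.v .np)) :
    nameTriples.RunIn M h X fun h' =>
      Frame [.a, .c, .x, .i, .j] (fun k => k < 3 * h.v .top) h h' ∧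
      Reduces s (h.v .m)
        (fun r => if r < h.v .np then h'.mem (3 * h.v .tp + r) else 0) := by
  have hw := hM.bits
  obtain ⟨-, -, -, -, h5, h6, h7, h8, h9, h10, h11, h12, h13⟩ := id hl
  have hns : ∀ v ∈ [Var.lev, .m, .top, .K, .q, .np, .tp, .b1], v ∉ [Var.a, .c, .x, .i, .j] := by
    decide
  have size : M.size = 3 * M.text.length + M.alphabetSize + 100 := rfl
  set L := h.v .np with hL
  set tp := h.v .tp with htp
  set q := h.v .q with hq
  set B : ℕ → ℕ := fun a => h.mem (3 * h.v .b1 + a) with hB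
  have hBlt' : ∀ a < L, B a < L := hlt
  have hBinj : ∀ a < L, ∀ b < a, B b ≠ B a := fun a ha b hb heq => by
    have := hsort b a hb ha
    rw [heq] at this
    simp only [TriLt, TriEq] at this
    omega
  -- the region that changes is the one for the names
  set R : ℕ → Prop := fun k => 3 * tp ≤ k ∧ k < 3 * tp + L with hR
  have hR' : ∀ k, R k → k < 3 * h.v .top := fun k hk => by simp only [hR] at hk; omega
  refine Stmt.RunIn.seq (R := fun h' => Frame [.a, .c, .x, .i, .j] R h h' ∧ h'.v .c = 0)
    (.of_wp hM (by simp [Stmt.Simple]) (by omega) ?_) fun h1 ⟨f1, c1⟩ => ?_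
  · simp only [Stmt.wp, ok_ofNat, eval_ofNat]
    exact ⟨by omega, (Frame.refl _ _ _).set (by simp) _, by simp⟩
  refine Stmt.RunIn.count hM (fun k h' => Frame [.a, .c, .x, .i, .j] R h h' ∧ h'.v .a = k ∧
      h'.v .c ≤ k ∧ (0 < k → h'.v .j = samplePos q (B (k - 1)) ∧
        h'.v .c = h'.mem (3 * tp + B (k - 1))) ∧
      (∀ a < k, 1 ≤ h'.mem (3 * tp + B a) ∧ h'.mem (3 * tp + B a) ≤ k) ∧
      ∀ a b, a < b → b < k →
        TriEq s (samplePos q (B a)) (samplePos q (B b)) ∧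
          h'.mem (3 * tp + B a) = h'.mem (3 * tp + B b) ∨
        TriLt s (samplePos q (B a)) (samplePos q (B b)) ∧
          h'.mem (3 * tp + B a) < h'.mem (3 * tp + B b))
    L (by omega) (by simp) (by simp) (by simp)
    (by simp [Stmt.Simple, triDiff, letter, samplePosE]) (by simp) ?_ ?_ ?_ ?_
  · rintro k hk h' ⟨hf, ha, -⟩
    simp [ha, hf.1 .np (by simp), hL]
  · rintro k hk h' ⟨hf, ha, hck, hj, hm, hs⟩
    have hl' := hl.frame hf hR' hns
    have e1 : h'.v .b1 = h.v .b1 := hf.1 _ (by simp)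
    have e2 : h'.v .tp = tp := hf.1 _ (by simp)
    have e3 : h'.v .m = h.v .m := hf.1 _ (by simp)
    have e4 : h'.v .q = q := hf.1 _ (by simp)
    have hBk : h'.mem (3 * h.v .b1 + k) = B k := hf.2 _ (by simp only [hR]; omega)
    have hBlt : B k < L := hlt k hk
    have hpos : samplePos q (B k) ≤ h.v .m := by rw [h5]; exact samplePos_le (by omega)
    obtain ⟨o1, v1⟩ := samplePosE_spec (M := M) (h := h'.set .x (B k)) (e := .var .x) trivial
      (by simp [e4]; omega)
    simp only [eval_var, View.set_v, e4, reduceCtorEq, if_false, if_true] at v1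
    -- the name of this triple
    obtain ⟨δ, oδ, vδ, hδ⟩ : ∃ δ, (Expr.ite .eq Var.a 0 1 (triDiff .i .j)).Ok M
          ((h'.set .x (B k)).set .i (samplePos q (B k))) ∧
        (Expr.ite .eq Var.a 0 1 (triDiff .i .j)).eval M
          ((h'.set .x (B k)).set .i (samplePos q (B k))) = δ ∧
        (k = 0 ∧ δ = 1 ∨ 0 < k ∧
          (TriEq s (samplePos q (B (k - 1))) (samplePos q (B k)) ∧ δ = 0 ∨
           TriLt s (samplePos q (B (k - 1))) (samplePos q (B k)) ∧ δ = 1)) := by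
      classical
      refine ⟨_, ?_, rfl, ?_⟩
      all_goals simp only [ok_ite, eval_ite, ok_var, ok_ofNat, eval_var, eval_ofNat, View.set_v,
        reduceCtorEq, if_false, ha, holds_eq]
      all_goals rcases Nat.eq_zero_or_pos k with rfl | hk0
      · simp
      · have := ((hl'.frame (vs := [.a, .c, .x, .i, .j]) (R := fun _ => False)
          (((Frame.refl _ _ h').set (x := .x) (by simp) (B k)).set (x := .i) (by simp)
          (samplePos q (B k))) (by simp) hns).triDiff_eval hM (i := .i) (j := .j)
          (by simp [e3, hpos]) (by
            simp only [View.set_v, reduceCtorEq, if_false, e3, (hj hk0).1]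
            rw [h5]; exact samplePos_le (by have := hBlt' (k - 1) (by omega); omega))).1
        simp [this]
      · simp
      · have := ((hl'.frame (vs := [.a, .c, .x, .i, .j]) (R := fun _ => False)
          (((Frame.refl _ _ h').set (x := .x) (by simp) (B k)).set (x := .i) (by simp)
          (samplePos q (B k))) (by simp) hns).triDiff_eval hM (i := .i) (j := .j)
          (by simp [e3, hpos]) (by
            simp only [View.set_v, reduceCtorEq, if_false, e3, (hj hk0).1]
            rw [h5]; exact samplePos_le (by have := hBlt' (k - 1) (by omega); omega))).2
        simp only [View.set_v, reduceCtorEq, if_false, if_true, (hj hk0).1] at this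
        have hcmp := hsort (k - 1) k (by omega) hk
        refine Or.inr ⟨hk0, ?_⟩
        rw [if_neg (by omega)]
        rcases this with ⟨he, hv⟩ | ⟨he, hv⟩
        · exact Or.inl ⟨⟨he.1.symm, he.2.1.symm, he.2.2.symm⟩, hv⟩
        · refine Or.inr ⟨hcmp.resolve_right fun h => he ?_, hv⟩
          exact ⟨h.1.1.symm, h.1.2.1.symm, h.1.2.2.symm⟩
    have hc1 : 1 ≤ h'.v .c + δ := by
      rcases hδ with ⟨-, h⟩ | ⟨h0, h⟩
      · omega
      · have := (hm (k - 1) (by omega)).1; rw [(hj h0).2]; omega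
    have hcu : h'.v .c + δ ≤ k + 1 := by
      rcases hδ with ⟨-, h⟩ | ⟨h0, h⟩ <;> omega
    simp only [Stmt.wp, ok_ofNat, ok_var, eval_ofNat, eval_var, ha, ok_add, eval_add, ok_get,
      eval_get, View.put_v, View.set_v, View.set_mem, View.put_mem, e1, hBk, v1, o1, oδ, vδ, e2,
      if_true, if_false, reduceCtorEq]
    refine ⟨⟨trivial, trivial, by omega⟩, trivial, ⟨trivial, trivial, by omega⟩, trivial, trivial,
      trivial, by omega, trivial, ⟨trivial, by omega, by omega⟩, ?_, trivial, hcu, fun _ => ?_,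
      fun a ha' => ?_, fun a b hab hb => ?_⟩
    · refine Frame.set (Frame.set (Frame.put (Frame.set (Frame.set (hf.set (by simp) _) (by simp) _)
        (by simp) _) ?_ _) (by simp) _) (by simp) _
      simp only [hR]; omega
    · simp
    · by_cases hak : a = k
      · simp [hak, hc1, hcu]
      · have hne := hBinj k hk a (by omega)
        rw [if_neg (by omega)]
        have := hm a (by omega)
        omega
    · have hne := hBinj k hk a (by omega)
      rw [if_neg (by omega : ¬ (3 * tp + B a = 3 * tp + B k))]
      by_cases hbk : b = k
      · subst hbk
        rw [if_pos rfl]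
        rcases hδ with ⟨h0, -⟩ | ⟨h0, h⟩
        · omega
        · rw [(hj h0).2]
          by_cases hab1 : a = b - 1
          · subst hab1
            rcases h with ⟨h, rfl⟩ | ⟨h, rfl⟩
            · exact Or.inl ⟨h, by omega⟩
            · exact Or.inr ⟨h, by omega⟩
          · have := hs a (b - 1) (by omega) (by omega)
            simp only [TriEq, TriLt] at *
            omega
      · have hne' := hBinj k hk b (by omega)
        rw [if_neg (by omega : ¬ (3 * tp + B b = 3 * tp + B k))]
        exact hs a b hab (by omega)
  · refine ⟨f1.set (by simp) _, by simp, by simp [c1], by simp, by simp, by simp⟩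
  · rintro h' ⟨hf, -, -, -, hm, hs⟩
    have hnp : (h.v .m + 2) / 3 + h.v .m / 3 = L := by omega
    have hsurj : ∀ r < L, ∃ a < L, B a = r := fun r hr =>
      exists_eq_of_inj_of_lt hlt (fun a ha b hb hab => by
        by_contra hne
        rcases Nat.lt_or_gt_of_ne hne with h' | h'
        · exact hBinj b hb a h' hab
        · exact hBinj a ha b h' hab.symm) hr
    have symm : ∀ p p', TriEq s p p' → TriEq s p' p := fun p p' h =>
      ⟨h.1.symm, h.2.1.symm, h.2.2.symm⟩
    refine ⟨hf.mono (fun _ h => h) hR', ⟨⟨?_, ?_⟩, ?_, ?_, ?_⟩⟩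
    · intro r hr
      rw [hnp] at hr
      obtain ⟨a, ha, rfl⟩ := hsurj r hr
      simp only [hr, if_true]
      exact (hm a ha).1
    · intro r hr
      rw [hnp] at hr
      simp [show ¬ r < L by omega]
    · intro r hr
      rw [hnp] at hr ⊢
      obtain ⟨a, ha, rfl⟩ := hsurj r hr
      simp only [hr, if_true]
      exact (hm a ha).2
    · intro x hx y hy
      rw [hnp] at hx hy
      obtain ⟨a, ha, rfl⟩ := hsurj x hx
      obtain ⟨b, hb, rfl⟩ := hsurj y hy
      simp only [hx, hy, if_true, ← h5]
      intro hlt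
      rcases lt_trichotomy a b with hab | rfl | hab
      · rcases hs a b hab hb with h | h
        · omega
        · exact h.1
      · omega
      · rcases hs b a hab ha with h | h <;> omega
    · intro x hx y hy
      rw [hnp] at hx hy
      obtain ⟨a, ha, rfl⟩ := hsurj x hx
      obtain ⟨b, hb, rfl⟩ := hsurj y hy
      simp only [hx, hy, if_true, ← h5]
      intro heq
      rcases lt_trichotomy a b with hab | rfl | hab
      · rcases hs a b hab hb with h | h
        · exact h.1
        · omega
      · exact ⟨rfl, rfl, rfl⟩
      · rcases hs b a hab ha with h | h
        · exact symm _ _ h.1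
        · omega

/-! ### Merging the suffixes of a level -/

/-- From the suffix array of the reduced string in row `0`: the ranks of its suffixes, in row `tp`
in place of the reduced string, and the sample positions in the order of their suffixes, in row
`b1`. -/
def rankSample : Stmt :=
  .seq (.set .a 0) (.loop .lt Var.a Var.np
    (.seq (.set .x (.get 0 Var.a)) <| .seq (.put Var.tp Var.x (Var.a + 1)) <|
      .seq (.put Var.b1 Var.a (samplePosE Var.x)) (.set .a (Var.a + 1))))

theorem rankSample_run (hM : M.Fits) {s R : ℕ → ℕ} {h : View} (hl : Level M s h) {X : ℕ}
    (hX : h.v .np + 1 ≤ X) (hA : IsSA R (h.v .np) h.mem) :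
    rankSample.RunIn M h X fun h' =>
      Frame [.a, .c, .x] (fun k => k < 3 * h.v .top) h h' ∧
      (∀ a < h.v .np, h'.mem (3 * h.v .tp + h.mem a) = a + 1) ∧
      ∀ a < h.v .np, h'.mem (3 * h.v .b1 + a) = samplePos (h.v .q) (h.mem a) := by
  have hw := hM.bits
  obtain ⟨-, -, -, -, h5, h6, h7, h8, h9, h10, h11, h12, h13⟩ := id hl
  have size : M.size = 3 * M.text.length + M.alphabetSize + 100 := rfl
  set L := h.v .np with hL
  set tp := h.v .tp with htp
  set b1 := h.v .b1 with hb1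
  set q := h.v .q with hq
  have hinj : ∀ a < L, ∀ b < a, h.mem b ≠ h.mem a := fun a ha b hb => (hA.2 b a hb ha).ne
  set F : ℕ → Prop := fun k => 3 * b1 ≤ k ∧ k < 3 * b1 + L ∨ 3 * tp ≤ k ∧ k < 3 * tp + L with hF
  refine Stmt.RunIn.count hM (fun k h' => Frame [.a, .c, .x] F h h' ∧ h'.v .a = k ∧
      (∀ a < k, h'.mem (3 * tp + h.mem a) = a + 1) ∧
      ∀ a < k, h'.mem (3 * b1 + a) = samplePos q (h.mem a))
    L hX (by simp) (by simp) (by simp) (by simp [Stmt.Simple, samplePosE]) (by simp) ?_ ?_ ?_ ?_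
  · rintro k hk h' ⟨hf, ha, -⟩
    simp [ha, hf.1 .np (by simp), hL]
  · rintro k hk h' ⟨hf, ha, hr, hp⟩
    have e1 : h'.v .b1 = b1 := hf.1 _ (by simp)
    have e2 : h'.v .tp = tp := hf.1 _ (by simp)
    have e4 : h'.v .q = q := hf.1 _ (by simp)
    have hAk : h'.mem (3 * 0 + k) = h.mem k := by
      rw [Nat.mul_zero, Nat.zero_add]; exact hf.2 _ (by simp only [hF]; omega)
    have hAlt := hA.1 k hk
    have hpos : samplePos q (h.mem k) ≤ h.v .m := by rw [h5]; exact samplePos_le (by omega)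
    obtain ⟨o1, v1⟩ := samplePosE_spec (M := M) (h := (h'.set .x (h.mem k)).put
      (3 * tp + h.mem k) (k + 1)) (e := .var .x) trivial (by simp [e4]; omega)
    simp only [eval_var, View.put_v, View.set_v, e4, reduceCtorEq, if_false, if_true] at v1
    simp only [Stmt.wp, ok_ofNat, ok_var, eval_ofNat, eval_var, ha, ok_add, eval_add, ok_get,
      eval_get, View.put_v, View.set_v, View.set_mem, View.put_mem, e1, e2, hAk, v1, o1,
      if_true, if_false, reduceCtorEq]
    refine ⟨⟨by omega, trivial, by omega⟩, trivial, trivial, ⟨trivial, by omega, by omega⟩,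
      by omega, trivial, trivial, trivial, by omega, ⟨trivial, by omega, by omega⟩, ?_, trivial,
      fun a ha' => ?_, fun a ha' => ?_⟩
    · refine Frame.set (Frame.put (Frame.put (hf.set (by simp) _) ?_ _) ?_ _) (by simp) _ <;>
        simp only [hF] <;> omega
    · have := hA.1 a (by omega)
      rw [if_neg (by omega)]
      split_ifs with h1
      · by_contra hne
        exact hinj k hk a (by omega) (by omega)
      · exact hr a (by by_contra hn; exact h1 (by rw [show a = k by omega]))
    · split_ifs with h1 h2
      · rw [show a = k by omega]
      · omega
      · exact hp a (by omega)
  · exact ⟨(Frame.refl _ _ _).set (by simp) _, by simp, by simp, by simp⟩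
  · rintro h' ⟨hf, -, hr, hp⟩
    exact ⟨hf.mono (fun _ h => h) fun k hk => by simp only [hF] at hk; omega, hr, hp⟩

/-- The multiples of `3` in the order of their suffixes, in row `b3`: a radix sort by the rank of
the next position, which belongs to the sample, and by the letter. -/
def sortThrees : Stmt :=
  .seq (.seq (.set .a 0) (.loop .lt Var.a Var.q
    (.seq (.put Var.b3 Var.a (3 * Var.a)) (.set .a (Var.a + 1))))) <|
  .seq (csort .b3 .b2 .q (.get Var.tp (Var.x / 3))) (csort .b2 .b3 .q (letter Var.x))

theorem sortThrees_run (hM : M.Fits) {s : ℕ → ℕ} {h : View} (hl : Level M s h)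
    (hb2 : h.v .b2 = h.v .b1 + (h.v .np / 3 + 1)) (hb3 : h.v .b3 = h.v .b2 + (h.v .q / 3 + 1))
    {X : ℕ} (hX : h.v .q + h.v .K + 3 ≤ X)
    (hρ : ∀ r < h.v .np, h.mem (3 * h.v .tp + r) ≤ h.v .np) :
    sortThrees.RunIn M h X fun h' =>
      Frame [.a, .c, .x] (fun k => k < h.v .K + 2 ∨ 3 * h.v .b2 ≤ k ∧ k < 3 * h.v .tp) h h' ∧
      (∀ a < h.v .q, h'.mem (3 * h.v .b3 + a) < h.v .m ∧ h'.mem (3 * h.v .b3 + a) % 3 = 0) ∧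
      SortedBy (fun x y => s x < s y ∨ s x = s y ∧
        (h.mem (3 * h.v .tp + x / 3) < h.mem (3 * h.v .tp + y / 3) ∨
         h.mem (3 * h.v .tp + x / 3) = h.mem (3 * h.v .tp + y / 3) ∧ x ≠ y))
        (fun a => h'.mem (3 * h.v .b3 + a)) (h.v .q) := by
  have hw := hM.bits
  obtain ⟨-, h2, -, -, h5, h6, h7, h8, h9, h10, h11, h12, h13⟩ := id hl
  have size : M.size = 3 * M.text.length + M.alphabetSize + 100 := rfl
  have hns : ∀ v ∈ [Var.lev, .m, .top, .K, .q, .np, .tp, .b1], v ∉ [Var.a, .c, .x] := by decide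
  set L := h.v .q with hL
  set tp := h.v .tp with htp
  set K := h.v .K with hK
  set F : ℕ → Prop := fun k => k < K + 2 ∨ 3 * h.v .b2 ≤ k ∧ k < 3 * tp with hF
  refine Stmt.RunIn.seq (R := fun h' => Frame [.a, .c, .x] F h h' ∧
    ∀ a < L, h'.mem (3 * h.v .b3 + a) = 3 * a) ?_ fun h1 ⟨f1, m1⟩ => ?_
  · refine Stmt.RunIn.count hM (fun k h' => Frame [.a, .c, .x] F h h' ∧
      h'.v .a = k ∧ ∀ a < k, h'.mem (3 * h.v .b3 + a) = 3 * a) L (by omega) (by simp) (by simp)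
      (by simp) (by simp [Stmt.Simple]) (by simp) ?_ ?_ ?_ ?_
    · rintro k hk h' ⟨hf, ha, -⟩
      simp [ha, hf.1 .q (by simp), hL]
    · rintro k hk h' ⟨hf, ha, hm⟩
      simp only [Stmt.wp, ok_ofNat, ok_var, eval_ofNat, eval_var, ha, ok_add, eval_add, ok_mul,
        eval_mul, View.put_v, View.set_v, View.set_mem, View.put_mem, hf.1 .b3 (by simp), if_true]
      refine ⟨trivial, trivial, ⟨by omega, trivial, by omega⟩, by omega,
        ⟨trivial, by omega, by omega⟩,
        (hf.put (by simp only [hF]; omega) _).set (by simp) _, trivial, fun a ha' => ?_⟩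
      split_ifs with h1
      · omega
      · exact hm a (by omega)
    · exact ⟨(Frame.refl _ _ _).set (by simp) _, by simp, by simp⟩
    · rintro h' ⟨hf, -, hm⟩
      exact ⟨hf, hm⟩
  have e : ∀ h', Frame [.a, .c, .x] F h h' → h'.v .q = L ∧ h'.v .K = K ∧ h'.v .tp = tp ∧
      h'.v .b2 = h.v .b2 ∧ h'.v .b3 = h.v .b3 ∧ h'.v .np = h.v .np ∧
      ∀ r < h.v .np, h'.mem (3 * tp + r) = h.mem (3 * tp + r) := fun h' hf =>
    ⟨hf.1 _ (by simp), hf.1 _ (by simp), hf.1 _ (by simp), hf.1 _ (by simp), hf.1 _ (by simp),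
      hf.1 _ (by simp), fun r hr => hf.2 _ (by simp only [hF]; omega)⟩
  obtain ⟨e1, e2, e3, e4, e5, e6, e7⟩ := e h1 f1
  refine Stmt.RunIn.seq (R := fun h' => Frame [.a, .c, .x] F h h' ∧
    StableSort (fun x => h.mem (3 * tp + x / 3)) (fun a => h1.mem (3 * h.v .b3 + a))
      (fun a => h'.mem (3 * h.v .b2 + a)) L) ?_ fun h2' ⟨f2, s2⟩ => ?_
  · have := csort_run hM (src := .b3) (dst := .b2) (len := .q)
      (key := .get Var.tp (Var.x / 3)) (h := h1)
      (κ := fun x => h.mem (3 * tp + x / 3)) (A := fun a => h1.mem (3 * h.v .b3 + a)) (X := X)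
      (by simp) (by simp) (by simp) (by simp) (by omega) (fun a _ => by rw [e5]) (by omega)
      (by omega) (by omega) (by omega) (by omega) (by omega) (by omega) (by omega)
      (fun a ha => ?_)
      (fun h'' hf'' hx => ?_)
    · refine this.mono le_rfl fun h'' ⟨hf'', hst⟩ => ?_
      rw [e1, e4] at hst
      exact ⟨f1.trans (hf''.mono (fun _ h => h) fun k hk => by simp only [hF]; omega), hst⟩
    · rw [e1] at ha
      rw [m1 a ha, Nat.mul_div_cancel_left _ (by omega)]
      exact (hρ a (by omega)).trans (by omega)
    · obtain ⟨a, ha, hx⟩ := hx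
      rw [e1] at ha
      rw [m1 a ha] at hx
      have hf3 := f1.trans (hf''.mono (vs' := [.a, .c, .x]) (R' := F) (fun _ h => h)
        fun k hk => by simp only [hF]; omega)
      obtain ⟨-, -, g3, -, -, -, g7⟩ := e h'' hf3
      simp only [ok_get, ok_var, ok_div, ok_ofNat, eval_get, eval_var, eval_div, eval_ofNat, g3, hx,
        true_and]
      rw [Nat.mul_div_cancel_left _ (by omega), g7 a (by omega)]
      exact ⟨⟨by omega, by omega⟩, rfl⟩
  · obtain ⟨e1, e2, e3, e4, e5, e6, e7⟩ := e h2' f2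
    have hl2 := hl.frame f2 (fun k hk => by simp only [hF] at hk; omega) hns
    have v2 : ∀ a < L, ∃ b < L, h2'.mem (3 * h.v .b2 + a) = 3 * b := fun a ha => by
      obtain ⟨b, hb, hx⟩ := (s2.2 _).1 ⟨a, ha, rfl⟩
      exact ⟨b, hb, hx.symm.trans (m1 b hb)⟩
    have := csort_run hM (src := .b2) (dst := .b3) (len := .q)
      (key := letter Var.x) (h := h2')
      (κ := s) (A := fun a => h2'.mem (3 * h.v .b2 + a)) (X := X)
      (by simp) (by simp) (by simp) (by simp [letter]) (by omega) (fun a _ => by rw [e4]) (by omega)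
      (by omega) (by omega) (by omega) (by omega) (by omega) (by omega) (by omega)
      (fun a ha => by rw [e2]; exact h2 _)
      (fun h'' hf'' hx => ?_)
    · refine this.mono le_rfl fun h'' ⟨hf'', hst⟩ => ?_
      rw [e1, e5] at hst
      refine ⟨f2.trans (hf''.mono (fun _ h => h) fun k hk => by simp only [hF]; omega),
        fun a ha => ?_, ?_⟩
      · obtain ⟨b, hb, hx⟩ := (hst.2 _).1 ⟨a, ha, rfl⟩
        obtain ⟨c, hc, hx'⟩ := v2 b hb
        have hx2 : h''.mem (3 * h.v .b3 + a) = 3 * c := hx.symm.trans hx'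
        omega
      · refine hst.1 _ (s2.1 (fun x y => x ≠ y) fun a b hab hb => ?_)
        simp only [m1 a (by omega), m1 b hb]
        omega
    · have hl'' := hl2.frame hf'' (fun k hk => by rw [f2.1 .top (by simp)]; omega) hns
      obtain ⟨a, ha, hx⟩ := hx
      obtain ⟨b, hb, hx'⟩ := v2 a (by omega)
      have hx2 : h''.v .x = 3 * b := hx.trans hx'
      have := hl''.letter_eval (e := Var.x) (by simp) (by rw [eval_var]; omega)
      simpa using this

/-- `sampleRank` as an expression. -/
def sampleRankE (e : Expr) : Expr :=
  .ite .eq (e % 3) 1 (.get Var.tp (e / 3))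
    (.ite .lt (e / 3) (Var.m / 3) (.get Var.tp (Var.q + e / 3)) 0)

theorem Level.sampleRankE_eval {s ρ : ℕ → ℕ} {h : View} (hM : M.Fits) (hl : Level M s h)
    (hρ : ∀ r < h.v .np, h.mem (3 * h.v .tp + r) = ρ r) {e : Expr} (he : e.Ok M h)
    (hle : e.eval M h ≤ h.v .m + 1) :
    (sampleRankE e).Ok M h ∧ (sampleRankE e).eval M h = sampleRank ρ (h.v .m) (e.eval M h) := by
  classical
  have hw := hM.bits
  have size : M.size = 3 * M.text.length + M.alphabetSize + 100 := rfl
  obtain ⟨-, h2, -, -, h5, h6, h7, h8, h9, h10, h11, h12, h13⟩ := id hl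
  simp only [sampleRankE, ok_ite, eval_ite, ok_var, eval_var, holds_lt, holds_eq, ok_ofNat,
    eval_ofNat, ok_add, eval_add, ok_get, eval_get, ok_div, ok_mod, eval_div, eval_mod, he,
    true_and, sampleRank]
  split_ifs with h1 h2
  · exact ⟨by simp [h1]; omega, hρ _ (by omega)⟩
  · exact ⟨by simp [h1, h2]; omega, by rw [hρ _ (by omega), h5]⟩
  · exact ⟨by simp [h1, h2], rfl⟩

/-- `1` if `MergeLt` holds for `x` and `y`, and otherwise `0`. -/
def mergeLtE : Expr :=
  .ite .lt (letter Var.x) (letter Var.y) 1 <| .ite .ne (letter Var.x) (letter Var.y) 0 <|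
  .ite .eq (Var.x % 3) 1 (.ite .lt (sampleRankE (Var.x + 1)) (sampleRankE (Var.y + 1)) 1 0) <|
  .ite .lt (letter (Var.x + 1)) (letter (Var.y + 1)) 1 <|
  .ite .ne (letter (Var.x + 1)) (letter (Var.y + 1)) 0 <|
  .ite .lt (sampleRankE (Var.x + 2)) (sampleRankE (Var.y + 2)) 1 0

theorem Level.mergeLtE_eval {s ρ : ℕ → ℕ} {h : View} (hM : M.Fits) (hl : Level M s h)
    (hρ : ∀ r < h.v .np, h.mem (3 * h.v .tp + r) = ρ r)
    (hx : h.v .x < h.v .m) (hy : h.v .y < h.v .m) :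
    mergeLtE.Ok M h ∧
      (MergeLt s ρ (h.v .m) (h.v .x) (h.v .y) ∧ mergeLtE.eval M h = 1 ∨
        ¬ MergeLt s ρ (h.v .m) (h.v .x) (h.v .y) ∧ mergeLtE.eval M h = 0) := by
  classical
  have hw := hM.bits
  have h3 := hl.K_le
  have h4 := hl.m_le
  have L : ∀ v : Var, h.v v < h.v .m → ((letter v).Ok M h ∧ (letter v).eval M h = s (h.v v)) ∧
      ((letter (v + 1)).Ok M h ∧ (letter (v + 1)).eval M h = s (h.v v + 1)) := fun v hv =>
    ⟨hl.letter_eval (e := v) (by simp) (by simp; omega),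
      hl.letter_eval (e := v + 1) (by simp; omega) (by simp; omega)⟩
  obtain ⟨⟨o1, v1⟩, o2, v2⟩ := L .x hx
  obtain ⟨⟨o3, v3⟩, o4, v4⟩ := L .y hy
  have L' : ∀ v : Var, h.v v < h.v .m →
      ((sampleRankE (v + 1)).Ok M h ∧
        (sampleRankE (v + 1)).eval M h = sampleRank ρ (h.v .m) (h.v v + 1)) ∧
      ((sampleRankE (v + 2)).Ok M h ∧
        (sampleRankE (v + 2)).eval M h = sampleRank ρ (h.v .m) (h.v v + 2)) := fun v hv =>
    ⟨hl.sampleRankE_eval hM hρ (e := v + 1) (by simp; omega) (by simp; omega),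
      hl.sampleRankE_eval hM hρ (e := v + 2) (by simp; omega) (by simp; omega)⟩
  obtain ⟨⟨o5, v5⟩, o6, v6⟩ := L' .x hx
  obtain ⟨⟨o7, v7⟩, o8, v8⟩ := L' .y hy
  simp only [mergeLtE, ok_ite, eval_ite, holds_eq, holds_lt, holds_ne, ok_ofNat, eval_ofNat, ok_mod,
    ok_var, eval_var, eval_mod, o1, o2, o3, o4, o5, o6, o7, o8, v1, v2, v3, v4, v5, v6, v7, v8,
    MergeLt]
  refine ⟨by simp, ?_⟩
  split_ifs <;> simp_all

/-- Merges the sample positions in row `b1` and the multiples of `3` in row `b3` into row `0`. If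
`m` is congruent to `1` modulo `3`, then the first sample position is `m` itself, which is
skipped. -/
def mergeSuffixes : Stmt :=
  .seq (.set .i (.ite .eq (Var.m % 3) 1 1 0)) <| .seq (.set .j 0) <|
  .seq (.set .a 0) (.loop .lt Var.a Var.m
    (.seq (.set .x (.ite .lt Var.i Var.np (.get Var.b1 Var.i) 0)) <|
      .seq (.set .y (.ite .lt Var.j Var.q (.get Var.b3 Var.j) 0)) <|
      .seq (.set .c (.ite .lt Var.j Var.q (.ite .lt Var.i Var.np mergeLtE 0) 1)) <|
      .seq (.ite .eq Var.c 1
        (.seq (.put 0 Var.a Var.x) (.set .i (Var.i + 1)))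
        (.seq (.put 0 Var.a Var.y) (.set .j (Var.j + 1)))) <|
      .set .a (Var.a + 1)))

theorem mergeSuffixes_run (hM : M.Fits) {s ρ : ℕ → ℕ} {h : View} (hl : Level M s h)
    (hb3 : 3 * h.v .b1 + h.v .np ≤ 3 * h.v .b3) (hb3' : 3 * h.v .b3 + h.v .q ≤ 3 * h.v .tp)
    {X : ℕ} (hX : h.v .m + 1 ≤ X) (hρ : ∀ r < h.v .np, h.mem (3 * h.v .tp + r) = ρ r)
    {st : ℕ} (hst : st = if h.v .m % 3 = 1 then 1 else 0)
    (hB1 : ∀ a < h.v .np, st ≤ a → h.mem (3 * h.v .b1 + a) < h.v .m ∧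
      h.mem (3 * h.v .b1 + a) % 3 ≠ 0)
    (hS1 : SortedBy (SufLt s) (fun a => h.mem (3 * h.v .b1 + a)) (h.v .np))
    (hB3 : ∀ a < h.v .q, h.mem (3 * h.v .b3 + a) < h.v .m ∧ h.mem (3 * h.v .b3 + a) % 3 = 0)
    (hS3 : SortedBy (SufLt s) (fun a => h.mem (3 * h.v .b3 + a)) (h.v .q))
    (hlt : ∀ x y, x < h.v .m → y < h.v .m → x % 3 ≠ 0 → y % 3 = 0 →
      (MergeLt s ρ (h.v .m) x y → SufLt s x y) ∧ (¬ MergeLt s ρ (h.v .m) x y → SufLt s y x)) :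
    mergeSuffixes.RunIn M h X fun h' =>
      Frame [.a, .c, .x, .y, .i, .j] (fun k => k < h.v .m) h h' ∧ IsSA s (h.v .m) h'.mem := by
  classical
  have hw := hM.bits
  have size : M.size = 3 * M.text.length + M.alphabetSize + 100 := rfl
  obtain ⟨-, -, -, -, h5, h6, h7, h8, h9, h10, h11, h12, h13⟩ := id hl
  have hns : ∀ v ∈ [Var.lev, .m, .top, .K, .q, .np, .tp, .b1], v ∉ [Var.a, .c, .x, .y, .i, .j] := by
    decide
  set m := h.v .m with hm
  set np := h.v .np with hnp
  set q := h.v .q with hq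
  set B1 : ℕ → ℕ := fun a => h.mem (3 * h.v .b1 + a) with hB1def
  set B3 : ℕ → ℕ := fun a => h.mem (3 * h.v .b3 + a) with hB3def
  have hB1' : ∀ a < np, st ≤ a → B1 a < m ∧ B1 a % 3 ≠ 0 := hB1
  have hB3' : ∀ a < q, B3 a < m ∧ B3 a % 3 = 0 := hB3
  have hst1 : st ≤ 1 := by rw [hst]; split_ifs <;> omega
  -- the number of items that are merged is `m`
  have htotal : np + q = m + st := by rw [hst]; split_ifs <;> omega
  set F : ℕ → Prop := fun k => k < m with hF
  set vs : List Var := [.a, .c, .x, .y, .i, .j] with hvs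
  refine Stmt.RunIn.seq (R := fun h' => Frame vs F h h' ∧ h'.v .i = st)
    (.of_wp hM (by simp [Stmt.Simple]) (by omega) ?_) fun h1 ⟨f1, i1⟩ =>
    Stmt.RunIn.seq (R := fun h' => Frame vs F h h' ∧ h'.v .i = st ∧ h'.v .j = 0)
    (.of_wp hM (by simp [Stmt.Simple]) (by omega) ?_) fun h2 ⟨f2, i2, j2⟩ => ?_
  · simp only [Stmt.wp, ok_ite, eval_ite, ok_mod, eval_mod, ok_var, eval_var, ok_ofNat, eval_ofNat,
      holds_eq]
    exact ⟨by simp, (Frame.refl _ _ _).set (by simp [hvs]) _, by simp [hst, hm]⟩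
  · simp only [Stmt.wp, ok_ofNat, eval_ofNat]
    exact ⟨by omega, f1.set (by simp [hvs]) _, by simp [i1], by simp⟩
  set I : ℕ → View → Prop := fun k h' => Frame vs F h h' ∧ h'.v .a = k ∧
      st ≤ h'.v .i ∧ h'.v .i ≤ np ∧ h'.v .j ≤ q ∧ h'.v .i + h'.v .j = k + st ∧
      (∀ a < k, h'.mem a < m) ∧ SortedBy (SufLt s) h'.mem k ∧
      (∀ a < k, ∀ b < np, h'.v .i ≤ b → SufLt s (h'.mem a) (B1 b)) ∧
      (∀ a < k, ∀ b < q, h'.v .j ≤ b → SufLt s (h'.mem a) (B3 b)) with hI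
  refine Stmt.RunIn.count hM I
    m hX (by simp) (by simp) (by simp)
    (by simp [Stmt.Simple, mergeLtE, letter, sampleRankE]) (by simp) ?_ ?_ ?_ ?_
  · rintro k hk h' ⟨hf, ha, -⟩
    simp [ha, hf.1 .m (by simp [hvs]), hm]
  · rintro k hk h' ⟨hf, ha, hi1, hi2, hj, hij, hlm, hso, hg1, hg3⟩
    have hl' := hl.frame hf (fun k hk => by simp only [hF] at hk; omega) hns
    have e1 : h'.v .b1 = h.v .b1 := hf.1 _ (by simp [hvs])
    have e2 : h'.v .b3 = h.v .b3 := hf.1 _ (by simp [hvs])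
    have e3 : h'.v .m = m := hf.1 _ (by simp [hvs])
    have e4 : h'.v .np = np := hf.1 _ (by simp [hvs])
    have e5 : h'.v .q = q := hf.1 _ (by simp [hvs])
    have e6 : h'.v .tp = h.v .tp := hf.1 _ (by simp [hvs])
    have hx : ∀ b < np, h'.mem (3 * h.v .b1 + b) = B1 b := fun b hb =>
      hf.2 _ (by simp only [hF]; omega)
    have hy : ∀ b < q, h'.mem (3 * h.v .b3 + b) = B3 b := fun b hb =>
      hf.2 _ (by simp only [hF]; omega)
    -- taking the next item of either list is fine if it is below the next one of the other list
    have take1 : h'.v .i < np → (h'.v .j < q → SufLt s (B1 (h'.v .i)) (B3 (h'.v .j))) →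
        ∀ h'' : View, Frame vs F h' h'' → h''.v .i = h'.v .i + 1 → h''.v .j = h'.v .j →
          h''.v .a = k + 1 → h''.mem k = B1 (h'.v .i) → (∀ a < k, h''.mem a = h'.mem a) →
          I (k + 1) h'' := by
      intro hi hcmp h'' hf'' vi vj va mk ma
      refine ⟨hf.trans hf'', va, by omega, by omega, by omega, by omega, fun a ha' => ?_,
        fun a b hab hb => ?_, fun a ha' b hb hib => ?_, fun a ha' b hb hjb => ?_⟩
      · rcases Nat.lt_or_ge a k with h1 | h1
        · rw [ma a h1]; exact hlm a h1
        · rw [show a = k by omega, mk]; exact (hB1' _ hi hi1).1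
      · rw [ma a (by omega)]
        rcases Nat.lt_or_ge b k with h1 | h1
        · rw [ma b h1]; exact hso a b hab h1
        · rw [show b = k by omega, mk]; exact hg1 a (by omega) _ hi le_rfl
      · rcases Nat.lt_or_ge a k with h1 | h1
        · rw [ma a h1]; exact hg1 a h1 b hb (by omega)
        · rw [show a = k by omega, mk]; exact hS1 _ b (by omega) hb
      · rcases Nat.lt_or_ge a k with h1 | h1
        · rw [ma a h1]; exact hg3 a h1 b hb (by omega)
        · rw [show a = k by omega, mk]
          have h2 := hcmp (by omega)
          rcases Nat.lt_or_ge (h'.v .j) b with h3 | h3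
          · exact h2.trans (hS3 _ b h3 hb)
          · rwa [show b = h'.v .j by omega]
    have take3 : h'.v .j < q → (h'.v .i < np → SufLt s (B3 (h'.v .j)) (B1 (h'.v .i))) →
        ∀ h'' : View, Frame vs F h' h'' → h''.v .i = h'.v .i → h''.v .j = h'.v .j + 1 →
          h''.v .a = k + 1 → h''.mem k = B3 (h'.v .j) → (∀ a < k, h''.mem a = h'.mem a) →
          I (k + 1) h'' := by
      intro hj hcmp h'' hf'' vi vj va mk ma
      refine ⟨hf.trans hf'', va, by omega, by omega, by omega, by omega, fun a ha' => ?_,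
        fun a b hab hb => ?_, fun a ha' b hb hib => ?_, fun a ha' b hb hjb => ?_⟩
      · rcases Nat.lt_or_ge a k with h1 | h1
        · rw [ma a h1]; exact hlm a h1
        · rw [show a = k by omega, mk]; exact (hB3' _ hj).1
      · rw [ma a (by omega)]
        rcases Nat.lt_or_ge b k with h1 | h1
        · rw [ma b h1]; exact hso a b hab h1
        · rw [show b = k by omega, mk]; exact hg3 a (by omega) _ hj le_rfl
      · rcases Nat.lt_or_ge a k with h1 | h1
        · rw [ma a h1]; exact hg1 a h1 b hb (by omega)
        · rw [show a = k by omega, mk]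
          have h2 := hcmp (by omega)
          rcases Nat.lt_or_ge (h'.v .i) b with h3 | h3
          · exact h2.trans (hS1 _ b h3 hb)
          · rwa [show b = h'.v .i by omega]
      · rcases Nat.lt_or_ge a k with h1 | h1
        · rw [ma a h1]; exact hg3 a h1 b hb (by omega)
        · rw [show a = k by omega, mk]; exact hS3 _ b (by omega) hb
    set X1 := if h'.v .i < np then B1 (h'.v .i) else 0 with hX1
    set Y1 := if h'.v .j < q then B3 (h'.v .j) else 0 with hY1
    -- the outcome of the comparison
    obtain ⟨δ, oδ, vδ, hδ⟩ : ∃ δ,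
        (Expr.ite .lt Var.j Var.q (.ite .lt Var.i Var.np mergeLtE 0) 1).Ok M
          ((h'.set .x X1).set .y Y1) ∧
        (Expr.ite .lt Var.j Var.q (.ite .lt Var.i Var.np mergeLtE 0) 1).eval M
          ((h'.set .x X1).set .y Y1) = δ ∧
        (δ = 1 ∧ h'.v .i < np ∧ (h'.v .j < q → SufLt s (B1 (h'.v .i)) (B3 (h'.v .j))) ∨
         δ = 0 ∧ h'.v .j < q ∧ (h'.v .i < np → SufLt s (B3 (h'.v .j)) (B1 (h'.v .i)))) := by
      by_cases hj' : h'.v .j < q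
      swap
      · refine ⟨1, ?_, ?_, Or.inl ⟨rfl, by omega, fun h => absurd h hj'⟩⟩ <;>
          simp [ok_ite, eval_ite, e5, hj']
      by_cases hi' : h'.v .i < np
      swap
      · refine ⟨0, ?_, ?_, Or.inr ⟨rfl, hj', fun h => absurd h hi'⟩⟩ <;>
          simp [ok_ite, eval_ite, e4, e5, hi', hj']
      have h1 := hB1' _ hi' hi1
      have h3 := hB3' _ hj'
      rw [if_pos hi'] at hX1
      rw [if_pos hj'] at hY1
      have hl2 := hl'.frame (vs := vs) (R := fun _ => False) (((Frame.refl _ _ h').set (x := .x)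
        (by simp [hvs]) X1).set (x := .y) (by simp [hvs]) Y1) (by simp) hns
      have := hl2.mergeLtE_eval hM (ρ := ρ) (fun r hr => by
          simp only [View.set_v, reduceCtorEq, if_false, View.set_mem, e6, e4] at hr ⊢
          rw [hf.2 _ (by simp only [hF]; omega)]; exact hρ r hr)
        (by simp [e3]; omega) (by simp [e3]; omega)
      simp only [View.set_v, reduceCtorEq, if_false, if_true, e3] at this
      refine ⟨mergeLtE.eval M ((h'.set .x X1).set .y Y1), ?_, ?_, ?_⟩
      · simp [ok_ite, e4, e5, hi', hj', this.1]
      · simp [eval_ite, e4, e5, hi', hj']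
      · have hc := hlt (B1 (h'.v .i)) (B3 (h'.v .j)) h1.1 h3.1 h1.2 h3.2
        rw [← hX1, ← hY1] at hc
        rcases this.2 with ⟨g1, g2⟩ | ⟨g1, g2⟩
        · exact Or.inl ⟨g2, hi', fun _ => by rw [← hX1, ← hY1]; exact hc.1 g1⟩
        · exact Or.inr ⟨g2, hj', fun _ => by rw [← hX1, ← hY1]; exact hc.2 g1⟩
    have vx : (Expr.ite .lt Var.i Var.np (.get Var.b1 Var.i) 0).Ok M h' ∧
        (Expr.ite .lt Var.i Var.np (.get Var.b1 Var.i) 0).eval M h' = X1 := by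
      simp only [ok_ite, eval_ite, ok_var, ok_ofNat, eval_var, eval_ofNat, holds_lt, ok_get,
        eval_get, e1, e4, hX1, true_and]
      refine ⟨⟨by omega, by omega⟩, ?_⟩
      split_ifs with h1
      · exact hx _ h1
      · rfl
    have vy : (Expr.ite .lt Var.j Var.q (.get Var.b3 Var.j) 0).Ok M (h'.set .x X1) ∧
        (Expr.ite .lt Var.j Var.q (.get Var.b3 Var.j) 0).eval M (h'.set .x X1) = Y1 := by
      simp only [ok_ite, eval_ite, ok_var, ok_ofNat, eval_var, eval_ofNat, holds_lt, ok_get,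
        eval_get, e2, e5, hY1, true_and, View.set_v, View.set_mem, reduceCtorEq, if_false]
      refine ⟨⟨by omega, by omega⟩, ?_⟩
      split_ifs with h1
      · exact hy _ h1
      · rfl
    simp only [Stmt.wp, vx, vy, oδ, vδ, true_and, ok_ofNat, ok_var, eval_ofNat, eval_var, ha,
      ok_add, eval_add, View.put_v, View.set_v,
      if_true, if_false, reduceCtorEq, holds_eq, Nat.mul_zero, Nat.zero_add]
    have fr : ∀ (u : ℕ), Frame vs F h' ((((h'.set .x X1).set .y Y1).set .c δ).put k u) := fun u =>
      ((((Frame.refl _ _ _).set (x := .x) (by simp [hvs]) _).set (x := .y) (by simp [hvs]) _).set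
        (x := .c) (by simp [hvs]) _).put
        (by simp only [hF]; omega) _
    refine ⟨by omega, fun h1 => ?_, fun h1 => ?_⟩
    · obtain ⟨-, hi, hc⟩ := hδ.resolve_right fun h => by omega
      refine ⟨by omega, by omega, ⟨by omega, by omega⟩, ⟨by omega, by omega⟩,
        take1 hi hc _ (((fr X1).set (x := .i) (by simp [hvs]) _).set (x := .a) (by simp [hvs]) _)
          (by simp) (by simp)
        (by simp) (by simp [hX1, hi]) fun a ha' => ?_⟩
      simp [show a ≠ k by omega]
    · obtain ⟨-, hj', hc⟩ := hδ.resolve_left fun h => h1 h.1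
      refine ⟨by omega, by omega, ⟨by omega, by omega⟩, ⟨by omega, by omega⟩,
        take3 hj' hc _ (((fr Y1).set (x := .j) (by simp [hvs]) _).set (x := .a) (by simp [hvs]) _)
          (by simp) (by simp)
        (by simp) (by simp [hY1, hj']) fun a ha' => ?_⟩
      simp [show a ≠ k by omega]
  · simp only [eval_ofNat]
    refine ⟨f2.set (by simp [hvs]) _, by simp, by simp [i2], by simp [i2]; omega, by simp [j2],
      by simp [i2, j2], by simp, fun a b _ hb => by omega, by simp, by simp⟩
  · rintro h' ⟨hf, -, -, -, -, -, hlm, hso, -, -⟩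
    exact ⟨hf, hlm, hso⟩

/-! ### One step from a reduced string back to the string itself -/

/-- Sorts the suffixes of the string of the current level, given the sorted suffixes of the reduced
string in row `0`. -/
def expandSuffixes : Stmt :=
  .seq (.set .b2 (Var.b1 + (Var.np / 3 + 1))) <| .seq (.set .b3 (Var.b2 + (Var.q / 3 + 1))) <|
  .seq rankSample <| .seq sortThrees mergeSuffixes

theorem samplePos_mod {q r : ℕ} : samplePos q r % 3 ≠ 0 := by
  simp only [samplePos]; split_ifs <;> omega

/-- The suffix array of the reduced string yields the suffix array of `s`: its ranks order the
sample positions, they also give the order of the multiples of `3` after one letter, and the two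
lists are merged. -/
theorem expandSuffixes_run (hM : M.Fits) {s R : ℕ → ℕ} {h : View} (hl : Level M s h)
    (hR : Reduces s (h.v .m) R) (hA : IsSA R (h.v .np) h.mem) {X : ℕ}
    (hX : h.v .np + h.v .K + 3 ≤ X) :
    expandSuffixes.RunIn M h X fun h' =>
      Frame [.b2, .b3, .a, .c, .x, .y, .i, .j] (fun k => k < 3 * h.v .top) h h' ∧
        IsSA s (h.v .m) h'.mem := by
  have hw := hM.bits
  have size : M.size = 3 * M.text.length + M.alphabetSize + 100 := rfl
  have hns : ∀ v ∈ [Var.lev, .m, .top, .K, .q, .np, .tp, .b1],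
      v ∉ [Var.b2, .b3, .a, .c, .x, .y, .i, .j] := by decide
  set vs : List Var := [.b2, .b3, .a, .c, .x, .y, .i, .j] with hvs
  set F : ℕ → Prop := fun k => k < 3 * h.v .top with hF
  -- the fixed variables after a part of the program
  have fixed : ∀ h', Frame vs F h h' → h'.v .m = h.v .m ∧ h'.v .top = h.v .top ∧
      h'.v .K = h.v .K ∧ h'.v .q = h.v .q ∧ h'.v .np = h.v .np ∧ h'.v .tp = h.v .tp ∧
      h'.v .b1 = h.v .b1 := fun h' hf =>
    ⟨hf.1 _ (by simp [hvs]), hf.1 _ (by simp [hvs]), hf.1 _ (by simp [hvs]),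
      hf.1 _ (by simp [hvs]), hf.1 _ (by simp [hvs]), hf.1 _ (by simp [hvs]),
      hf.1 _ (by simp [hvs])⟩
  obtain ⟨g1, g2, -, -, g5, g6, g7, g8, g9, g10, g11, g12, g13⟩ := id hl
  set A : ℕ → ℕ := h.mem with hAdef
  refine Stmt.RunIn.seq (R := fun h' => Frame vs F h h' ∧ h'.mem = A ∧
      h'.v .b2 = h.v .b1 + (h.v .np / 3 + 1)) (.of_wp hM (by simp [Stmt.Simple]) (by omega) ?_)
    fun h1 ⟨f1, m1, b1⟩ => Stmt.RunIn.seq (R := fun h' => Frame vs F h h' ∧ h'.mem = A ∧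
      h'.v .b2 = h.v .b1 + (h.v .np / 3 + 1) ∧ h'.v .b3 = h'.v .b2 + (h.v .q / 3 + 1))
    (.of_wp hM (by simp [Stmt.Simple]) (by omega) ?_) fun h2 ⟨f2, m2, b2, b3⟩ => ?_
  · simp only [Stmt.wp, ok_add, ok_div, ok_var, ok_ofNat, eval_add, eval_div, eval_var, eval_ofNat,
      true_and]
    exact ⟨by omega, (Frame.refl _ _ _).set (by simp [hvs]) _, rfl, by simp⟩
  · obtain ⟨e1, e2, e3, e4, e5, e6, e7⟩ := fixed h1 f1
    simp only [Stmt.wp, ok_add, ok_div, ok_var, ok_ofNat, eval_add, eval_div, eval_var, eval_ofNat,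
      true_and]
    exact ⟨by omega, f1.set (by simp [hvs]) _, m1, by simp [b1], by simp [e4]⟩
  have l2 := hl.frame f2 (fun k hk => hk) hns
  obtain ⟨e1, e2, e3, e4, e5, e6, e7⟩ := fixed h2 f2
  refine Stmt.RunIn.seq (rankSample_run hM l2 (R := R) (by omega) (by rw [m2, e5]; exact hA))
    fun h3 ⟨f3', r3, p3⟩ => ?_
  have f3 : Frame vs F h h3 := f2.trans (f3'.mono (by simp [hvs]) (by simp [hF, e2]))
  have l3 := hl.frame f3 (fun k hk => hk) hns
  rw [m2, e5, e6] at r3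
  rw [m2, e5, e7, e4] at p3
  obtain ⟨c1, c2, c3, c4, c5, c6, c7⟩ := fixed h3 f3
  have c8 : h3.v .b2 = h2.v .b2 := f3'.1 _ (by simp)
  have c9 : h3.v .b3 = h2.v .b3 := f3'.1 _ (by simp)
  set ρ : ℕ → ℕ := fun r => h3.mem (3 * h.v .tp + r) with hρ
  have hnp : h.v .np = (h.v .m + 2) / 3 + h.v .m / 3 := by omega
  have hρA : ∀ a < (h.v .m + 2) / 3 + h.v .m / 3, ρ (A a) = a + 1 := by
    rw [← hnp]; exact r3
  refine Stmt.RunIn.seq (sortThrees_run hM l3 (by omega) (by omega) (by omega) ?_)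
    fun h4 ⟨f4', t4, s4⟩ => ?_
  · intro r hr
    rw [c5] at hr ⊢
    obtain ⟨a, ha, rfl⟩ := hA.surj hr
    rw [c6, r3 a ha]; omega
  have f4 : Frame vs F h h4 := f3.trans (f4'.mono (by simp [hvs]) (by
    intro k; simp only [hF]; omega))
  have l4 := hl.frame f4 (fun k hk => hk) hns
  obtain ⟨d1, d2, d3, d4, d5, d6, d7⟩ := fixed h4 f4
  have d8 : h4.v .b2 = h3.v .b2 := f4'.1 _ (by simp)
  have d9 : h4.v .b3 = h3.v .b3 := f4'.1 _ (by simp)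
  have hrank : ∀ p ≤ h.v .m, ∀ p' ≤ h.v .m, p % 3 ≠ 0 → p' % 3 ≠ 0 →
      (sampleRank ρ (h.v .m) p < sampleRank ρ (h.v .m) p' → SufLt s p p') ∧
      (sampleRank ρ (h.v .m) p = sampleRank ρ (h.v .m) p' → p = p') :=
    fun p hp p' hp' h3 h3' => sampleRank_spec g1 hR (by rwa [hnp] at hA) hρA hp hp' h3 h3'
  rw [c1, c4] at t4
  rw [c6, c4] at s4
  have hB1 : ∀ a < h.v .np, h4.mem (3 * h.v .b1 + a) = samplePos (h.v .q) (A a) := by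
    intro a ha
    rw [f4'.2 _ (by omega), p3 a ha]
  have hB1s : SortedBy (SufLt s) (fun a => h4.mem (3 * h.v .b1 + a)) (h.v .np) := by
    intro a b hab hb
    simp only [hB1 a (by omega), hB1 b hb, g5]
    exact hR.sufLt g1 (by rw [← hnp]; exact hA.1 a (by omega)) (by rw [← hnp]; exact hA.1 b hb)
      (hA.2 a b hab hb)
  -- nothing is smaller than the empty suffix
  have hzero : ∀ p, ¬ SufLt s p (h.v .m) := by
    rintro p ⟨d, -, hd⟩
    rw [g1.zero (h.v .m + d) (by omega)] at hd
    omega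
  rw [← d1]
  refine (mergeSuffixes_run hM (ρ := ρ) (st := if h.v .m % 3 = 1 then 1 else 0) l4 (by omega)
    (by omega) (X := X) (by omega) ?_ (by rw [d1]) ?_ (by rw [d7, d5]; exact hB1s) ?_ ?_ ?_).mono
      le_rfl fun h5 ⟨f5, r5⟩ => ⟨f4.trans (f5.mono (by simp [hvs]) (fun k => by
        simp only [hF]; omega)), r5⟩
  · intro r hr
    rw [d6, f4'.2 _ (by omega)]
  · intro a ha hsa
    rw [d5] at ha
    rw [d7, hB1 a ha, d1]
    refine ⟨?_, samplePos_mod⟩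
    have hle : samplePos (h.v .q) (A a) ≤ h.v .m := by
      rw [g5]; exact samplePos_le (by rw [← hnp]; exact hA.1 a ha)
    by_contra hn
    have hm : samplePos (h.v .q) (A a) = h.v .m := by omega
    have ha0 : a ≠ 0 := by
      rintro rfl
      have h0 := hA.1 0 ha
      have : h.v .m % 3 ≠ 1 := by
        intro h1; rw [if_pos h1] at hsa; omega
      simp only [samplePos] at hm
      split_ifs at hm <;> omega
    have := hB1s 0 a (by omega) ha
    simp only [hB1 a ha, hm] at this
    exact hzero _ this
  · intro a ha
    rw [d4] at ha
    rw [d9, d1]; exact t4 a ha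
  · intro a b hab hb
    rw [d4] at hb
    have hx3 := t4 a (by omega)
    have hy3 := t4 b hb
    have hxy := s4 a b hab hb
    simp only [d9] at hxy ⊢
    set x := h4.mem (3 * h3.v .b3 + a)
    set y := h4.mem (3 * h3.v .b3 + b)
    rcases hxy with hxy | ⟨hxy, hlt⟩
    · exact .of_lt hxy
    · have hx : sampleRank ρ (h.v .m) (x + 1) = h3.mem (3 * h.v .tp + x / 3) := by
        rw [sampleRank, if_pos (by omega), show (x + 1) / 3 = x / 3 by omega]
      have hy : sampleRank ρ (h.v .m) (y + 1) = h3.mem (3 * h.v .tp + y / 3) := by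
        rw [sampleRank, if_pos (by omega), show (y + 1) / 3 = y / 3 by omega]
      have := hrank (x + 1) (by omega) (y + 1) (by omega) (by omega) (by omega)
      rw [hx, hy] at this
      refine .cons hxy (hlt.elim this.1 fun heq => absurd (this.2 heq.1) ?_)
      omega
  · intro x y hx hy
    rw [d1] at *
    exact mergeLt_spec g1 hrank hx hy

/-! ### Descending to a string of length one and back -/

/-- The lengths of the iterated reduced strings. -/
def lenAt (n : ℕ) : ℕ → ℕ
  | 0 => n
  | l + 1 => (lenAt n l + 2) / 3 + lenAt n l / 3

/-- The rows in which the iterated reduced strings begin. -/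
def topAt (n σ : ℕ) : ℕ → ℕ
  | 0 => n + (σ + 100) / 3
  | l + 1 => topAt n σ l - (lenAt n (l + 1) / 3 + 1)

theorem lenAt_pos {n : ℕ} (hn : 1 ≤ n) : ∀ l, 1 ≤ lenAt n l
  | 0 => hn
  | l + 1 => by
    have := lenAt_pos hn l
    simp only [lenAt]; omega

theorem topAt_anti (n σ : ℕ) {k l : ℕ} (h : k ≤ l) : topAt n σ l ≤ topAt n σ k := by
  induction h with
  | refl => exact le_rfl
  | step _ ih => exact le_trans (Nat.sub_le _ _) ih

/-- There is always enough room below the current string. -/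
theorem topAt_ge {n σ : ℕ} (hn : 1 ≤ n) : ∀ l, (∀ k < l, 2 ≤ lenAt n k) →
    lenAt n l + min (lenAt n l) 10 + 8 ≤ topAt n σ l ∧
    (l = 0 ∨ 3 * topAt n σ l + lenAt n l < 3 * topAt n σ (l - 1))
  | 0, _ => ⟨by simp only [lenAt, topAt]; omega, Or.inl rfl⟩
  | l + 1, h => by
    have h1 := (topAt_ge hn l (fun k hk => h k (by omega)) (σ := σ)).1
    have h2 := h l (by omega)
    simp only [lenAt, topAt, Nat.add_sub_cancel]
    obtain ⟨c, hc⟩ : ∃ c, lenAt n l = 3 * c ∨ lenAt n l = 3 * c + 1 ∨ lenAt n l = 3 * c + 2 :=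
      ⟨lenAt n l / 3, by omega⟩
    rcases hc with hc | hc | hc <;> rw [hc] at h1 h2 ⊢
    · rw [show (3 * c + 2) / 3 + 3 * c / 3 = 2 * c by omega]; omega
    · rw [show (3 * c + 1 + 2) / 3 + (3 * c + 1) / 3 = 2 * c + 1 by omega]; omega
    · rw [show (3 * c + 2 + 2) / 3 + (3 * c + 2) / 3 = 2 * c + 1 by omega]; omega

/-- The strings `S 0, …, S l`, of which `S 0` is the text and each is the reduction of the one
before, are stored, and the string `S l` is the current one. Behind each reduced string, the length
of the string that it comes from is stored. -/
structure Stack (M : Machine) (S : ℕ → ℕ → ℕ) (l : ℕ) (h : View) : Prop where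
  text : ∀ i, S 0 i = M.text.getD i 0
  reduces : ∀ k < l, 2 ≤ lenAt M.text.length k ∧
    Reduces (S k) (lenAt M.text.length k) (S (k + 1))
  mem : ∀ k, 1 ≤ k → k ≤ l → ∀ i < lenAt M.text.length k,
    h.mem (3 * topAt M.text.length M.alphabetSize k + i) = S k i
  parent : ∀ k < l, h.mem (3 * topAt M.text.length M.alphabetSize (k + 1) +
    lenAt M.text.length (k + 1)) = lenAt M.text.length k
  lev : h.v .lev = l
  m : h.v .m = lenAt M.text.length l
  top : h.v .top = topAt M.text.length M.alphabetSize l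

theorem Stack.frame {S : ℕ → ℕ → ℕ} {l : ℕ} {h h' : View} (hs : Stack M S l h) {vs : List Var}
    {R : ℕ → Prop} (hf : Frame vs R h h') (hR : ∀ k, R k → k < 3 * h.v .top)
    (hvs : ∀ v ∈ [Var.lev, .m, .top], v ∉ vs) : Stack M S l h' := by
  have e : ∀ v ∈ [Var.lev, .m, .top], h'.v v = h.v v := fun v hv => hf.1 v (hvs v hv)
  simp only [List.mem_cons, List.not_mem_nil, or_false, forall_eq_or_imp, forall_eq] at e
  obtain ⟨e1, e2, e3⟩ := e
  obtain ⟨a1, a2, a3, a4, a5, a6, a7⟩ := hs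
  have key : ∀ k ≤ l, ∀ i, h'.mem (3 * topAt M.text.length M.alphabetSize k + i) =
      h.mem (3 * topAt M.text.length M.alphabetSize k + i) := fun k hk i =>
    hf.2 _ fun hk' => by
      have h1 := hR _ hk'
      have h2 := topAt_anti M.text.length M.alphabetSize hk
      omega
  refine ⟨a1, a2, fun k h1 h2 i hi => ?_, fun k hk => ?_, e1.trans a5, e2.trans a6, e3.trans a7⟩
  · rw [key k h2]; exact a3 k h1 h2 i hi
  · rw [key (k + 1) hk]; exact a4 k hk

/-- Computes the derived parameters of the current level. -/
def enterLevel : Stmt :=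
  .seq (.set .K (.ite .eq Var.lev 0
    (.ite .lt .alphabetSize Var.m Var.m .alphabetSize) Var.m)) <|
  .seq (.set .q ((Var.m + 2) / 3)) <| .seq (.set .np (Var.q + Var.m / 3)) <|
  .seq (.set .tp (Var.top - (Var.np / 3 + 1))) (.set .b1 (Var.K / 3 + 2))

/-- A bound, up to a constant, for the work at level `l`. -/
def workAt (n σ l : ℕ) : ℕ := 4 * lenAt n l + if l = 0 then σ else 0

theorem lenAt_le {n : ℕ} (hn : 1 ≤ n) : ∀ l, (∀ k < l, 2 ≤ lenAt n k) → lenAt n l ≤ n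
  | 0, _ => le_rfl
  | l + 1, h => by
    have := lenAt_le hn l fun k hk => h k (by omega)
    have h2 := h l (by omega)
    simp only [lenAt]; omega

/-- The free rows below the current string suffice for the work of the level, by `topAt_ge`. -/
theorem enterLevel_run (hM : M.Fits) (hT : ∀ x ∈ M.text, 1 ≤ x ∧ x ≤ M.alphabetSize)
    {S : ℕ → ℕ → ℕ} {l : ℕ} {h : View} (hs : Stack M S l h)
    (h2 : 2 ≤ lenAt M.text.length l) {X : ℕ} (hX : 1 ≤ X) :
    enterLevel.RunIn M h X fun h' => Frame [.K, .q, .np, .tp, .b1] (fun _ => False) h h' ∧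
      Stack M S l h' ∧ Level M (S l) h' ∧ h'.v .np = lenAt M.text.length (l + 1) ∧
      h'.v .tp = topAt M.text.length M.alphabetSize (l + 1) ∧
      h'.v .np + h'.v .K + 3 ≤ workAt M.text.length M.alphabetSize l := by
  classical
  have hw := hM.bits
  have hn := hM.pos
  have size : M.size = 3 * M.text.length + M.alphabetSize + 100 := rfl
  have hvs : ∀ v ∈ [Var.lev, .m, .top], v ∉ [Var.K, .q, .np, .tp, .b1] := by decide
  obtain ⟨a1, a2, a3, a4, a5, a6, a7⟩ := id hs
  obtain ⟨t1, t2⟩ := topAt_ge hn (σ := M.alphabetSize) l fun k hk => (a2 k hk).1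
  have t3 := topAt_anti M.text.length M.alphabetSize (Nat.zero_le l)
  have t4 := topAt_anti M.text.length M.alphabetSize (Nat.zero_le (l - 1))
  have t0 : topAt M.text.length M.alphabetSize 0 =
    M.text.length + (M.alphabetSize + 100) / 3 := rfl
  have hle := lenAt_le hn l fun k hk => (a2 k hk).1
  set N := lenAt M.text.length l with hN
  have hN' : lenAt M.text.length (l + 1) = (N + 2) / 3 + N / 3 := rfl
  have ht' : topAt M.text.length M.alphabetSize (l + 1) =
    topAt M.text.length M.alphabetSize l - (((N + 2) / 3 + N / 3) / 3 + 1) := rfl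
  set K := if l = 0 then max M.alphabetSize N else N with hK
  have hKe : (Expr.ite .eq Var.lev 0 (.ite .lt .alphabetSize Var.m Var.m .alphabetSize)
      Var.m).eval M h = K := by
    simp only [eval_ite, eval_var, eval_ofNat, holds_eq, holds_lt, eval_alphabetSize, a5, a6, hK]
    split_ifs <;> omega
  have hKo : (Expr.ite .eq Var.lev 0 (.ite .lt .alphabetSize Var.m Var.m .alphabetSize)
      Var.m).Ok M h := by
    simp [ok_ite]
  refine .of_wp hM (by simp [enterLevel, Stmt.Simple]) hX ?_
  simp only [enterLevel, Stmt.wp, hKe, hKo, ok_add, ok_div, ok_sub, ok_var, ok_ofNat, eval_add,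
    eval_div, eval_sub, eval_var, eval_ofNat, View.set_v, reduceCtorEq, if_true, if_false, a6, a7,
    true_and]
  have hKb : N ≤ K ∧ K ≤ M.text.length + M.alphabetSize := by
    rw [hK]; split_ifs <;> omega
  have f : Frame [.K, .q, .np, .tp, .b1] (fun _ => False) h
      (((((h.set .K K).set .q ((N + 2) / 3)).set .np ((N + 2) / 3 + N / 3)).set .tp
        (topAt M.text.length M.alphabetSize l - (((N + 2) / 3 + N / 3) / 3 + 1))).set .b1
        (K / 3 + 2)) :=
    (((((Frame.refl _ _ _).set (by simp) _).set (by simp) _).set (by simp) _).set (by simp) _).set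
      (by simp) _
  have room : K / 3 + 2 + (((N + 2) / 3 + N / 3) / 3 + 1) + 2 * ((N + 2) / 3 / 3 + 1) +
      (((N + 2) / 3 + N / 3) / 3 + 1) ≤ topAt M.text.length M.alphabetSize l := by
    have hKt : 3 * (K / 3) + 2 * N + 3 * 10 ≤ 3 * topAt M.text.length M.alphabetSize l ∨
        K = N ∧ N < 10 := by
      rcases Nat.eq_zero_or_pos l with rfl | hl
      · have : N = M.text.length := rfl
        simp only [hK, if_true, t0, max_def]
        left
        split_ifs <;> omega
      · rw [if_neg (by omega)] at hK
        omega
    rcases hKt with hKt | ⟨h1, h3⟩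
    · obtain ⟨c, hc⟩ : ∃ c, N = 3 * c ∨ N = 3 * c + 1 ∨ N = 3 * c + 2 := ⟨N / 3, by omega⟩
      rcases hc with hc | hc | hc <;> rw [hc] at hKt ⊢
      · rw [show (3 * c + 2) / 3 = c by omega, show 3 * c / 3 = c by omega]; omega
      · rw [show (3 * c + 1 + 2) / 3 = c + 1 by omega, show (3 * c + 1) / 3 = c by omega]; omega
      · rw [show (3 * c + 2 + 2) / 3 = c + 1 by omega, show (3 * c + 2) / 3 = c by omega]; omega
    · rw [h1]
      generalize topAt M.text.length M.alphabetSize l = top at t1 ⊢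
      clear_value N
      clear * - h2 h3 t1
      interval_cases N <;> omega
  refine ⟨by omega, by omega, by omega, by omega, f, hs.frame f (by simp) hvs, ?_, ?_, ?_,
    ?_⟩
  · have hstr0 : IsStr (S 0) M.text.length := by
      refine ⟨fun i hi => ?_, fun i hi => ?_⟩
      · rw [a1, List.getD_eq_getElem _ _ hi]
        exact (hT _ (List.getElem_mem hi)).1
      · rw [a1, List.getD_eq_default _ _ hi]
    have hstr : IsStr (S l) N := by
      rcases l with _ | l
      · exact hstr0
      · exact (a2 l (by omega)).2.str
    constructor <;> simp only [View.set_v, reduceCtorEq, if_true, if_false, a5, a6, a7,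
      View.set_mem]
    · exact hstr
    · intro i
      rcases Nat.lt_or_ge i N with hi | hi
      · rcases l with _ | l
        · rw [a1]
          simp only [hN, lenAt] at hi
          rw [List.getD_eq_getElem _ _ hi]
          have := (hT _ (List.getElem_mem hi)).2
          simp only [hK, if_true]; omega
        · exact ((a2 l (by omega)).2.le i hi).trans hKb.1
      · rw [hstr.zero i hi]; omega
    · rintro rfl
      exact ⟨rfl, fun i _ => a1 i⟩
    · intro hl0
      exact ⟨by omega, fun i hi => a3 l (by omega) le_rfl i hi⟩
    all_goals omega
  · simp [hN']
  · simp [ht']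
  · simp only [workAt, hK, ← hN]
    split_ifs <;> omega

/-- One step of the descent: the current string is replaced by its reduction. -/
def descend : Stmt :=
  .seq enterLevel <| .seq sortTriples <| .seq nameTriples <|
  .seq (.put Var.tp Var.np Var.m) <| .seq (.set .m Var.np) <|
  .seq (.set .top Var.tp) (.set .lev (Var.lev + 1))

theorem workAt_pos {n σ l : ℕ} (hn : 1 ≤ n) : 1 ≤ workAt n σ l := by
  have := lenAt_pos hn l
  simp only [workAt]; omega

theorem add_lenAt_le {n l : ℕ} (h : ∀ k < l, 2 ≤ lenAt n k) : l + lenAt n l ≤ n := by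
  induction l with
  | zero => simp [lenAt]
  | succ l ih =>
    have h1 := ih fun k hk => h k (by omega)
    have h2 := h l (by omega)
    simp only [lenAt]; omega

theorem descend_run (hM : M.Fits) (hT : ∀ x ∈ M.text, 1 ≤ x ∧ x ≤ M.alphabetSize)
    {S : ℕ → ℕ → ℕ} {l : ℕ} {h : View} (hs : Stack M S l h) (h2 : 2 ≤ lenAt M.text.length l) :
    descend.RunIn M h (workAt M.text.length M.alphabetSize l) fun h' =>
      ∃ S', Stack M S' (l + 1) h' := by
  have hw := hM.bits
  have hn := hM.pos
  have size : M.size = 3 * M.text.length + M.alphabetSize + 100 := rfl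
  have hX := workAt_pos (σ := M.alphabetSize) (l := l) hn
  have hns : ∀ v ∈ [Var.lev, .m, .top, .K, .q, .np, .tp, .b1], v ∉ [Var.a, .c, .x] := by decide
  refine Stmt.RunIn.seq (enterLevel_run hM hT hs h2 hX) fun h1 ⟨f1, k1, l1, n1, p1, w1⟩ => ?_
  refine Stmt.RunIn.seq (sortTriples_run hM l1 w1) fun h2 ⟨f2, r2, s2⟩ => ?_
  have l2 := l1.frame f2 (fun k hk => hk) hns
  have e1 : h2.v .np = h1.v .np := f2.1 _ (by simp)
  have e2 : h2.v .b1 = h1.v .b1 := f2.1 _ (by simp)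
  have e3 : h2.v .q = h1.v .q := f2.1 _ (by simp)
  have e4 : h2.v .m = h1.v .m := f2.1 _ (by simp)
  have e5 : h2.v .tp = h1.v .tp := f2.1 _ (by simp)
  have e6 : h2.v .top = h1.v .top := f2.1 _ (by simp)
  refine Stmt.RunIn.seq (nameTriples_run hM l2 (by omega) (by rwa [e1, e2])
    (by rwa [e1, e2, e3])) fun h3 ⟨f3, r3⟩ => ?_
  have k3 := (k1.frame f2 (fun k hk => hk) (by decide)).frame f3 (fun k hk => hk) (by decide)
  have d1 : h3.v .np = h1.v .np := (f3.1 _ (by simp)).trans e1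
  have d4 : h3.v .m = h1.v .m := (f3.1 _ (by simp)).trans e4
  have d5 : h3.v .tp = h1.v .tp := (f3.1 _ (by simp)).trans e5
  have d6 : h3.v .top = h1.v .top := (f3.1 _ (by simp)).trans e6
  obtain ⟨a1, a2, a3, a4, a5, a6, a7⟩ := id k3
  have hle := add_lenAt_le fun k hk => (a2 k hk).1
  have b1 := l1.top_eq
  have b2 := l1.top_le
  set R : ℕ → ℕ := fun r => if r < h2.v .np then h3.mem (3 * h2.v .tp + r) else 0 with hR
  rw [e4, ← d4, a6] at r3
  refine .of_wp hM (by simp [Stmt.Simple]) hX ?_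
  simp only [Stmt.wp, ok_add, ok_var, ok_ofNat, eval_add, eval_var, eval_ofNat, View.set_v,
    View.put_v, reduceCtorEq, if_false, d1, d4, d5, a5,
    true_and]
  refine ⟨by omega, ⟨by omega, by omega⟩, ?_⟩
  have key : ∀ k ≤ l, ∀ i, (if 3 * topAt M.text.length M.alphabetSize k + i =
      3 * h1.v .tp + h1.v .np then h1.v .m
      else h3.mem (3 * topAt M.text.length M.alphabetSize k + i)) =
      h3.mem (3 * topAt M.text.length M.alphabetSize k + i) := fun k hk i => by
    have h2 := topAt_anti M.text.length M.alphabetSize hk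
    rw [if_neg (by omega)]
  refine ⟨Function.update S (l + 1) R, ?_, ?_, ?_, ?_, ?_, ?_, ?_⟩
  · simpa using a1
  · intro k hk
    rw [Function.update_of_ne (by omega)]
    rcases Nat.lt_or_ge k l with h | h
    · rw [Function.update_of_ne (by omega)]; exact a2 k h
    · obtain rfl : k = l := by omega
      rw [Function.update_self]
      exact ⟨‹_›, r3⟩
  · intro k hk1 hk2 i hi
    simp only [View.set_mem, View.put_mem]
    rcases Nat.lt_or_ge l k with h | h
    · obtain rfl : k = l + 1 := by omega
      rw [← p1, if_neg (by omega), Function.update_self]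
      simp only [hR]
      rw [if_pos (by omega), e5]
    · rw [key k h, Function.update_of_ne (by omega)]
      exact a3 k hk1 h i hi
  · intro k hk
    simp only [View.set_mem, View.put_mem]
    rcases Nat.lt_or_ge k l with h | h
    · rw [key (k + 1) h]; exact a4 k h
    · obtain rfl : k = l := by omega
      rw [if_pos (by omega)]; omega
  · simp
  · simpa using n1
  · simpa using p1

/-- One step back: the suffixes of the string from which the current string was obtained are
sorted. -/
def ascend : Stmt :=
  .seq (.seq (.set .x Var.m) <| .seq (.set .m (.get Var.top Var.x)) <|
    .seq (.set .top (Var.top + (Var.x / 3 + 1))) (.set .lev (Var.lev - 1))) <|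
  .seq enterLevel expandSuffixes

theorem ascend_run (hM : M.Fits) (hT : ∀ x ∈ M.text, 1 ≤ x ∧ x ≤ M.alphabetSize)
    {S : ℕ → ℕ → ℕ} {l : ℕ} {h : View} (hs : Stack M S (l + 1) h)
    (hA : IsSA (S (l + 1)) (lenAt M.text.length (l + 1)) h.mem) :
    ascend.RunIn M h (workAt M.text.length M.alphabetSize l) fun h' =>
      Stack M S l h' ∧ IsSA (S l) (lenAt M.text.length l) h'.mem := by
  have hw := hM.bits
  have hn := hM.pos
  have size : M.size = 3 * M.text.length + M.alphabetSize + 100 := rfl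
  have hX := workAt_pos (σ := M.alphabetSize) (l := l) hn
  obtain ⟨a1, a2, a3, a4, a5, a6, a7⟩ := id hs
  obtain ⟨t1, t2⟩ := topAt_ge hn (σ := M.alphabetSize) (l + 1) fun k hk => (a2 k hk).1
  have t3 := topAt_anti M.text.length M.alphabetSize (Nat.zero_le l)
  have t0 : topAt M.text.length M.alphabetSize 0 =
    M.text.length + (M.alphabetSize + 100) / 3 := rfl
  have t5 : topAt M.text.length M.alphabetSize (l + 1) =
    topAt M.text.length M.alphabetSize l - (lenAt M.text.length (l + 1) / 3 + 1) := rfl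
  have hpar := a4 l (by omega)
  simp only [Nat.add_sub_cancel] at t2
  set h4 := (((h.set .x (h.v .m)).set .m (lenAt M.text.length l)).set .top
      (topAt M.text.length M.alphabetSize l)).set .lev l with h4def
  have e : ∀ P : View → Prop, P h4 →
      (Stmt.seq (.set .x Var.m) <| .seq (.set .m (.get Var.top Var.x)) <|
        .seq (.set .top (Var.top + (Var.x / 3 + 1))) (.set .lev (Var.lev - 1))).wp M P h := by
    intro P hP
    simp only [Stmt.wp, ok_add, ok_sub, ok_var, ok_ofNat, eval_add, eval_sub, eval_var, eval_ofNat,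
      View.set_v, View.set_mem, reduceCtorEq, if_true, if_false, ok_get, eval_get, ok_div, eval_div,
      a5, a7, true_and]
    rw [a6, hpar, show topAt M.text.length M.alphabetSize (l + 1) +
      (lenAt M.text.length (l + 1) / 3 + 1) = topAt M.text.length M.alphabetSize l by omega,
      Nat.add_sub_cancel]
    rw [h4def, a6] at hP
    exact ⟨by omega, by omega, by simp, hP⟩
  have hs4 : Stack M S l h4 := by
    refine ⟨a1, fun k hk => a2 k (by omega), fun k hk hk' => a3 k hk (by omega),
      fun k hk => a4 k (by omega), ?_, ?_, ?_⟩ <;> simp [h4def]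
  have hmain : (Stmt.seq enterLevel expandSuffixes).RunIn M h4
      (workAt M.text.length M.alphabetSize l) fun h' =>
      Stack M S l h' ∧ IsSA (S l) (lenAt M.text.length l) h'.mem := by
    refine Stmt.RunIn.seq (enterLevel_run hM hT hs4 (a2 l (by omega)).1 hX)
      fun h5 ⟨f5, k5, l5, n5, p5, w5⟩ => ?_
    have em : h5.mem = h.mem := funext fun k => f5.2 k (by simp)
    refine (expandSuffixes_run hM l5 (R := S (l + 1)) ?_ ?_ w5).mono le_rfl
      fun h6 ⟨f6, r6⟩ => ⟨k5.frame f6 (fun k hk => hk) (by decide), ?_⟩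
    · rw [k5.m]; exact (a2 l (by omega)).2
    · rw [n5, em]; exact hA
    · rw [k5.m] at r6; exact r6
  have hrun := Stmt.RunIn.seq (.of_wp hM (by simp [Stmt.Simple]) hX (e (fun h' => h' = h4) rfl))
    fun h5 (h5e : h5 = h4) => h5e ▸ hmain
  exact hrun

/-! ### The suffix array in linear time -/

/-- The work at all levels before level `l`. -/
def workSum (n σ : ℕ) : ℕ → ℕ
  | 0 => 0
  | l + 1 => workSum n σ l + workAt n σ l

/-- The lengths decrease geometrically, so the total work is linear. -/
theorem workSum_le {n σ : ℕ} : ∀ l, (∀ k < l, 2 ≤ lenAt n k) →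
    workSum n σ l + 24 * lenAt n l ≤ 24 * n + σ ∧ (l = 0 → workSum n σ l + 24 * lenAt n l ≤ 24 * n)
  | 0, _ => by simp [workSum, lenAt]
  | l + 1, h => by
    have h1 := workSum_le l (fun k hk => h k (by omega)) (σ := σ)
    have h2 := h l (by omega)
    simp only [lenAt, workSum, workAt]
    refine ⟨?_, by omega⟩
    split_ifs with h0
    · have := h1.2 h0; omega
    · omega

/-- Sorts the suffixes of the text into row `0`, with positions counted from `0`. -/
def sortSuffixes : Stmt :=
  .seq (.seq (.set .lev 0) <| .seq (.set .m .textLen) <|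
    .set .top (.textLen + (.alphabetSize + 100) / 3)) <|
  .seq (.loop .lt 1 Var.m descend) <| .seq (.put 0 0 0) (.loop .lt 0 Var.lev ascend)

/-- Sorting takes linear time. The loop downwards has the potential `24 n + σ - workSum` and the loop
upwards the potential `workSum`, up to constant factors. -/
theorem sortSuffixes_run : ∃ C, ∀ M : Machine, M.Fits →
    (∀ x ∈ M.text, 1 ≤ x ∧ x ≤ M.alphabetSize) → ∀ h : View,
    sortSuffixes.Run M h (C * (M.text.length + M.alphabetSize)) fun h' =>
      IsSA (fun i => M.text.getD i 0) M.text.length h'.mem := by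
  set D := descend.compile.cost + condCost 1 Var.m with hD
  set U := ascend.compile.cost + condCost 0 Var.lev with hU
  set c1 := (Stmt.seq (.set .lev 0) <| .seq (.set .m .textLen) <|
    .set .top (.textLen + (.alphabetSize + 100) / 3)).compile.cost with hc1
  set c2 := (Stmt.put 0 0 0).compile.cost with hc2
  refine ⟨c1 + (24 * D + condCost 1 Var.m) + (c2 + (24 * U + condCost 0 Var.lev)),
    fun M hM hT h => ?_⟩
  have hw := hM.bits
  have hn := hM.pos
  have size : M.size = 3 * M.text.length + M.alphabetSize + 100 := rfl
  set n := M.text.length with hndef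
  set σ := M.alphabetSize with hσ
  have hX : ∀ l, 1 ≤ workAt n σ l := fun l => workAt_pos hn
  have start : (Stmt.seq (.set .lev 0) <| .seq (.set .m .textLen) <|
      .set .top (.textLen + (.alphabetSize + 100) / 3)).Run M h c1
      fun h' => Stack M (fun _ i => M.text.getD i 0) 0 h' := by
    refine .of_wp hM (by simp [Stmt.Simple]) ?_
    simp only [Stmt.wp, ok_add, ok_div, ok_textLen, ok_alphabetSize, ok_ofNat, eval_add, eval_div,
      eval_textLen, eval_alphabetSize, eval_ofNat, true_and]
    refine ⟨by omega, by omega, fun _ => rfl, by simp, by omega, by simp, ?_, ?_, ?_⟩ <;>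
      simp [lenAt, topAt, hndef, hσ]
  have down : ∀ h, Stack M (fun _ i => M.text.getD i 0) 0 h →
      (Stmt.loop .lt 1 Var.m descend).Run M h (D * (24 * n + σ) + condCost 1 Var.m) fun h' =>
        ∃ S l, Stack M S l h' ∧ lenAt n l = 1 := by
    intro h hs
    have := Stmt.Run.loop hM (ι := ℕ × (ℕ → ℕ → ℕ)) (fun g h => Stack M g.2 g.1 h)
      (fun g => D * (24 * n + σ - workSum n σ g.1)) (r := .lt) (a := 1) (b := Var.m)
      (p := descend) (by simp) (by simp) (fun g h _ => by simp) ?_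
      (g := (0, fun _ i => M.text.getD i 0)) hs
    · refine this.mono (by simp [workSum]) ?_
      rintro h' ⟨⟨l, S⟩, hs', hlt⟩
      refine ⟨S, l, hs', ?_⟩
      have := lenAt_pos hn l
      simp only [← hndef, eval_ofNat, eval_var, holds_lt, hs'.m] at hlt
      omega
    · rintro ⟨l, S⟩ h hs' hlt
      simp only [eval_ofNat, eval_var, holds_lt, hs'.m] at hlt
      refine ⟨_, (descend_run hM hT hs' hlt).mono le_rfl fun h' ⟨S', hS'⟩ =>
        ⟨(l + 1, S'), hS', ?_⟩⟩
      have h1 := (workSum_le (n := n) (σ := σ) (l + 1) fun k hk => (hS'.reduces k hk).1).1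
      have h2 := hX l
      simp only [workSum] at h1 ⊢
      obtain ⟨r, hr⟩ : ∃ r, 24 * n + σ = workSum n σ l + workAt n σ l + r :=
        ⟨24 * n + σ - (workSum n σ l + workAt n σ l), by omega⟩
      rw [hr, Nat.add_sub_cancel_left, Nat.add_assoc (workSum n σ l), Nat.add_sub_cancel_left]
      rw [Nat.mul_add D, hD]
      nlinarith
  have base : ∀ h, (∃ S l, Stack M S l h ∧ lenAt n l = 1) →
      (Stmt.put 0 0 0).Run M h c2 fun h' =>
        ∃ S l, Stack M S l h' ∧ IsSA (S l) (lenAt n l) h'.mem := by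
    rintro h ⟨S, l, hs, h1⟩
    refine .of_wp hM (by simp [Stmt.Simple]) ?_
    simp only [Stmt.wp, ok_ofNat, eval_ofNat]
    have ht := (topAt_ge hn (σ := σ) l fun k hk => (hs.reduces k hk).1).1
    have hf : Frame [] (fun k => k < 3 * h.v .top) h (h.put (3 * 0 + 0) 0) :=
      (Frame.refl _ _ _).put (by rw [hs.top, ← hndef, ← hσ]; omega) _
    refine ⟨by omega, by omega, by omega, by omega, S, l, hs.frame hf (fun k hk => hk) (by simp),
      ?_, ?_⟩
    · intro k hk
      obtain rfl : k = 0 := by omega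
      simp [h1]
    · intro a b _ hb; omega
  have up : ∀ h, (∃ S l, Stack M S l h ∧ IsSA (S l) (lenAt n l) h.mem) →
      (Stmt.loop .lt 0 Var.lev ascend).Run M h (U * (24 * n + σ) + condCost 0 Var.lev) fun h' =>
        IsSA (fun i => M.text.getD i 0) n h'.mem := by
    rintro h ⟨S, l, hs, hA⟩
    have := Stmt.Run.loop hM (fun l h => Stack M S l h ∧ IsSA (S l) (lenAt n l) h.mem)
      (fun l => U * workSum n σ l) (r := .lt) (a := 0) (b := Var.lev)
      (p := ascend) (by simp) (by simp) (fun g h _ => by simp) ?_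
      (g := l) ⟨hs, hA⟩
    · refine this.mono ?_ ?_
      · have h1 := (workSum_le (n := n) (σ := σ) l fun k hk => (hs.reduces k hk).1).1
        have := Nat.mul_le_mul_left U (show workSum n σ l ≤ 24 * n + σ by omega)
        omega
      · rintro h' ⟨l', ⟨hs', hA'⟩, hlt⟩
        simp only [eval_ofNat, eval_var, holds_lt, hs'.lev] at hlt
        obtain rfl : l' = 0 := by omega
        have : S 0 = fun i => M.text.getD i 0 := funext hs'.text
        rwa [this] at hA'
    · rintro l h ⟨hs', hA'⟩ hlt
      simp only [eval_ofNat, eval_var, holds_lt, hs'.lev] at hlt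
      obtain ⟨l, rfl⟩ : ∃ k, l = k + 1 := ⟨l - 1, by omega⟩
      refine ⟨_, (ascend_run hM hT hs' hA').mono le_rfl fun h' hh' => ⟨l, hh', ?_⟩⟩
      have h2 := hX l
      simp only [workSum, hU]
      nlinarith
  refine (start.seq fun h1 r1 => (down h1 r1).seq fun h2 r2 => (base h2 r2).seq fun h3 r3 =>
    up h3 r3).mono ?_ fun _ h => h
  nlinarith [Nat.zero_le (D * σ), Nat.zero_le (U * σ), Nat.zero_le (c1 * (n + σ - 1)),
    Nat.mul_le_mul_left (c1 + condCost 1 Var.m + c2 + condCost 0 Var.lev)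
      (show 1 ≤ n + σ by omega)]

/-! ### The Lyndon array and next smaller suffixes -/

/-- Lexicographic comparison of words with prefixes of equal length. -/
theorem append_lt_append_iff {a b c d : List ℕ} (h : a.length = b.length) :
    a ++ c < b ++ d ↔ a < b ∨ a = b ∧ c < d := by
  induction a generalizing b with
  | nil =>
    obtain rfl : b = [] := List.length_eq_zero_iff.1 h.symm
    simp
  | cons x a ih =>
    obtain ⟨y, b, rfl⟩ : ∃ y b', b = y :: b' := by
      cases b with
      | nil => simp at h
      | cons y b => exact ⟨y, b, rfl⟩
    have h' : a.length = b.length := by simpa using h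
    simp only [List.cons_append, List.cons_lt_cons_iff, ih h', List.cons.injEq]
    tauto

/-- Words that commute are powers of one word. -/
theorem exists_flatten_replicate_of_append_comm (v y : List ℕ) (h : v ++ y = y ++ v) :
    ∃ (S : List ℕ) (a b : ℕ), v = (List.replicate a S).flatten ∧
      y = (List.replicate b S).flatten := by
  induction hN : v.length + y.length using Nat.strong_induction_on generalizing v y with
  | _ N ih =>
  have key : ∀ v y : List ℕ, v.length + y.length = N → v ++ y = y ++ v → v.length ≤ y.length →
      ∃ (S : List ℕ) (a b : ℕ), v = (List.replicate a S).flatten ∧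
        y = (List.replicate b S).flatten := by
    intro v y hN h hle
    rcases v with _ | ⟨x, v⟩
    · exact ⟨y, 0, 1, by simp, by simp⟩
    obtain ⟨y', rfl⟩ : x :: v <+: y := by
      refine List.prefix_of_prefix_length_le (List.prefix_append _ y) ?_ hle
      rw [h]; exact List.prefix_append _ _
    rw [List.append_assoc, List.append_cancel_left_eq] at h
    simp only [List.length_append, List.length_cons] at hN
    obtain ⟨S, a, b, h1, h2⟩ := ih (y'.length + (x :: v).length) (by simp; omega) _ _ h
      (by simp; omega)
    refine ⟨S, a, a + b, h1, ?_⟩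
    rw [List.replicate_add, List.flatten_append, ← h1, ← h2]
  rcases Nat.le_total v.length y.length with hle | hle
  · exact key v y hN h hle
  · obtain ⟨S, a, b, h1, h2⟩ := key y v (by omega) h.symm hle
    exact ⟨S, b, a, h2, h1⟩

/-- A word that is smaller than all its nontrivial rotations is a Lyndon word. -/
theorem isLyndonWord_of_lt_rotate {u : List ℕ} (hu : u ≠ [])
    (h : ∀ k, 0 < k → k < u.length → u < u.rotate k) : IsLyndonWord u := by
  have hpos := List.length_pos_iff.2 hu
  refine ⟨?_, fun k => ?_⟩
  · rintro ⟨S, k, hk, rfl⟩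
    obtain ⟨k, rfl⟩ : ∃ j, k = j + 2 := ⟨k - 2, by omega⟩
    have hS : 0 < S.length := by
      by_contra hn
      obtain rfl : S = [] := List.length_eq_zero_iff.1 (by omega)
      simp at hpos
    have e : (List.replicate (k + 2) S).flatten = S ++ (List.replicate (k + 1) S).flatten := by
      rw [List.replicate_succ, List.flatten_cons]
    have e' : (List.replicate (k + 2) S).flatten = (List.replicate (k + 1) S).flatten ++ S := by
      rw [List.replicate_succ', List.flatten_append]; simp
    have hlt : S.length < (List.replicate (k + 2) S).flatten.length := by
      rw [e, List.replicate_succ, List.flatten_cons]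
      simp only [List.length_append]; omega
    have := h S.length hS hlt
    nth_rw 2 [e] at this
    rw [List.rotate_append_length_eq, ← e'] at this
    exact lt_irrefl _ this
  · rw [← List.rotate_mod]
    rcases Nat.eq_zero_or_pos (k % u.length) with h0 | h0
    · rw [h0, List.rotate_zero]
    · exact (h _ h0 (Nat.mod_lt _ hpos)).le

/-- A Lyndon word is not of the form `v ++ x = y ++ v` with nonempty `v` and `y`. -/
theorem IsLyndonWord.no_border {v x y : List ℕ} (h : IsLyndonWord (v ++ x)) (hxy : v ++ x = y ++ v)
    (hv : v ≠ []) (hy : y ≠ []) : False := by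
  have hlen : x.length = y.length := by
    have := congrArg List.length hxy
    simp only [List.length_append] at this; omega
  have h1 : v ++ x ≤ x ++ v := by
    have := h.2 v.length
    rwa [List.rotate_append_length_eq] at this
  have h2 : v ++ x ≤ v ++ y := by
    have := h.2 y.length
    nth_rw 2 [hxy] at this
    rwa [List.rotate_append_length_eq] at this
  rw [← not_lt] at h1 h2
  rw [hxy, append_lt_append_iff hlen] at h1
  rw [append_lt_append_iff rfl] at h2
  have h3 : x = y := le_antisymm (not_lt.1 fun h => h2 (Or.inr ⟨rfl, h⟩))
    (not_lt.1 fun h => h1 (Or.inl h))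
  subst h3
  obtain ⟨S, a, b, ha, hb⟩ := exists_flatten_replicate_of_append_comm v x hxy
  have ha0 : a ≠ 0 := by rintro rfl; simp at ha; exact hv ha
  have hb0 : b ≠ 0 := by rintro rfl; simp at hb; exact hy hb
  exact h.1 ⟨S, a + b, by omega, by rw [List.replicate_add, List.flatten_append, ← ha, ← hb]⟩

/-- `N` is the next position after `j` at which a smaller suffix starts, or one more than the
length of the text. -/
structure IsNextSmaller (T : List ℕ) (j N : ℕ) : Prop where
  lt : j < N
  le : N ≤ T.length + 1
  smaller : N ≤ T.length → suffix T N < suffix T j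
  larger : ∀ k, j < k → k < N → suffix T j < suffix T k

theorem suffix_eq_factor_append {T : List ℕ} {j l : ℕ} (hj : 1 ≤ j) :
    suffix T j = factor T j l ++ suffix T (j + l) := by
  simp only [suffix, factor]
  rw [show j + l - 1 = j - 1 + l by omega, ← List.drop_drop, List.take_append_drop]

theorem factor_add {T : List ℕ} {j k l : ℕ} (hj : 1 ≤ j) :
    factor T j (k + l) = factor T j k ++ factor T (j + k) l := by
  simp only [factor]
  rw [List.take_add, List.drop_drop, show j + k - 1 = j - 1 + k by omega]

theorem length_factor {T : List ℕ} {j l : ℕ} (hj : 1 ≤ j) (h : j + l ≤ T.length + 1) :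
    (factor T j l).length = l := by
  simp only [factor, List.length_take, List.length_drop]; omega

/-- The longest Lyndon factor that starts at `j` ends just before the next smaller suffix. The factor
up to there is smaller than its rotations because the suffixes between `j` and `N` are larger than
the one at `j`; a border of the factor would make some suffix between them smaller than the suffix
at `N`, hence smaller than the one at `j`. A longer factor has a smaller rotation, which begins at
`N`, or a border. -/
theorem IsNextSmaller.isGreatest {T : List ℕ} {j N : ℕ} (hj : 1 ≤ j) (h : IsNextSmaller T j N) :
    IsGreatest {l : ℕ | 1 ≤ l ∧ j + l ≤ T.length + 1 ∧ IsLyndonWord (factor T j l)} (N - j) := by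
  obtain ⟨hjN, hN, hs, hl⟩ := h
  constructor
  · refine ⟨by omega, by omega, ?_⟩
    have hlen : (factor T j (N - j)).length = N - j := length_factor hj (by omega)
    refine isLyndonWord_of_lt_rotate (fun h0 => ?_) fun d hd hd' => ?_
    · rw [h0] at hlen; simp at hlen; omega
    rw [hlen] at hd'
    -- the rotation by `d` is `T[j + d, N - 1]` followed by `T[j, j + d - 1]`
    set e := N - j - d with he
    have e1 : factor T j (N - j) = factor T j d ++ factor T (j + d) e := by
      rw [← factor_add hj]; congr 1; omega
    have e2 : factor T j (N - j) = factor T j e ++ factor T (j + e) d := by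
      rw [← factor_add hj]; congr 1; omega
    have hrot : (factor T j (N - j)).rotate d = factor T (j + d) e ++ factor T j d := by
      rw [e1]
      nth_rw 3 [← length_factor (T := T) (j := j) (l := d) hj (by omega)]
      rw [List.rotate_append_length_eq]
    have hlt := hl (j + d) (by omega) (by omega)
    rw [suffix_eq_factor_append (l := e) hj, suffix_eq_factor_append (j := j + d) (l := e)
      (by omega), append_lt_append_iff (by
        rw [length_factor hj (by omega), length_factor (by omega) (by omega)])] at hlt
    rw [hrot, e2, append_lt_append_iff (by
        rw [length_factor hj (by omega), length_factor (by omega) (by omega)])]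
    refine hlt.imp id fun ⟨_, h2⟩ => ?_
    exfalso
    rw [show j + d + e = N by omega] at h2
    rcases Nat.lt_or_ge T.length N with h3 | h3
    · have : suffix T N = [] := by simp only [suffix]; exact List.drop_eq_nil_of_le (by omega)
      rw [this] at h2
      exact List.not_lt_nil _ h2
    · exact lt_irrefl _ ((h2.trans (hs h3)).trans (hl (j + e) (by omega) (by omega)))
  · rintro l ⟨h1, h2, hly⟩
    by_contra hn
    set d := N - j with hd
    set e := l - d with he
    have hlt := hs (by omega)
    have e1 : factor T j l = factor T j d ++ factor T (j + d) e := by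
      rw [← factor_add hj]; congr 1; omega
    have e2 : factor T j l = factor T j e ++ factor T (j + e) d := by
      rw [← factor_add hj]; congr 1; omega
    have l1 : (factor T j d).length = d := length_factor hj (by omega)
    have l2 : (factor T j e).length = e := length_factor hj (by omega)
    have l3 : (factor T (j + d) e).length = e := length_factor (by omega) (by omega)
    rw [show N = j + d by omega, suffix_eq_factor_append (j := j + d) (l := e) (by omega),
      suffix_eq_factor_append (l := e) hj, append_lt_append_iff (by rw [l2, l3])] at hlt
    rcases hlt with hlt | ⟨heq, -⟩
    · have hle := hly.2 d
      have hrot : (factor T j l).rotate d = factor T (j + d) e ++ factor T j d := by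
        rw [e1]
        nth_rw 3 [← l1]
        rw [List.rotate_append_length_eq]
      rw [hrot, e2, ← not_lt, append_lt_append_iff (by rw [l2, l3])] at hle
      exact hle (Or.inl hlt)
    · rw [heq] at e1
      rw [e2] at hly e1
      refine hly.no_border e1 (fun h0 => ?_) fun h0 => ?_
      · rw [h0] at l2; simp at l2; omega
      · rw [h0] at l1; simp at l1; omega

/-! ### The merged pointer array -/

/-- `v` is the last position before `j` with `LA[v] = 0`, or `0` if there is none. -/
def IsPred (LA : ℕ → ℕ) (j v : ℕ) : Prop :=
  v < j ∧ (1 ≤ v → LA v = 0) ∧ ∀ l, l < j → v < l → LA l ≠ 0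

/-- `IsNext` says that `v` is the next zero of `LA` after `i`, or `n + 1`. -/
theorem isNext_iff {n i v : ℕ} {LA : ℕ → ℕ} (hi : i ≤ n) : IsNext n LA i v ↔
    i < v ∧ v ≤ n + 1 ∧ (v ≤ n → LA v = 0) ∧ ∀ l, i < l → l < v → LA l ≠ 0 := by
  simp only [IsNext, IsLeast, mem_lowerBounds, Set.mem_union, Set.mem_singleton_iff,
    Set.mem_ofPred_eq]
  constructor
  · rintro ⟨h1, h2⟩
    have h3 := h2 (n + 1) (Or.inl rfl)
    refine ⟨by omega, h3, fun h => (h1.resolve_left (by omega)).2.2, fun l h4 h5 h6 => ?_⟩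
    have := h2 l (Or.inr ⟨h4, by omega, h6⟩)
    omega
  · rintro ⟨h1, h2, h3, h4⟩
    refine ⟨?_, fun l hl => ?_⟩
    · rcases Nat.lt_or_ge n v with h | h
      · left; omega
      · exact Or.inr ⟨h1, h, h3 h⟩
    · by_contra hn
      rcases hl with hl | hl
      · omega
      · exact h4 l hl.1 (by omega) hl.2.2

/-- For a zero `j` of `LA`, the previous zero is the position whose next zero is `j`. -/
theorem IsPred.isPrev {n j v : ℕ} {LA : ℕ → ℕ} (hjn : j ≤ n) (hj : LA j = 0) (h : IsPred LA j v) :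
    IsPrev n LA j v := by
  obtain ⟨h1, h2, h3⟩ := h
  rcases Nat.eq_zero_or_pos v with rfl | hv
  · refine Or.inr ⟨rfl, fun l hl hl0 hn => ?_⟩
    rcases Nat.lt_or_ge n l with h | h
    · have h4 : IsNext n LA l (n + 1) := ⟨Or.inl rfl, by
        rintro x (hx | hx)
        · rw [Set.mem_singleton_iff.1 hx]
        · simp only [Set.mem_ofPred_eq] at hx; omega⟩
      have := hn.unique h4
      omega
    · have h4 := (isNext_iff h).1 hn
      exact h3 l h4.1 (by omega) hl0
  · exact Or.inl ⟨hv, h2 hv, (isNext_iff (by omega)).2 ⟨h1, by omega, fun _ => hj,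
      fun l h4 h5 => h3 l h5 h4⟩⟩

/-- The positions `j` with `LA[j] = 0` form a doubly linked list in `A`. -/
def Merged.Linked (n : ℕ) (s : Merged) : Prop :=
  ∀ j, 1 ≤ j → j ≤ n → s.LA j = 0 → IsNext n s.LA j (s.A j) ∧ IsPred s.LA j (s.prev j)

theorem Merged.linked_init (n : ℕ) : Merged.init.Linked n := by
  intro j h1 hj _
  rw [isNext_iff hj]
  simp only [Merged.init, Merged.prev, IsPred, if_true]
  refine ⟨⟨by omega, by omega, by simp, by omega⟩, ?_⟩
  split_ifs
  · exact ⟨by omega, by simp, by omega⟩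
  · exact ⟨by omega, by simp, by omega⟩

/-- An iteration takes `j` out of the list. -/
theorem Merged.Linked.step {n j : ℕ} {s : Merged} (h : s.Linked n) (hj : 1 ≤ j) (hjn : j ≤ n)
    (h0 : s.LA j = 0) : (s.step n j).Linked n := by
  obtain ⟨hnext, hprev⟩ := h j hj hjn h0
  rw [isNext_iff hjn] at hnext
  obtain ⟨n1, n2, n3, n4⟩ := hnext
  obtain ⟨p1, p2, p3⟩ := hprev
  set q := s.A j with hq
  set p := s.prev j with hp
  have hLA : ∀ i, (s.step n j).LA i = if i = j then q - j else s.LA i := fun i => by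
    simp only [Merged.step, Function.update_apply, ← hq]
  have hA : ∀ i, (s.step n j).A i = if q < n + 1 ∧ i = q - 1 then p
      else if 0 < p ∧ i = p then q else s.A i := fun i => by
    simp only [Merged.step, ← hq, ← hp]
    by_cases c1 : q < n + 1 <;> by_cases c2 : 0 < p <;> simp [c1, c2, Function.update_apply]
  have hz : ∀ i, (s.step n j).LA i = 0 ↔ i ≠ j ∧ s.LA i = 0 := fun i => by
    rw [hLA]; split_ifs with h1
    · simp [h1]; omega
    · simp [h1]
  intro i hi hin hi0
  obtain ⟨hij, hi0'⟩ := (hz i).1 hi0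
  obtain ⟨hin', hip⟩ := h i hi hin hi0'
  rw [isNext_iff hin] at hin' ⊢
  obtain ⟨a1, a2, a3, a4⟩ := hin'
  obtain ⟨b1, b2, b3⟩ := hip
  simp only [IsPred, ne_eq, hz]
  -- no element of the list lies strictly between `p` and `j` or between `j` and `q`
  have hiq : ¬ (j < i ∧ i < q) := fun hh => n4 i hh.1 hh.2 hi0'
  have hip : ¬ (p < i ∧ i < j) := fun hh => p3 i hh.2 hh.1 hi0'
  constructor
  · rw [hA, if_neg (by omega)]
    split_ifs with hc
    · exact ⟨by omega, n2, fun hq => ⟨by omega, n3 hq⟩, fun l h1 h2 ⟨h3, h4⟩ => by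
        rcases Nat.lt_or_gt_of_ne h3 with h5 | h5
        · exact p3 l h5 (by omega) h4
        · exact n4 l h5 h2 h4⟩
    · have hne : s.A i ≠ j := by
        intro he
        have hip' : i < p := by omega
        exact a4 p hip' (by omega) (p2 (by omega))
      exact ⟨a1, a2, fun h => ⟨hne, a3 h⟩, fun l h1 h2 h3 => a4 l h1 h2 h3.2⟩
  · have hprev' : (s.step n j).prev i = if i ≤ 1 then 0 else
        if (s.step n j).LA (i - 1) = 0 then i - 1 else (s.step n j).A (i - 1) := rfl
    rw [hprev']
    rcases Nat.lt_or_ge 1 i with h1 | h1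
    swap
    · rw [if_pos h1]; exact ⟨by omega, by omega, by omega⟩
    rw [if_neg (by omega)]
    by_cases hz1 : (s.step n j).LA (i - 1) = 0
    · rw [if_pos hz1]
      exact ⟨by omega, fun _ => (hz _).1 hz1, by omega⟩
    rw [if_neg hz1, hA]
    rw [hz] at hz1
    by_cases hiq' : i = q
    · rw [if_pos (by omega)]
      refine ⟨by omega, fun h => ⟨by omega, p2 h⟩, fun l h1 h2 ⟨h3, h4⟩ => ?_⟩
      rcases Nat.lt_or_gt_of_ne h3 with h5 | h5
      · exact p3 l h5 h2 h4
      · exact n4 l h5 (by omega) h4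
    · have hij' : i - 1 ≠ j := fun he => by
        rcases Nat.lt_or_gt_of_ne hiq' with h5 | h5
        · omega
        · omega
      have hLA1 : s.LA (i - 1) ≠ 0 := fun he => hz1 ⟨hij', he⟩
      have hpi : ¬ (0 < p ∧ i - 1 = p) := fun hh => hLA1 (hh.2 ▸ p2 hh.1)
      rw [if_neg (by omega), if_neg hpi]
      have hold : s.prev i = s.A (i - 1) := by
        simp only [Merged.prev]
        rw [if_neg (by omega), if_neg hLA1]
      rw [hold] at b1 b2 b3
      refine ⟨b1, fun h => ⟨fun he => ?_, b2 h⟩, fun l h1 h2 h3 => b3 l h1 h2 h3.2⟩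
      have h5 : q < i := by omega
      exact b3 q h5 (by omega) (n3 (by omega))

/-- The state after `m` iterations, in terms of suffixes: `LA` is final at the positions of the
`m` largest suffixes, and `0` elsewhere. -/
structure Merged.AfterRun (T : List ℕ) (SA : ℕ → ℕ) (m : ℕ) (s : Merged) : Prop where
  linked : s.Linked T.length
  zero : ∀ i, 1 ≤ i → i ≤ T.length - m → s.LA (SA i) = 0
  next : ∀ i, T.length - m < i → i ≤ T.length →
    ∃ N, IsNextSmaller T (SA i) N ∧ s.LA (SA i) = N - SA i

theorem IsSuffixArray.inj {T : List ℕ} {SA : ℕ → ℕ} (h : IsSuffixArray T SA) {i j : ℕ}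
    (hi : 1 ≤ i) (hin : i ≤ T.length) (hj : 1 ≤ j) (hjn : j ≤ T.length) (he : SA i = SA j) :
    i = j := by
  by_contra hne
  rcases Nat.lt_or_gt_of_ne hne with h' | h'
  · have := h.2 i j hi h' hjn
    rw [he] at this; exact lt_irrefl _ this
  · have := h.2 j i hj h' hin
    rw [he] at this; exact lt_irrefl _ this

theorem IsSuffixArray.surj {T : List ℕ} {SA : ℕ → ℕ} (h : IsSuffixArray T SA) {l : ℕ}
    (hl : 1 ≤ l) (hln : l ≤ T.length) : ∃ i, 1 ≤ i ∧ i ≤ T.length ∧ SA i = l := by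
  obtain ⟨a, ha, he⟩ := exists_eq_of_inj_of_lt (f := fun a => SA (a + 1) - 1) (L := T.length)
    (y := l - 1) (fun a ha => by have := h.1 (a + 1) (by omega) (by omega); omega)
    (fun a ha b hb hab => by
      have h1 := h.1 (a + 1) (by omega) (by omega)
      have h2 := h.1 (b + 1) (by omega) (by omega)
      have := h.inj (i := a + 1) (j := b + 1) (by omega) (by omega) (by omega) (by omega)
        (by have : SA (a + 1) - 1 = SA (b + 1) - 1 := hab; omega)
      omega) (by omega)
  have h1 := h.1 (a + 1) (by omega) (by omega)
  exact ⟨a + 1, by omega, by omega, by omega⟩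

/-- When `j` is processed, exactly the positions with smaller suffixes are left in the list beside
`j`, so the next element of the list is the next position with a smaller suffix. -/
theorem Merged.afterRun {T : List ℕ} {SA : ℕ → ℕ} (h : IsSuffixArray T SA) (m : ℕ)
    (hm : m ≤ T.length) : (Merged.run T.length SA m).AfterRun T SA m := by
  induction m with
  | zero => exact ⟨Merged.linked_init _, fun _ _ _ => rfl, fun i h1 h2 => by omega⟩
  | succ m ih =>
    obtain ⟨h1, h2, h3⟩ := ih (by omega)
    set s := Merged.run T.length SA m with hs
    set j := SA (T.length - m) with hj
    have hj' := h.1 (T.length - m) (by omega) (by omega)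
    have hj0 : s.LA j = 0 := h2 _ (by omega) le_rfl
    have hstep : Merged.run T.length SA (m + 1) = s.step T.length j := rfl
    have hLA : ∀ i, (s.step T.length j).LA i = if i = j then s.A j - j else s.LA i := fun i => by
      simp only [Merged.step, Function.update_apply]
    have hnext := (isNext_iff hj'.2).1 (h1 j hj'.1 hj'.2 hj0).1
    obtain ⟨n1, n2, n3, n4⟩ := hnext
    rw [hstep]
    refine ⟨h1.step hj'.1 hj'.2 hj0, fun i hi hi' => ?_, fun i hi hi' => ?_⟩
    · rw [hLA, if_neg]
      · exact h2 i hi (by omega)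
      · intro he
        have := h.inj hi (by omega) (by omega) (by omega) he
        omega
    · rw [hLA]
      rcases Nat.lt_or_ge (T.length - m) i with h4 | h4
      · rw [if_neg]
        · exact h3 i h4 hi'
        · intro he
          have := h.inj (by omega) (by omega) (by omega) (by omega) he
          omega
      · obtain rfl : i = T.length - m := by omega
        rw [if_pos rfl]
        refine ⟨s.A j, ⟨n1, n2, fun hle => ?_, fun k hk hk' => ?_⟩, rfl⟩
        · -- a position that is not processed yet has a smaller suffix
          obtain ⟨i, hi1, hi2, hi3⟩ := h.surj (l := s.A j) (by omega) hle
          have h0 := n3 hle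
          rw [← hi3] at h0 n1 ⊢
          rcases Nat.lt_or_ge (T.length - m) i with h5 | h5
          · obtain ⟨N, hN, hN'⟩ := h3 i h5 hi2
            have := hN.lt
            omega
          · refine h.2 i _ hi1 ?_ (by omega)
            rcases Nat.lt_or_ge i (T.length - m) with h6 | h6
            · exact h6
            · obtain rfl : i = T.length - m := by omega
              omega
        · obtain ⟨i, hi1, hi2, rfl⟩ := h.surj (l := k) (by omega) (by omega)
          refine h.2 _ i (by omega) ?_ hi2
          by_contra hn
          exact n4 _ hk hk' (h2 i hi1 (by omega))

theorem Merged.run_isLyndonArray {T : List ℕ} {SA : ℕ → ℕ} (h : IsSuffixArray T SA) :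
    IsLyndonArray T (Merged.run T.length SA T.length).LA := by
  intro j h1 h2
  obtain ⟨i, hi1, hi2, rfl⟩ := h.surj h1 h2
  obtain ⟨N, hN, hN'⟩ := (Merged.afterRun h _ le_rfl).next i (by omega) hi2
  rw [hN']
  exact hN.isGreatest h1

/-! ### The output arrays -/

/-- The order of suffixes in terms of padded strings agrees with the lexicographic order of
lists. -/
theorem SufLt.drop_lt {T : List ℕ} (hT : ∀ x ∈ T, 1 ≤ x) {i j : ℕ}
    (h : SufLt (fun i => T.getD i 0) i j) : T.drop i < T.drop j := by
  obtain ⟨d, hd, hlt⟩ := h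
  induction d generalizing i j with
  | zero =>
    simp only [Nat.add_zero] at hlt
    have hj : j < T.length := by
      by_contra hn
      rw [List.getD_eq_default T _ (by omega : T.length ≤ j)] at hlt
      omega
    rw [List.getD_eq_getElem _ _ hj] at hlt
    rw [List.drop_eq_getElem_cons hj]
    rcases Nat.lt_or_ge i T.length with hi | hi
    · rw [List.getD_eq_getElem _ _ hi] at hlt
      rw [List.drop_eq_getElem_cons hi, List.cons_lt_cons_iff]
      exact Or.inl hlt
    · rw [List.drop_eq_nil_of_le hi]
      exact List.nil_lt_cons _ _
  | succ d ih =>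
    have hj : j < T.length := by
      by_contra hn
      simp only at hlt
      rw [List.getD_eq_default T _ (by omega : T.length ≤ j + (d + 1))] at hlt
      omega
    have h0 := hd 0 (by omega)
    simp only [Nat.add_zero] at h0
    rw [List.getD_eq_getElem _ _ hj] at h0
    have hi : i < T.length := by
      by_contra hn
      rw [List.getD_eq_default T _ (by omega : T.length ≤ i)] at h0
      have := hT _ (List.getElem_mem hj)
      omega
    rw [List.getD_eq_getElem _ _ hi] at h0
    rw [List.drop_eq_getElem_cons hi, List.drop_eq_getElem_cons hj, List.cons_lt_cons_iff]
    refine Or.inr ⟨h0, ih (fun t ht => ?_) ?_⟩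
    · have := hd (t + 1) (by omega)
      rwa [show i + (t + 1) = i + 1 + t by omega, show j + (t + 1) = j + 1 + t by omega] at this
    · rwa [show i + (d + 1) = i + 1 + d by omega, show j + (d + 1) = j + 1 + d by omega] at hlt

/-- Positions are counted from `0` in `IsSA` and from `1` in `IsSuffixArray`. -/
theorem IsSA.isSuffixArray {T : List ℕ} (hT : ∀ x ∈ T, 1 ≤ x) {A : ℕ → ℕ}
    (h : IsSA (fun i => T.getD i 0) T.length A) : IsSuffixArray T fun i => A (i - 1) + 1 := by
  refine ⟨fun i h1 h2 => ?_, fun i j hi hij hj => ?_⟩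
  · exact ⟨Nat.le_add_left 1 _, h.1 (i - 1) (by omega)⟩
  · exact SufLt.drop_lt hT (h.2 (i - 1) (j - 1) (by omega) (by omega))

/-- Moves the sorted positions from row `0` to the cells of the array `SA`. The cells are filled
from the last one down, so that none is overwritten before it is read. -/
def spreadOut : Stmt :=
  .seq (.set .a 0) (.loop .lt Var.a .textLen
    (.seq (.put (.textLen - 1 - Var.a) 0 (.get 0 (.textLen - 1 - Var.a) + 1))
      (.set .a (Var.a + 1))))

theorem spreadOut_run (hM : M.Fits) {h : View} (hA : ∀ i < M.text.length, h.mem i < M.text.length) :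
    spreadOut.RunIn M h (M.text.length + 1) fun h' =>
      ∀ i < M.text.length, h'.mem (3 * i) = h.mem i + 1 := by
  have hw := hM.bits
  have size : M.size = 3 * M.text.length + M.alphabetSize + 100 := rfl
  refine Stmt.RunIn.count hM (fun k h' => h'.v .a = k ∧
    (∀ i < M.text.length - k, h'.mem i = h.mem i) ∧
    ∀ i < M.text.length, M.text.length - k ≤ i → h'.mem (3 * i) = h.mem i + 1) M.text.length le_rfl
    (by simp) (by simp) (by simp) (by simp [Stmt.Simple]) (by simp) ?_ ?_ ?_ ?_
  · rintro k hk h' ⟨ha, -⟩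
    simp [ha]
  · rintro k hk h' ⟨ha, h1, h2⟩
    simp only [Stmt.wp, ok_add, ok_sub, ok_var, ok_ofNat, ok_textLen, ok_get, eval_add, eval_sub,
      eval_var, eval_ofNat, eval_textLen, eval_get, ha, true_and, Nat.mul_zero, Nat.zero_add,
      View.put_v, View.put_mem, View.set_v, View.set_mem, if_true, Nat.add_zero, and_true]
    have hlast := h1 (M.text.length - 1 - k) (by omega)
    have hb := hA (M.text.length - 1 - k) (by omega)
    rw [hlast]
    refine ⟨by omega, by omega, by omega, by omega, by omega, fun i hi => ?_, fun i hi hik => ?_⟩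
    · rw [if_neg (by omega)]; exact h1 i (by omega)
    · split_ifs with hc
      · rw [show i = M.text.length - 1 - k by omega]
      · exact h2 i hi (by omega)
  · simp only [View.set_v, View.set_mem, eval_ofNat, if_true]
    exact ⟨trivial, fun i _ => trivial, by omega⟩
  · rintro h' ⟨-, -, h2⟩ i hi
    exact h2 i hi (by omega)

/-- The arrays `LA` and `A` as they are stored in the flat memory. -/
def Merged.Stored (n : ℕ) (s : Merged) (mem : ℕ → ℕ) : Prop :=
  ∀ i < n, mem (3 * i + 1) = s.LA (i + 1) ∧ mem (3 * i + 2) = s.A (i + 1)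

/-- Sets `LA` and `A` to their initial contents. -/
def initMerged : Stmt :=
  .seq (.set .a 0) (.loop .lt Var.a .textLen
    (.seq (.put Var.a 1 0) <| .seq (.put Var.a 2 (Var.a + 2)) (.set .a (Var.a + 1))))

theorem initMerged_run (hM : M.Fits) {h : View} :
    initMerged.RunIn M h (M.text.length + 1) fun h' =>
      (∀ i < M.text.length, h'.mem (3 * i) = h.mem (3 * i)) ∧
        Merged.init.Stored M.text.length h'.mem := by
  have hw := hM.bits
  have size : M.size = 3 * M.text.length + M.alphabetSize + 100 := rfl
  refine Stmt.RunIn.count hM (fun k h' => h'.v .a = k ∧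
    (∀ i < M.text.length, h'.mem (3 * i) = h.mem (3 * i)) ∧ Merged.init.Stored k h'.mem)
    M.text.length le_rfl (by simp) (by simp) (by simp) (by simp [Stmt.Simple]) (by simp) ?_ ?_ ?_ ?_
  · rintro k hk h' ⟨ha, -⟩
    simp [ha]
  · rintro k hk h' ⟨ha, h1, h2⟩
    simp only [Stmt.wp, ok_add, ok_var, ok_ofNat, eval_add, eval_var, eval_ofNat, ha, true_and,
      View.put_v, View.put_mem, View.set_v, View.set_mem, if_true, Merged.Stored]
    refine ⟨by omega, by omega, by omega, by omega, by omega, by omega, by omega,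
      fun i hi => ?_, fun i hi => ⟨?_, ?_⟩⟩
    · rw [if_neg (by omega), if_neg (by omega)]; exact h1 i hi
    · rw [if_neg (by omega)]
      split_ifs with hc
      · rfl
      · exact (h2 i (by omega)).1
    · split_ifs with hc
      · simp only [Merged.init]; omega
      · omega
      · exact (h2 i (by omega)).2
  · simp only [View.set_v, View.set_mem, eval_ofNat, if_true]
    exact ⟨trivial, fun i _ => trivial, fun i hi => by omega⟩
  · exact fun h' hh' => hh'.2

/-- The iterations on the merged array. -/
def runMerged : Stmt :=
  .seq (.set .a 0) (.loop .lt Var.a .textLen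
    (.seq (.set .j (.get (.textLen - 1 - Var.a) 0)) <|
      .seq (.set .q (.get (Var.j - 1) 2)) <|
      .seq (.set .x (.ite .le Var.j 1 0 (.ite .eq (.get (Var.j - 2) 1) 0 (Var.j - 1)
        (.get (Var.j - 2) 2)))) <|
      .seq (.put (Var.j - 1) 1 (Var.q - Var.j)) <|
      .seq (.ite .lt 0 Var.x (.put (Var.x - 1) 2 Var.q) (.set .c 0)) <|
      .seq (.ite .lt Var.q (.textLen + 1) (.put (Var.q - 2) 2 Var.x) (.set .c 0)) <|
      .set .a (Var.a + 1)))

/-- The columns `0`, `1`, `2` of the rows below `n` are the arrays `SA`, `LA` and `A`. -/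
theorem runMerged_run (hM : M.Fits) {SA : ℕ → ℕ} (hSA : IsSuffixArray M.text SA) {h : View}
    (h1 : ∀ i < M.text.length, h.mem (3 * i) = SA (i + 1))
    (h2 : Merged.init.Stored M.text.length h.mem) :
    runMerged.RunIn M h (M.text.length + 1) fun h' =>
      (∀ i < M.text.length, h'.mem (3 * i) = SA (i + 1)) ∧
        (Merged.run M.text.length SA M.text.length).Stored M.text.length h'.mem := by
  classical
  have hw := hM.bits
  have size : M.size = 3 * M.text.length + M.alphabetSize + 100 := rfl
  refine Stmt.RunIn.count hM (fun k h' => h'.v .a = k ∧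
    (∀ i < M.text.length, h'.mem (3 * i) = SA (i + 1)) ∧
      (Merged.run M.text.length SA k).Stored M.text.length h'.mem)
    M.text.length le_rfl (by simp) (by simp) (by simp) (by simp [Stmt.Simple]) (by simp) ?_ ?_ ?_ ?_
  · rintro k hk h' ⟨ha, -⟩
    simp only [ok_var, ok_textLen, eval_var, eval_textLen, ha, holds_lt, true_and]
  · rintro k hk h' ⟨ha, hm, hs⟩
    have hrun := Merged.afterRun hSA k hk.le
    have hstep : Merged.run M.text.length SA (k + 1) =
      (Merged.run M.text.length SA k).step M.text.length (SA (M.text.length - k)) := rfl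
    rw [hstep]
    set s := Merged.run M.text.length SA k
    have hj := hSA.1 (M.text.length - k) (by omega) (by omega)
    have h0 := hrun.zero (M.text.length - k) (by omega) le_rfl
    obtain ⟨hnext, hpred⟩ := hrun.linked _ hj.1 hj.2 h0
    rw [isNext_iff hj.2] at hnext
    have hm0 : h'.mem (3 * (M.text.length - 1 - k) + 0) = SA (M.text.length - k) := by
      rw [Nat.add_zero, hm _ (by omega)]; congr 1; omega
    set j := SA (M.text.length - k)
    have hq : h'.mem (3 * (j - 1) + 2) = s.A j := by
      rw [(hs (j - 1) (by omega)).2]; congr 1; omega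
    obtain ⟨n1, n2, -, -⟩ := hnext
    have p1 := hpred.1
    set q := s.A j with hqd
    set h'' := (h'.set .j j).set .q q with hh''
    have hx : (Expr.ite .le Var.j 1 0 (.ite .eq (.get (Var.j - 2) 1) 0 (Var.j - 1)
        (.get (Var.j - 2) 2))).Ok M h'' ∧ (Expr.ite .le Var.j 1 0 (.ite .eq (.get (Var.j - 2) 1) 0
        (Var.j - 1) (.get (Var.j - 2) 2))).eval M h'' = s.prev j := by
      simp only [ok_ite, eval_ite, ok_var, ok_ofNat, eval_var, eval_ofNat, holds_le, holds_eq,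
        ok_get, eval_get, ok_sub, eval_sub, true_and, hh'', View.set_v, View.set_mem, reduceCtorEq,
        if_false, if_true, Merged.prev]
      rcases Nat.lt_or_ge 1 j with hj1 | hj1
      · have := hs (j - 2) (by omega)
        rw [show j - 2 + 1 = j - 1 by omega] at this
        rw [this.1, this.2]
        exact ⟨by omega, rfl⟩
      · exact ⟨by omega, by simp [hj1]⟩
    set p := s.prev j with hpd
    have hLA : ∀ i, (s.step M.text.length j).LA i = if i = j then q - j else s.LA i := fun i => by
      simp only [Merged.step, Function.update_apply, ← hqd]
    have hA : ∀ i, (s.step M.text.length j).A i = if q < M.text.length + 1 ∧ i = q - 1 then p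
        else if 0 < p ∧ i = p then q else s.A i := fun i => by
      simp only [Merged.step, ← hqd, ← hpd]
      by_cases c1 : q < M.text.length + 1 <;> by_cases c2 : 0 < p <;>
        simp [c1, c2, Function.update_apply]
    simp only [Stmt.wp, ok_add, ok_sub, ok_var, ok_ofNat, ok_textLen, ok_get, eval_add, eval_sub,
      eval_var, eval_ofNat, eval_textLen, eval_get, ha, true_and, View.put_v, View.put_mem,
      View.set_v, View.set_mem, if_true, if_false, reduceCtorEq, hm0, hq, ← hh'', hx,
      holds_lt]
    have fin : ∀ mem f : ℕ → ℕ,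
        (∀ a, mem a = if q < M.text.length + 1 ∧ a = 3 * (q - 2) + 2 then p else
          if 0 < p ∧ a = 3 * (p - 1) + 2 then q else
          if a = 3 * (j - 1) + 1 then q - j else h'.mem a) → (∀ i, f i = mem (3 * i)) →
        (∀ i < M.text.length, f i = SA (i + 1)) ∧
          (s.step M.text.length j).Stored M.text.length mem := by
      intro mem f hmem hf
      refine ⟨fun i hi => ?_, fun i hi => ⟨?_, ?_⟩⟩
      · rw [hf, hmem, if_neg (by omega), if_neg (by omega), if_neg (by omega)]
        exact hm i hi
      · rw [hmem, if_neg (by omega), if_neg (by omega), hLA]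
        exact if_congr (by omega) rfl (hs i hi).1
      · rw [hmem, hA]
        refine if_congr (by omega) rfl (if_congr (by omega) rfl ?_)
        rw [if_neg (by omega)]
        exact (hs i hi).2
    have hv : h''.v .j = j ∧ h''.v .q = q ∧ h''.v .a = k ∧ h''.mem = h'.mem := by
      simp [hh'', ha]
    obtain ⟨v1, v2, v3, v4⟩ := hv
    simp only [v1, v2, v3, v4]
    refine ⟨⟨⟨by omega, trivial⟩, by omega, by omega⟩, by omega, by omega, by omega, by omega,
      by omega, fun c2 => ⟨by omega, by omega, by omega, by omega,
        fun c1 => ⟨by omega, by omega, by omega, by omega, trivial, fin _ _ (fun a => ?_) fun i => ?_⟩,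
        fun c1 => ⟨by omega, by omega, trivial, fin _ _ (fun a => ?_) fun i => ?_⟩⟩,
      fun c2 => ⟨by omega, by omega,
        fun c1 => ⟨by omega, by omega, by omega, by omega, trivial, fin _ _ (fun a => ?_) fun i => ?_⟩,
        fun c1 => ⟨by omega, by omega, trivial,
          fin _ _ (fun a => ?_) fun i => ?_⟩⟩⟩ <;>
    simp [c1, c2, v4]
  · simp only [View.set_v, View.set_mem, eval_ofNat, if_true]
    exact ⟨trivial, h1, h2⟩
  · exact fun h' hh' => hh'.2

/-- Computes the suffix array and the Lyndon array. -/
def computeArrays : Stmt :=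
  .seq sortSuffixes <| .seq spreadOut <| .seq initMerged runMerged

theorem computeArrays_run : ∃ C, ∀ M : Machine, M.Fits →
    (∀ x ∈ M.text, 1 ≤ x ∧ x ≤ M.alphabetSize) → ∀ h : View,
    computeArrays.Run M h (C * (M.text.length + M.alphabetSize)) fun h' =>
      ∃ SA, IsSuffixArray M.text SA ∧ ∀ i < M.text.length, h'.mem (3 * i) = SA (i + 1) ∧
        h'.mem (3 * i + 1) = (Merged.run M.text.length SA M.text.length).LA (i + 1) := by
  obtain ⟨C, hC⟩ := sortSuffixes_run
  refine ⟨C + 2 * (spreadOut.compile.cost + (initMerged.compile.cost + runMerged.compile.cost)),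
    fun M hM hT h => ?_⟩
  have hn := hM.pos
  refine ((hC M hM hT h).seq fun h1 r1 => (spreadOut_run hM r1.1).seq (Q := fun h' =>
      ∃ SA, IsSuffixArray M.text SA ∧ ∀ i < M.text.length, h'.mem (3 * i) = SA (i + 1) ∧
        h'.mem (3 * i + 1) = (Merged.run M.text.length SA M.text.length).LA (i + 1))
      fun h2 r2 => (initMerged_run hM).seq fun h3 r3 => (runMerged_run hM
        (r1.isSuffixArray fun x hx => (hT x hx).1) (fun i hi => ?_) r3.2).mono le_rfl
        fun h4 r4 => ⟨_, r1.isSuffixArray fun x hx => (hT x hx).1, fun i hi =>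
          ⟨r4.1 i hi, (r4.2 i hi).1⟩⟩).mono ?_ fun _ h => h
  · rw [r3.1 i hi, r2 i hi]; rfl
  · have h1 : M.text.length + 1 ≤ 2 * (M.text.length + M.alphabetSize) := by omega
    have e : (spreadOut.seq (initMerged.seq runMerged)).compile.cost =
      spreadOut.compile.cost + (initMerged.compile.cost + runMerged.compile.cost) := rfl
    rw [e]
    have := Nat.mul_le_mul_right
      (spreadOut.compile.cost + (initMerged.compile.cost + runMerged.compile.cost)) h1
    nlinarith

theorem mem_sa_eq (s : State 64) {i : ℕ} (h1 : 1 ≤ i) (h2 : i ≤ M.text.length) :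
    s.mem .sa i = (view M s).mem (3 * (i - 1)) := by
  have : cellOf M.text.length (3 * (i - 1)) = (.sa, i) := by
    simp only [cellOf]
    rw [if_pos (by omega), if_pos (by omega), show 3 * (i - 1) / 3 + 1 = i by omega]
  simp [view, this]

theorem mem_la_eq (s : State 64) {i : ℕ} (h1 : 1 ≤ i) (h2 : i ≤ M.text.length) :
    s.mem .la i = (view M s).mem (3 * (i - 1) + 1) := by
  have : cellOf M.text.length (3 * (i - 1) + 1) = (.la, i) := by
    simp only [cellOf]
    rw [if_pos (by omega), if_neg (by omega), if_pos (by omega),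
      show (3 * (i - 1) + 1) / 3 + 1 = i by omega]
  simp [view, this]

theorem IsSuffixArray.congr {T : List ℕ} {S S' : ℕ → ℕ} (h : IsSuffixArray T S)
    (he : ∀ i, 1 ≤ i → i ≤ T.length → S' i = S i) : IsSuffixArray T S' := by
  refine ⟨fun i h1 h2 => ?_, fun i j h1 h2 h3 => ?_⟩
  · rw [he i h1 h2]; exact h.1 i h1 h2
  · rw [he i h1 (by omega), he j (by omega) h3]; exact h.2 i j h1 h2 h3

theorem IsLyndonArray.congr {T : List ℕ} {L L' : ℕ → ℕ} (h : IsLyndonArray T L)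
    (he : ∀ i, 1 ≤ i → i ≤ T.length → L' i = L i) : IsLyndonArray T L' := fun i h1 h2 => by
  rw [he i h1 h2]; exact h i h1 h2

end LyndonSA

/-- There is one word-RAM program that computes the suffix array and the Lyndon array of every
string of length `n` over `{1, …, σ}` in at most `c * (n + σ)` steps (so in `O(n)` steps for a
fixed alphabet) with working space `k` registers plus `n + σ + e` cells, where `k`, `e`, `c` do not
depend on the input. Moreover NEXT and PREV can be kept together in one array `A`. -/
theorem mainTheorem2 :
    (∃ (k e c : ℕ) (P : LyndonSA.Cmd k),
      ∀ (σ : ℕ) (T : List ℕ), (∀ x ∈ T, 1 ≤ x ∧ x ≤ σ) → LyndonSA.EndsWithSentinel T →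
      ∀ w : ℕ, T.length + σ + (k + e) < 2 ^ w →
      ∀ s : LyndonSA.State k, s.HoldsWords w →
        ∃ (t : ℕ) (s' : LyndonSA.State k),
          LyndonSA.Exec
            { wordBits := w, text := T, alphabetSize := σ, workLen := T.length + σ + e }
            P s t s' ∧
          t ≤ c * (T.length + σ) ∧
          LyndonSA.IsSuffixArray T (s'.mem LyndonSA.Arr.sa) ∧
          LyndonSA.IsLyndonArray T (s'.mem LyndonSA.Arr.la)) ∧
    (∀ (T : List ℕ) (SA : ℕ → ℕ), LyndonSA.EndsWithSentinel T → LyndonSA.IsSuffixArray T SA →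
      (∀ m ≤ T.length, ∀ j, 1 ≤ j → j ≤ T.length →
        (LyndonSA.Merged.run T.length SA m).LA j = 0 →
          LyndonSA.IsNext T.length (LyndonSA.Merged.run T.length SA m).LA j
            ((LyndonSA.Merged.run T.length SA m).A j) ∧
          LyndonSA.IsPrev T.length (LyndonSA.Merged.run T.length SA m).LA j
            ((LyndonSA.Merged.run T.length SA m).prev j)) ∧
      LyndonSA.IsLyndonArray T (LyndonSA.Merged.run T.length SA T.length).LA) := by
  constructor
  · obtain ⟨C, hC⟩ := LyndonSA.computeArrays_run
    -- the temporaries are the last 44 of the 64 registers; the 100 additional cells give short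
    -- texts the room that `topAt_ge` asks for
    refine ⟨64, 100, C, LyndonSA.computeArrays.compile, fun σ T hT hz w hw s _ => ?_⟩
    let M : LyndonSA.Machine :=
      { wordBits := w, text := T, alphabetSize := σ, workLen := T.length + σ + 100 }
    have hpos : 1 ≤ T.length := by
      obtain ⟨S, z, rfl, -⟩ := hz
      simp
    have hM : M.Fits := ⟨hpos, rfl, hw⟩
    obtain ⟨t, ht, s', hx, SA, hSA, hmem⟩ := hC M hM hT _ s rfl
    refine ⟨t, s', hx, ht, hSA.congr fun i h1 h2 => ?_,
      (LyndonSA.Merged.run_isLyndonArray hSA).congr fun i h1 h2 => ?_⟩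
    · rw [LyndonSA.mem_sa_eq (M := M) s' h1 h2, (hmem (i - 1) (by omega)).1, Nat.sub_add_cancel h1]
    · rw [LyndonSA.mem_la_eq (M := M) s' h1 h2, (hmem (i - 1) (by omega)).2, Nat.sub_add_cancel h1]
  · intro T SA _ hSA
    refine ⟨fun m hm j h1 h2 h0 => ?_, LyndonSA.Merged.run_isLyndonArray hSA⟩
    obtain ⟨hn, hp⟩ := (LyndonSA.Merged.afterRun hSA m hm).linked j h1 h2 h0
    exact ⟨hn, hp.isPrev h2 h0⟩
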